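/- Let $I=[-1,1]$ and let $\mathcal F$ be the space of smooth ($C^\infty$) functions $f$ on $I$ with $f'>0$ (smooth increasing diffeomorphisms of $I$ onto their images), with the $C^\infty$ topology (uniform convergence on $I$ of all derivatives). For $f\in\mathcal F$ put $$\varphi_0(y,p,q)=-py+q-f\Big(-\tfrac1p f(y)+\tfrac qp\Big),\qquad w=w(y,p,q)=\tfrac{q-f(y)}{p}.$$ The horizon of the surface $\varphi_0=0$ is the set $H$ of all $(y,p,q)$ with $y\in I$, $p>0$, $w\in I$ and $\varphi_0=\partial\varphi_0/\partial y=0$, and the apparent contour $\Lambda_0$ is its projection to the $(p,q)$-plane. If $(y,p,q)\in H$ then $(w,p,q)\in H$; the set $\{y,w\}$ is called the orbit of the point, and both points project to the same branch of $\Lambda_0$. The points with $y=w$ are the points $(y,L_0(y))$ with $L_0(y)=(f'(y),f'(y)y+f(y))$, $y\in I$; let $A$ be the set of $y\in I$ with $\partial^3\varphi_0/\partial y^3=0$ at $(y,L_0(y))$. An endpoint of $\Lambda_0$ is the projection of a point of $H$ whose orbit contains $1$ or $-1$. A self-intersection of $\Lambda_0$ is a point over which there are at least two different orbits. An ordinary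 cusp is a point near which $\Lambda_0$ is a smoothly parametrized curve $\gamma$, the projection of a smoothly parametrized piece of $H$, such that there $\gamma'=0$ and $\gamma'',\gamma'''$ are linearly independent. For a generic $f$ (all $f$ in a residual subset of $\mathcal F$) the following hold. 1. $\Lambda_0$ has only finitely many ordinary cusps, and $A$ is finite. For each $y\in A$, $\Lambda_0$ has a codimension-$2$ flip at $L_0(y)$: $y\in(-1,1)$; at $(y,L_0(y))$ one has $\partial^5\varphi_0/\partial y^5\ne0$, and the Jacobian determinant of $(\partial\varphi_0/\partial y,\partial^3\varphi_0/\partial y^3)$ with respect to $(p,q)$ is nonzero; and a local $C^1$ diffeomorphism of the plane carries $L_0(y)$ to $0$ and $\Lambda_0$ near $L_0(y)$ onto the apparent contour near $0$ of $G(y,p,q)=py+qy^3-y^5$, that is, onto $\{p=0\}\cup\{p=-q^2/4,\ q\ge0\}$. 2. Near each of its points that is neither an endpoint nor a self-intersection nor one of these cusps and flips, $\Lambda_0$ is a smooth arc, the regular projection of $H$ near any point of $H$ above it. 3. Near each self-intersection, $\Lambda_0$ is the union of two smooth arcs, the regular projections of $H$ near points of two different orbits, which cross transversally. There are never three different orbits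 over one point. 4. No endpoint of $\Lambda_0$ is a self-intersection, and no endpoint is a singular point: near an endpoint $\Lambda_0$ is a smooth arc ending there, the regular projection of $H$. -/

import Mathlib

open Set Filter Topology
open scoped ContDiff

/-- Smooth increasing diffeomorphisms of `[-1,1]` onto their image. A smooth function on the
compact interval is presented by a smooth function on the line extending it; everything below,
including the topology, depends only on the restriction to `[-1,1]`. -/
structure IncrDiffeo where
  toFun : ℝ → ℝ
  smooth : ContDiff ℝ ∞ toFun
  deriv_pos : ∀ y ∈ Icc (-1 : ℝ) 1, 0 < deriv toFun y

namespace IncrDiffeo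

instance : CoeFun IncrDiffeo (fun _ => ℝ → ℝ) := ⟨toFun⟩

/-- The `k`-th derivative, as a continuous function on `[-1,1]`. -/
noncomputable def jet (f : IncrDiffeo) (k : ℕ) : C(Icc (-1 : ℝ) 1, ℝ) where
  toFun x := iteratedDeriv k f x
  continuous_toFun :=
    (f.smooth.continuous_iteratedDeriv k (by exact_mod_cast le_top)).comp continuous_subtype_val

/-- The smooth topology on `[-1,1]`: uniform convergence on `[-1,1]` of every derivative. -/
noncomputable instance : TopologicalSpace IncrDiffeo := TopologicalSpace.induced jet inferInstance

end IncrDiffeo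

/-- The function `φ₀(y,p,q) = -py + q - f(-f(y)/p + q/p)`. -/
noncomputable def phi (f : IncrDiffeo) (y p q : ℝ) : ℝ :=
  -p * y + q - f (-(1 / p) * f y + q / p)

/-- The `k`-th partial derivative of `φ₀` with respect to `y`. -/
noncomputable def phiY (f : IncrDiffeo) (k : ℕ) (y p q : ℝ) : ℝ :=
  iteratedDeriv k (fun t => phi f t p q) y

/-- For `h = (y,p,q)`, the point `w = (q - f(y))/p`. If `φ₀(y,p,q) = 0`, then `{y, w}` is the orbit
(of period at most 2) of `y`, and `w` is a root of `φ₀(·,p,q)` as well. -/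
noncomputable def partner (f : IncrDiffeo) (h : ℝ × ℝ × ℝ) : ℝ :=
  -(1 / h.2.1) * f h.1 + h.2.2 / h.2.1

/-- The horizon of the surface `φ₀ = 0`: points `(y,p,q)` with `φ₀ = ∂φ₀/∂y = 0`. As `f` lives on
`[-1,1]`, both `y` and `w` range over `[-1,1]`; also `p > 0`. -/
def horizon (f : IncrDiffeo) : Set (ℝ × ℝ × ℝ) :=
  {h | h.1 ∈ Icc (-1 : ℝ) 1 ∧ 0 < h.2.1 ∧ partner f h ∈ Icc (-1 : ℝ) 1 ∧
    phi f h.1 h.2.1 h.2.2 = 0 ∧ phiY f 1 h.1 h.2.1 h.2.2 = 0}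

/-- The apparent contour `Λ₀`: the projection of the horizon to the `(p,q)`-plane. -/
def apparentContour (f : IncrDiffeo) : Set (ℝ × ℝ) := Prod.snd '' horizon f

/-- The curve `L₀(y) = (f'(y), f'(y) y + f(y))`, the part `y = w` of the apparent contour. -/
noncomputable def curveL (f : IncrDiffeo) (y : ℝ) : ℝ × ℝ :=
  (deriv f y, deriv f y * y + f y)

/-- `c`, smooth and injective on `[-ε,ε]`, parametrizes `S` near `x = c 0` when restricted to `J`.
It is used with `J = [-ε,ε]` (an arc through `x`) and with `J = [0,ε]` (an arc ending at `x`). -/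
structure IsLocalParam {E : Type*} [NormedAddCommGroup E] [NormedSpace ℝ E]
    (S : Set E) (x : E) (J : Set ℝ) (ε : ℝ) (c : ℝ → E) : Prop where
  pos : 0 < ε
  smooth : ContDiffOn ℝ ∞ c (Icc (-ε) ε)
  inj : InjOn c (Icc (-ε) ε)
  base : c 0 = x
  subset : c '' J ⊆ S
  mem_nhds : c '' J ∈ 𝓝[S] x

/-- `c` parametrizes the horizon near `h`, and its projection parametrizes the apparent contour
near the projection of `h`. -/
def IsContourParam (f : IncrDiffeo) (h : ℝ × ℝ × ℝ) (J : Set ℝ) (ε : ℝ)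
    (c : ℝ → ℝ × ℝ × ℝ) : Prop :=
  IsLocalParam (horizon f) h J ε c ∧
    IsLocalParam (apparentContour f) h.2 J ε (fun t => (c t).2)

/-- Near the projection of `h`, the apparent contour is a smooth arc (the regular projection of
the horizon near `h`). -/
def IsSmoothPoint (f : IncrDiffeo) (h : ℝ × ℝ × ℝ) : Prop :=
  ∃ (ε : ℝ) (c : ℝ → ℝ × ℝ × ℝ), IsContourParam f h (Icc (-ε) ε) ε c ∧
    deriv (fun t => (c t).2) 0 ≠ 0

/-- Near the projection of `h`, the apparent contour is a smooth arc ending at that point. -/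
def IsEndOfSmoothArc (f : IncrDiffeo) (h : ℝ × ℝ × ℝ) : Prop :=
  ∃ (ε : ℝ) (c : ℝ → ℝ × ℝ × ℝ), IsContourParam f h (Icc 0 ε) ε c ∧
    deriv (fun t => (c t).2) 0 ≠ 0

/-- The apparent contour has an ordinary cusp at the projection of `h`: it is locally a curve `γ`
with `γ' = 0` and `γ''`, `γ'''` linearly independent there. -/
def IsOrdinaryCusp (f : IncrDiffeo) (h : ℝ × ℝ × ℝ) : Prop :=
  ∃ (ε : ℝ) (c : ℝ → ℝ × ℝ × ℝ), IsContourParam f h (Icc (-ε) ε) ε c ∧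
    deriv (fun t => (c t).2) 0 = 0 ∧
    LinearIndependent ℝ
      ![iteratedDeriv 2 (fun t => (c t).2) 0, iteratedDeriv 3 (fun t => (c t).2) 0]

/-- The parameters `y` with `∂³φ₀/∂y³ = 0` at the point `(y, L₀(y))` of the horizon. -/
def flipSet (f : IncrDiffeo) : Set ℝ :=
  {y | y ∈ Icc (-1 : ℝ) 1 ∧ phiY f 3 y (curveL f y).1 (curveL f y).2 = 0}

/-- The Jacobian determinant of `(∂φ₀/∂y, ∂³φ₀/∂y³)` with respect to `(p,q)`. -/
noncomputable def flipJacobian (f : IncrDiffeo) (y p q : ℝ) : ℝ :=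
  deriv (fun s => phiY f 1 y s q) p * deriv (fun s => phiY f 3 y p s) q -
    deriv (fun s => phiY f 1 y p s) q * deriv (fun s => phiY f 3 y s q) p

/-- The apparent contour of `G = 0`, where `G(y,p,q) = py + qy³ - y⁵`: the line `p = 0` and the
half parabola `p = -q²/4`, `q ≥ 0`. -/
def flipModel : Set (ℝ × ℝ) :=
  {z | ∃ y : ℝ, z.1 * y + z.2 * y ^ 3 - y ^ 5 = 0 ∧ z.1 + 3 * z.2 * y ^ 2 - 5 * y ^ 4 = 0}

/-- The apparent contour has at `L₀(y)`, `y ∈ (-1,1)`, a codimension-2 flip: `∂³φ₀/∂y³ = 0`,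
`∂⁵φ₀/∂y⁵ ≠ 0`, the Jacobian above is nonzero, and a local `C¹` diffeomorphism of the plane
carries the contour to that of `G`. -/
def IsCodimTwoFlip (f : IncrDiffeo) (y : ℝ) : Prop :=
  y ∈ Ioo (-1 : ℝ) 1 ∧
  phiY f 3 y (curveL f y).1 (curveL f y).2 = 0 ∧
  phiY f 5 y (curveL f y).1 (curveL f y).2 ≠ 0 ∧
  flipJacobian f y (curveL f y).1 (curveL f y).2 ≠ 0 ∧
  ∃ Ψ : OpenPartialHomeomorph (ℝ × ℝ) (ℝ × ℝ),
    curveL f y ∈ Ψ.source ∧ Ψ (curveL f y) = 0 ∧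
    ContDiffOn ℝ 1 Ψ Ψ.source ∧ ContDiffOn ℝ 1 Ψ.symm Ψ.target ∧
    Ψ '' (apparentContour f ∩ Ψ.source) = flipModel ∩ Ψ.target

/-- `h` and `k` are horizon points with the same projection that belong to different orbits: the
apparent contour meets itself there. (The points `(y,p,q)` and `(w,p,q)` of one orbit always have
the same projection and give the same branch of the contour.) -/
def MeetAt (f : IncrDiffeo) (h k : ℝ × ℝ × ℝ) : Prop :=
  h ∈ horizon f ∧ k ∈ horizon f ∧ h.2 = k.2 ∧ k.1 ≠ h.1 ∧ k.1 ≠ partner f h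

/-- Near the common projection of `h` and `k` the apparent contour is the union of two smooth
arcs, the projections of the horizon near `h` and near `k`, that cross transversally. -/
def IsTransversalDouble (f : IncrDiffeo) (h k : ℝ × ℝ × ℝ) : Prop :=
  ∃ (ε δ : ℝ) (c d : ℝ → ℝ × ℝ × ℝ),
    IsLocalParam (horizon f) h (Icc (-ε) ε) ε c ∧
    IsLocalParam (horizon f) k (Icc (-δ) δ) δ d ∧
    LinearIndependent ℝ ![deriv (fun t => (c t).2) 0, deriv (fun t => (d t).2) 0] ∧
    (fun t => (c t).2) '' Icc (-ε) ε ∪ (fun t => (d t).2) '' Icc (-δ) δ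
      ∈ 𝓝[apparentContour f] h.2

/-- `h` lies over an endpoint of the apparent contour: its orbit contains `1` or `-1`. -/
def IsOverEndpoint (f : IncrDiffeo) (h : ℝ × ℝ × ℝ) : Prop :=
  h ∈ horizon f ∧ (h.1 = 1 ∨ h.1 = -1 ∨ partner f h = 1 ∨ partner f h = -1)

/-!
A point of the horizon over `(p,q)` is a fixed point or an orbit `{y, w}` of the map
`T(t) = (q - f(t)) / p` with `T²(y) = y` and `(T²)'(y) = 1`. On an orbit with two elements, `p` is
the slope of a chord, `p = (f(y) - f(w)) / (y - w)`, and the second condition is `f'(y) f'(w) = p²`.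
So the horizon is the curve `defect = 0` in the square of pairs `(y, w)`, together with the
diagonal, over which the contour is the curve `L₀`.

**Genericity.** All conditions on `f` are collected in `IsGeneric`. Each of them excludes a
multijet of `f` at one to six distinct points that is a `C¹` function of fewer parameters than it
has entries. By `residual_avoid` a generic `f` avoids such a family: `f` can be perturbed by Hermite
interpolation polynomials, the coefficients that hit the family form a `C¹` image of a space of
smaller dimension and so have dense complement, and compactness of the parameter sets gives
openness.

**Two-point orbits.** Along an arc of the horizon the projection moves in the direction
`(r - 1, r y - w)`, where `r = f'(y) / p`, with speed proportional to `f''(y) - r³ f''(w)`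
(`tangent_identity`). Where this factor is nonzero the projection is regular. Where it vanishes, its
derivative does not, and the front with a moving tangent direction has an ordinary cusp
(`cusp_of_front`).

**The diagonal.** The center and the half-length `s` of the chord from `w` to `y` are coordinates in
which `defect` is divisible by `s²`. The quotient `redDefect` is smooth and restricts to a multiple
of the Schwarzian derivative on the diagonal. Away from the zeros of the Schwarzian, `L₀` is
therefore the only branch, and it is an immersed curve.

**Flips.** At a zero of the Schwarzian, which is simple, the two-point orbits form a curve
parametrized by `s`, with center varying only to second order. In coordinates `(u, y)` adapted to
`L₀`, which becomes `u = 0`, this front has `y - y₀` of order `s²` and `u` of order `s⁴`; the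
coefficients are nonzero because `∂⁵φ₀/∂y⁵` is. In the parameter `x = s²` both `y` and `√|u|` are
`C¹` up to `x = 0` with nonzero derivative, and `exists_flip_diffeo` straightens the picture to the
line and the half-parabola.

**From the horizon to the contour.** The horizon is compact, so a neighborhood of the fiber in the
horizon projects onto a neighborhood in the contour (`image_snd_mem_nhdsWithin_contour`). Finiteness
of cusps and flips holds because they are isolated in a compact set.
-/

/-! ### Hermite interpolation -/

theorem contDiff_polynomial_eval (P : Polynomial ℝ) {n : WithTop ℕ∞} :
    ContDiff ℝ n fun x => P.eval x := by
  simp only [Polynomial.eval_eq_sum, Polynomial.sum]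
  fun_prop

open Polynomial in
theorem iteratedDeriv_polynomial_eval (i : ℕ) (P : ℝ[X]) :
    iteratedDeriv i (fun x => P.eval x) = fun x => (derivative^[i] P).eval x := by
  induction i generalizing P with
  | zero => simp
  | succ i ih =>
    rw [iteratedDeriv_succ', show deriv (fun x => P.eval x) = fun x => (derivative P).eval x from
      funext fun x => P.deriv, ih, Function.iterate_succ_apply]

/-- The polynomial of degree less than `k * n` with coefficients `ε`, the index set `Fin k × Fin n`
being that of the Hermite data: `n` derivatives at each of `k` points. -/
noncomputable def hermitePoly {k n : ℕ} (ε : Fin k × Fin n → ℝ) : Polynomial ℝ :=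
  ∑ l, Polynomial.C (ε l) * Polynomial.X ^ (finProdFinEquiv l : ℕ)

/-- The matrix of the linear map sending a polynomial to its derivatives of order `< n` at the
points `x j`. -/
noncomputable def hermiteMatrix {k n : ℕ} (x : Fin k → ℝ) :
    Matrix (Fin k × Fin n) (Fin k × Fin n) ℝ :=
  fun ji l => (Polynomial.derivative^[(ji.2 : ℕ)]
    (Polynomial.X ^ (finProdFinEquiv l : ℕ) : Polynomial ℝ)).eval (x ji.1)

theorem eval_iterate_derivative_hermitePoly {k n : ℕ} (ε : Fin k × Fin n → ℝ) (i : ℕ) (t : ℝ) :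
    (Polynomial.derivative^[i] (hermitePoly ε)).eval t = ∑ l, ε l *
      (Polynomial.derivative^[i]
        (Polynomial.X ^ (finProdFinEquiv l : ℕ) : Polynomial ℝ)).eval t := by
  simp [hermitePoly, Polynomial.iterate_derivative_sum, Polynomial.eval_finsetSum,
    Polynomial.iterate_derivative_C_mul]

theorem hermiteMatrix_mulVec {k n : ℕ} (x : Fin k → ℝ) (ε : Fin k × Fin n → ℝ)
    (ji : Fin k × Fin n) :
    (hermiteMatrix x).mulVec ε ji =
      (Polynomial.derivative^[(ji.2 : ℕ)] (hermitePoly ε)).eval (x ji.1) := by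
  rw [eval_iterate_derivative_hermitePoly]
  simp [Matrix.mulVec, dotProduct, hermiteMatrix, mul_comm]

theorem natDegree_hermitePoly_lt {k n : ℕ} (hkn : 0 < k * n) (ε : Fin k × Fin n → ℝ) :
    (hermitePoly ε).natDegree < k * n := by
  refine lt_of_le_of_lt (b := k * n - 1) (Polynomial.natDegree_sum_le_of_forall_le _ _ ?_) (by omega)
  intro l _
  refine (Polynomial.natDegree_C_mul_X_pow_le _ _).trans ?_
  have := (finProdFinEquiv l).2
  omega

theorem hermitePoly_eq_zero {k n : ℕ} {ε : Fin k × Fin n → ℝ} (h : hermitePoly ε = 0) : ε = 0 := by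
  funext l
  have := congrArg (fun P => Polynomial.coeff P (finProdFinEquiv l : ℕ)) h
  simp only [hermitePoly, Polynomial.finsetSum_coeff, Polynomial.coeff_C_mul_X_pow,
    Polynomial.coeff_zero] at this
  rw [Finset.sum_eq_single l] at this
  · simpa using this
  · intro b _ hb
    rw [if_neg]
    intro h
    exact hb (finProdFinEquiv.injective (Fin.ext h)).symm
  · simp

/-- A polynomial of degree less than `k * n` that vanishes to order `n` at `k` distinct points is
zero. -/
theorem det_hermiteMatrix_ne_zero {k n : ℕ} {x : Fin k → ℝ} (hx : Function.Injective x) :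
    (hermiteMatrix (n := n) x).det ≠ 0 := by
  intro h
  obtain ⟨ε, hε, h0⟩ := Matrix.exists_mulVec_eq_zero_iff.2 h
  apply hε
  apply hermitePoly_eq_zero
  rcases Nat.eq_zero_or_pos (k * n) with hkn | hkn
  · have : IsEmpty (Fin k × Fin n) := by
      rw [← Fintype.card_eq_zero_iff]; simpa using hkn
    simp [hermitePoly]
  by_contra hP
  have hdvd : ∏ j, (Polynomial.X - Polynomial.C (x j)) ^ n ∣ hermitePoly ε := by
    apply Fintype.prod_dvd_of_coprime
    · intro i j hij
      exact (Polynomial.isCoprime_X_sub_C_of_isUnit_sub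
        (sub_ne_zero.2 (hx.ne hij)).isUnit).pow
    · intro j
      have hn : 0 < n := Nat.pos_of_mul_pos_left hkn
      rw [← Polynomial.le_rootMultiplicity_iff hP]
      obtain ⟨m, rfl⟩ : ∃ m, n = m + 1 := ⟨n - 1, by omega⟩
      rw [Nat.succ_le_iff, Polynomial.lt_rootMultiplicity_iff_isRoot_iterate_derivative hP]
      intro i hi
      have := congrFun h0 (j, ⟨i, by omega⟩)
      rw [hermiteMatrix_mulVec] at this
      exact this
  refine hP (Polynomial.eq_zero_of_dvd_of_natDegree_lt hdvd ?_)
  rw [Polynomial.natDegree_prod_of_monic _ _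
    (fun j _ => (Polynomial.monic_X_sub_C _).pow _)]
  simpa using natDegree_hermitePoly_lt hkn ε

/-! ### Jets as continuous functions of the diffeomorphism -/

namespace IncrDiffeo

theorem continuous_jet (i : ℕ) : Continuous fun f : IncrDiffeo => f.jet i :=
  (continuous_apply (A := fun _ : ℕ => C(Icc (-1 : ℝ) 1, ℝ)) i).comp
    (continuous_induced_dom (f := jet))

theorem contDiff (f : IncrDiffeo) {n : WithTop ℕ∞} (hn : n ≤ ∞) : ContDiff ℝ n f :=
  f.smooth.of_le hn

theorem exists_deriv_lower_bound (f : IncrDiffeo) :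
    ∃ δ > 0, ∀ y ∈ Icc (-1 : ℝ) 1, δ ≤ deriv f y := by
  obtain ⟨y, hy, hm⟩ := isCompact_Icc.exists_isMinOn (s := Icc (-1 : ℝ) 1) ⟨0, by simp⟩
    (f.smooth.continuous_deriv (by simp)).continuousOn
  exact ⟨_, f.deriv_pos y hy, fun z hz => hm hz⟩

/-- A polynomial perturbation of `f`, as long as its derivative stays positive on `[-1,1]`; other
perturbations are replaced by `f`. -/
noncomputable def perturb (f : IncrDiffeo) (P : Polynomial ℝ) : IncrDiffeo :=
  open Classical in
  if h : ∀ y ∈ Icc (-1 : ℝ) 1, 0 < deriv (fun x => f x + P.eval x) y then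
    ⟨fun x => f x + P.eval x, f.smooth.add (contDiff_polynomial_eval P), h⟩ else f

/-- The restriction to `[-1,1]` of the `i`-th derivative of a polynomial, depending linearly on its
coefficients. -/
noncomputable def polyJet {k n : ℕ} (i : ℕ) (ε : Fin k × Fin n → ℝ) : C(Icc (-1 : ℝ) 1, ℝ) :=
  ∑ l, ε l • ⟨fun t => (Polynomial.derivative^[i]
        (Polynomial.X ^ (finProdFinEquiv l : ℕ) : Polynomial ℝ)).eval (t : ℝ), by fun_prop⟩

theorem polyJet_apply {k n : ℕ} (i : ℕ) (ε : Fin k × Fin n → ℝ) (t : Icc (-1 : ℝ) 1) :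
    polyJet i ε t = (Polynomial.derivative^[i] (hermitePoly ε)).eval (t : ℝ) := by
  rw [eval_iterate_derivative_hermitePoly]
  simp [polyJet, ContinuousMap.sum_apply]

theorem iteratedDeriv_add_poly (f : IncrDiffeo) (P : Polynomial ℝ) (i : ℕ) (y : ℝ) :
    iteratedDeriv i (fun x => f x + P.eval x) y =
      iteratedDeriv i f y + (Polynomial.derivative^[i] P).eval y := by
  have := iteratedDeriv_add (n := i) (x := y) (f := f.toFun) (g := fun x => P.eval x)
    (f.contDiff (by exact_mod_cast le_top)).contDiffAt (contDiff_polynomial_eval P).contDiffAt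
  rw [iteratedDeriv_polynomial_eval] at this
  exact this

theorem eventually_perturb_eq (f : IncrDiffeo) (k n : ℕ) :
    ∀ᶠ ε : Fin k × Fin n → ℝ in 𝓝 0,
      (f.perturb (hermitePoly ε)).toFun = fun x => f x + (hermitePoly ε).eval x := by
  obtain ⟨δ, hδ, hf⟩ := f.exists_deriv_lower_bound
  have hc : Continuous fun ε : Fin k × Fin n → ℝ => ‖polyJet 1 ε‖ := by
    unfold polyJet; fun_prop
  have h0 : ∀ᶠ ε : Fin k × Fin n → ℝ in 𝓝 0, ‖polyJet 1 ε‖ < δ :=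
    hc.continuousAt.eventually_lt continuousAt_const (by simpa [polyJet] using hδ)
  filter_upwards [h0] with ε hε
  rw [perturb, dif_pos]
  intro y hy
  have h1 := f.iteratedDeriv_add_poly (hermitePoly ε) 1 y
  rw [iteratedDeriv_one, iteratedDeriv_one] at h1
  rw [h1]
  have h2 := ((polyJet 1 ε).norm_coe_le_norm ⟨y, hy⟩).trans_lt hε
  rw [polyJet_apply, Real.norm_eq_abs, abs_lt] at h2
  linarith [hf y hy, h2.1]

theorem tendsto_perturb (f : IncrDiffeo) (k n : ℕ) :
    Tendsto (fun ε : Fin k × Fin n → ℝ => f.perturb (hermitePoly ε)) (𝓝 0) (𝓝 f) := by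
  rw [nhds_induced, tendsto_comap_iff, tendsto_pi_nhds]
  intro i
  have hc : Continuous fun ε : Fin k × Fin n → ℝ => f.jet i + polyJet i ε := by
    unfold polyJet; fun_prop
  have h0 := hc.tendsto 0
  simp only [polyJet, Pi.zero_apply, zero_smul, Finset.sum_const_zero, add_zero] at h0
  refine h0.congr' ?_
  filter_upwards [f.eventually_perturb_eq k n] with ε hε
  ext t
  simp only [Function.comp, jet, ContinuousMap.coe_mk, ContinuousMap.add_apply]
  rw [hε, f.iteratedDeriv_add_poly, ← polyJet_apply]
  rfl

end IncrDiffeo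

/-! ### Multijet transversality by counting parameters -/

/-- The coefficients of the polynomial perturbations of `f` that have a prescribed multijet of a
`d`-parameter family form a set of dimension at most `d`, being the image of the family under
Hermite interpolation. -/
theorem dense_compl_interpolation {d k n : ℕ} (hd : d < k * n) (f : IncrDiffeo)
    (X : (Fin d → ℝ) → Fin k → ℝ) (Z : (Fin d → ℝ) → Fin k → Fin n → ℝ)
    (V : Set (Fin d → ℝ)) (hX : ∀ θ ∈ V, ContDiffAt ℝ 1 X θ)
    (hZ : ∀ θ ∈ V, ContDiffAt ℝ 1 Z θ)
    (hinj : ∀ θ ∈ V, Function.Injective (X θ)) :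
    Dense {ε : Fin k × Fin n → ℝ | ∃ θ ∈ V, ∀ j, ∀ i : Fin n, iteratedDeriv i f (X θ j) +
      (Polynomial.derivative^[(i : ℕ)] (hermitePoly ε)).eval (X θ j) = Z θ j i}ᶜ := by
  set M : (Fin d → ℝ) → Matrix (Fin k × Fin n) (Fin k × Fin n) ℝ :=
    fun θ => hermiteMatrix (X θ) with hM
  set b : (Fin d → ℝ) → Fin k × Fin n → ℝ :=
    fun θ ji => Z θ ji.1 ji.2 - iteratedDeriv ji.2 f (X θ ji.1) with hb
  set F : (Fin d → ℝ) → Fin k × Fin n → ℝ :=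
    fun θ l => (M θ).det⁻¹ * (M θ).cramer (b θ) l with hF
  have hMC : ∀ θ ∈ V, ∀ a l, ContDiffAt ℝ 1 (fun θ => M θ a l) θ := fun θ hθ a l => by
    have := contDiffAt_pi.1 (hX θ hθ) a.1
    simp only [hM, hermiteMatrix]
    exact (contDiff_polynomial_eval (n := 1) _).contDiffAt.comp θ this
  have hbC : ∀ θ ∈ V, ∀ a, ContDiffAt ℝ 1 (fun θ => b θ a) θ := fun θ hθ a => by
    refine (contDiffAt_pi.1 (contDiffAt_pi.1 (hZ θ hθ) a.1) a.2).sub ?_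
    have h1 : ContDiff ℝ 1 (iteratedDeriv (a.2 : ℕ) f) := by
      rw [iteratedDeriv_eq_iterate]
      exact ContDiff.iterate_deriv' 1 a.2 (f.contDiff (by exact_mod_cast le_top))
    exact h1.contDiffAt.comp θ (contDiffAt_pi.1 (hX θ hθ) a.1)
  have hdet : ∀ (A : (Fin d → ℝ) → Matrix (Fin k × Fin n) (Fin k × Fin n) ℝ) (θ : Fin d → ℝ),
      (∀ a l, ContDiffAt ℝ 1 (fun θ => A θ a l) θ) → ContDiffAt ℝ 1 (fun θ => (A θ).det) θ := by
    intro A θ hA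
    simp only [Matrix.det_apply']
    refine ContDiffAt.sum fun σ _ => contDiffAt_const.mul ?_
    exact contDiffAt_prod (𝔸' := ℝ) (𝕜 := ℝ) fun i _ => hA _ _
  have hFC : ∀ θ ∈ V, ContDiffAt ℝ 1 F θ := fun θ hθ => by
    rw [contDiffAt_pi]
    intro l
    refine ((hdet _ θ (hMC θ hθ)).inv (det_hermiteMatrix_ne_zero (hinj θ hθ))).mul ?_
    simp only [Matrix.cramer_apply]
    apply hdet
    intro a l'
    simp only [Matrix.updateCol_apply]
    split_ifs
    · exact hbC θ hθ a
    · exact hMC θ hθ a l'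
  have hdim : dimH (F '' V) < Module.finrank ℝ (Fin k × Fin n → ℝ) := by
    calc dimH (F '' V) ≤ dimH V := dimH_image_le_of_locally_lipschitzOn fun θ hθ => by
          obtain ⟨K, t, ht, h⟩ := (hFC θ hθ).exists_lipschitzOnWith
          exact ⟨K, t, mem_nhdsWithin_of_mem_nhds ht, h⟩
      _ ≤ dimH (univ : Set (Fin d → ℝ)) := dimH_mono (subset_univ _)
      _ = d := Real.dimH_univ_pi_fin d
      _ < _ := by
        rw [Module.finrank_fintype_fun_eq_card]
        simpa [← Nat.cast_mul] using (by exact_mod_cast hd : ((d : ℕ) : ENNReal) < ((k * n : ℕ) : ENNReal))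
  refine (dense_compl_of_dimH_lt_finrank hdim).mono (compl_subset_compl.2 ?_)
  rintro ε ⟨θ, hθ, h⟩
  refine ⟨θ, hθ, ?_⟩
  have hMb : (M θ).mulVec ε = b θ := by
    funext ji
    rw [hermiteMatrix_mulVec]
    simp only [hb]
    linarith [h ji.1 ji.2]
  funext l
  simp only [hF]
  rw [← hMb, Matrix.cramer_eq_adjugate_mulVec, Matrix.mulVec_mulVec, Matrix.adjugate_mul,
    Matrix.smul_mulVec, Matrix.one_mulVec, Pi.smul_apply, smul_eq_mul,
    inv_mul_cancel_left₀ (det_hermiteMatrix_ne_zero (hinj θ hθ))]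

/-- A family of multijets (`n` derivatives at `k` distinct points of `[-1,1]`) depending on fewer
than `k * n` parameters is avoided by a generic diffeomorphism. Both the points `X j` and the values
`Z j i` of the derivatives are functions of the parameter `θ`. -/
theorem residual_avoid {d k n : ℕ} (hd : d < k * n)
    (X : (Fin d → ℝ) → Fin k → ℝ) (Z : (Fin d → ℝ) → Fin k → Fin n → ℝ) :
    ∀ᶠ f : IncrDiffeo in residual IncrDiffeo, ∀ θ, ContDiffAt ℝ 1 X θ →
      ContDiffAt ℝ 1 Z θ → Function.Injective (X θ) →
      (∀ j, X θ j ∈ Icc (-1 : ℝ) 1) → ¬ ∀ j i, iteratedDeriv (i : Fin n) f (X θ j) = Z θ j i := by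
  set V : Set (Fin d → ℝ) := {θ | ContDiffAt ℝ 1 X θ ∧
    ContDiffAt ℝ 1 Z θ ∧ Function.Injective (X θ)} with hV
  have hVo : IsOpen V := by
    rw [isOpen_iff_mem_nhds]
    rintro θ ⟨h1, h2, h3⟩
    have e3 : ∀ᶠ θ in 𝓝 θ, ∀ i j, i ≠ j → X θ i ≠ X θ j := by
      refine eventually_all.2 fun i => eventually_all.2 fun j => ?_
      by_cases hij : i = j
      · simp [hij]
      · filter_upwards [((continuousAt_pi.1 h1.continuousAt i).ne_iff_eventually_ne
          (continuousAt_pi.1 h1.continuousAt j)).1 (h3.ne hij)]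
          with θ h _ using h
    filter_upwards [h1.eventually (by simp), h2.eventually (by simp), e3] with θ h1 h2 h3
    exact ⟨h1, h2, fun i j h => by_contra fun hij => h3 i j hij h⟩
  have : LocallyCompactSpace V := hVo.locallyCompactSpace
  set C : ℕ → Set V := fun m => compactCovering V m ∩ {θ | ∀ j, X θ j ∈ Icc (-1 : ℝ) 1} with hC
  have hXc : ∀ j, Continuous fun θ : V => X θ j := fun j => by
    rw [continuous_iff_continuousAt]
    intro θ
    exact (continuousAt_pi.1 θ.2.1.continuousAt j).comp continuous_subtype_val.continuousAt
  have hZc : ∀ j i, Continuous fun θ : V => Z θ j i := fun j i => by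
    rw [continuous_iff_continuousAt]
    intro θ
    exact (continuousAt_pi.1 (continuousAt_pi.1 θ.2.2.1.continuousAt j) i).comp continuous_subtype_val.continuousAt
  have hCc : ∀ m, IsCompact (C m) := fun m => by
    refine (isCompact_compactCovering V m).inter_right ?_
    simp only [ofPred_forall]
    exact isClosed_iInter fun j => isClosed_Icc.preimage (hXc j)
  have key : ∀ m, ∀ᶠ f : IncrDiffeo in residual IncrDiffeo, ∀ θ ∈ C m,
      ¬ ∀ j i, iteratedDeriv (i : Fin n) f (X θ j) = Z θ j i := by
    intro m
    apply residual_of_dense_open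
    · have : CompactSpace (C m) := isCompact_iff_compactSpace.1 (hCc m)
      have hcl : IsClosed {x : C m × IncrDiffeo | ∀ j i,
          x.2.jet (i : Fin n) ⟨X x.1 j, x.1.2.2 j⟩ = Z x.1 j i} := by
        simp only [ofPred_forall]
        refine isClosed_iInter fun j => isClosed_iInter fun i => isClosed_eq ?_ ?_
        · have h1 : Continuous fun x : C m × IncrDiffeo => x.2.jet i :=
            (IncrDiffeo.continuous_jet i).comp continuous_snd
          have h2 : Continuous fun x : C m × IncrDiffeo =>
              (⟨X x.1 j, x.1.2.2 j⟩ : Icc (-1 : ℝ) 1) :=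
            ((hXc j).comp (continuous_subtype_val.comp continuous_fst)).subtype_mk _
          exact continuous_eval.comp (h1.prodMk h2)
        · exact (hZc j i).comp (continuous_subtype_val.comp continuous_fst)
      rw [← isClosed_compl_iff]
      convert isClosedMap_snd_of_compactSpace _ hcl using 1
      ext f
      simp [IncrDiffeo.jet, hC, and_assoc]
    · intro f
      have hdense := dense_compl_interpolation hd f X Z V (fun θ h => h.1) (fun θ h => h.2.1)
        (fun θ h => h.2.2)
      refine mem_closure_of_frequently_of_tendsto ?_ (f.tendsto_perturb k n)
      refine ((mem_closure_iff_frequently.1 (hdense 0)).and_eventually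
        (f.eventually_perturb_eq k n)).mono ?_
      rintro ε ⟨hε, he⟩ θ hθ hall
      refine hε ⟨θ, θ.2, fun j i => ?_⟩
      rw [← hall j i, he, f.iteratedDeriv_add_poly]
  filter_upwards [eventually_countable_forall.2 key] with f hf θ h1 h2 h3 h4
  obtain ⟨m, hm⟩ := exists_mem_compactCovering (⟨θ, h1, h2, h3⟩ : V)
  exact hf m ⟨θ, h1, h2, h3⟩ ⟨hm, h4⟩

@[fun_prop]
theorem contDiffAt_vecCons {E F : Type*} [NormedAddCommGroup E] [NormedSpace ℝ E]
    [NormedAddCommGroup F] [NormedSpace ℝ F] {n : ℕ} {x : E} {a : E → F} {v : E → Fin n → F}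
    (ha : ContDiffAt ℝ 1 a x) (hv : ContDiffAt ℝ 1 v x) :
    ContDiffAt ℝ 1 (fun t => Matrix.vecCons (a t) (v t)) x := by
  rw [contDiffAt_pi] at hv ⊢
  intro j
  refine Fin.cases ?_ (fun j => ?_) j
  · simpa using ha
  · simpa using hv j

theorem injective_of_nodup_ofFn {k : ℕ} {v : Fin k → ℝ} (h : (List.ofFn v).Nodup) :
    Function.Injective v := List.nodup_ofFn.1 h

/-! ### Generic conditions on the jets along orbits -/

namespace IncrDiffeo

/-- The `i`-th derivative of `f` at `x`. -/
noncomputable abbrev der (f : IncrDiffeo) (i : ℕ) (x : ℝ) : ℝ := iteratedDeriv i f x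

theorem der_zero (f : IncrDiffeo) : f.der 0 = f := by funext x; simp [der]

theorem der_one (f : IncrDiffeo) : f.der 1 = deriv f := by funext x; simp [der]

theorem contDiff_der (f : IncrDiffeo) (i : ℕ) : ContDiff ℝ ∞ (f.der i) := by
  rw [show f.der i = deriv^[i] f.toFun from iteratedDeriv_eq_iterate]
  exact f.smooth.iterate_deriv i

theorem continuous_der (f : IncrDiffeo) (i : ℕ) : Continuous (f.der i) :=
  (f.contDiff_der i).continuous

theorem hasDerivAt_der (f : IncrDiffeo) (i : ℕ) (x : ℝ) :
    HasDerivAt (f.der i) (f.der (i + 1) x) x := by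
  have h := ((f.contDiff_der i).differentiable (by simp)).differentiableAt (x := x) |>.hasDerivAt
  rwa [← iteratedDeriv_succ] at h

theorem hasDerivAt (f : IncrDiffeo) (x : ℝ) : HasDerivAt f (f.der 1 x) x := by
  simpa [der_zero] using f.hasDerivAt_der 0 x

theorem der_one_pos (f : IncrDiffeo) {x : ℝ} (hx : x ∈ Icc (-1 : ℝ) 1) : 0 < f.der 1 x := by
  rw [der_one]; exact f.deriv_pos x hx

/-- The Schwarzian derivative of `f`, multiplied by `2 f'²`. -/
noncomputable def schwarz (f : IncrDiffeo) (x : ℝ) : ℝ :=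
  2 * f.der 1 x * f.der 3 x - 3 * f.der 2 x ^ 2

/-- Half the derivative of `schwarz`. -/
noncomputable def schwarz' (f : IncrDiffeo) (x : ℝ) : ℝ :=
  f.der 1 x * f.der 4 x - 2 * f.der 2 x * f.der 3 x

/-- The fifth derivative of `φ₀` at the diagonal point of the horizon over `x`, multiplied by
`f'²`. -/
noncomputable def quint (f : IncrDiffeo) (x : ℝ) : ℝ :=
  2 * f.der 5 x * f.der 1 x ^ 2 - 15 * f.der 2 x * f.der 4 x * f.der 1 x
    + 10 * f.der 3 x ^ 2 * f.der 1 x + 5 * f.der 2 x ^ 2 * f.der 3 x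

/-- A horizon point over `(p,q)` whose orbit `{y, w}` has two elements. The additional parameter
`r` is the ratio `f'(y) / p`. -/
structure OffOrbit (f : IncrDiffeo) (p q r y w : ℝ) : Prop where
  y_mem : y ∈ Icc (-1 : ℝ) 1
  w_mem : w ∈ Icc (-1 : ℝ) 1
  ne : y ≠ w
  p_pos : 0 < p
  r_pos : 0 < r
  val_y : f.der 0 y = q - p * w
  val_w : f.der 0 w = q - p * y
  der_y : f.der 1 y = p * r
  der_w : f.der 1 w = p / r

theorem OffOrbit.swap {f : IncrDiffeo} {p q r y w : ℝ} (h : f.OffOrbit p q r y w) :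
    f.OffOrbit p q r⁻¹ w y :=
  ⟨h.w_mem, h.y_mem, h.ne.symm, h.p_pos, inv_pos.2 h.r_pos, h.val_w, h.val_y,
    by rw [h.der_w, div_eq_mul_inv], by rw [h.der_y, div_inv_eq_mul]⟩

/-- A horizon point over `(p,q)` whose orbit is the single point `x`. -/
structure DiagOrbit (f : IncrDiffeo) (p q x : ℝ) : Prop where
  mem : x ∈ Icc (-1 : ℝ) 1
  val : f.der 0 x = q - p * x
  der_eq : f.der 1 x = p

theorem DiagOrbit.p_pos {f : IncrDiffeo} {p q x : ℝ} (h : f.DiagOrbit p q x) : 0 < p :=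
  h.der_eq ▸ f.der_one_pos h.mem

theorem OffOrbit.sub_ne {f : IncrDiffeo} {p q r y w : ℝ} (h : f.OffOrbit p q r y w) : y - w ≠ 0 :=
  sub_ne_zero.2 h.ne

/-- Two orbits over the same point are disjoint unless they are equal. -/
theorem OffOrbit.ne_right {f : IncrDiffeo} {p q r y w r' y' w' : ℝ} (h : f.OffOrbit p q r y w)
    (h' : f.OffOrbit p q r' y' w') (hne : y ≠ y') : w ≠ w' := by
  rintro rfl
  have := h.val_w.symm.trans h'.val_w
  have h2 : p * (y - y') = 0 := by linarith
  rcases mul_eq_zero.1 h2 with h3 | h3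
  · exact h.p_pos.ne' h3
  · exact hne (sub_eq_zero.1 h3)

theorem DiagOrbit.ne_left {f : IncrDiffeo} {p q r x y w : ℝ} (h : f.DiagOrbit p q x)
    (h' : f.OffOrbit p q r y w) : x ≠ y := by
  rintro rfl
  have := h.val.symm.trans h'.val_y
  have h2 : p * (x - w) = 0 := by linarith
  exact (mul_ne_zero h'.p_pos.ne' h'.sub_ne) h2

end IncrDiffeo

open IncrDiffeo

/-- The zeros of the Schwarzian are simple: `4` parameters `(x, f, f', f'')`, since `f'''` and
`f''''` are determined by them, against a jet with `5` entries at one point. Every `generic_*`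
lemma below is a count of this kind: a degenerate configuration is a multijet that is a function
of fewer parameters than it has entries, and `residual_avoid` excludes it. -/
theorem generic_schwarz_simple : ∀ᶠ f : IncrDiffeo in residual IncrDiffeo,
    ∀ x ∈ Icc (-1 : ℝ) 1, f.schwarz x = 0 → f.schwarz' x ≠ 0 := by
  filter_upwards [residual_avoid (d := 4) (k := 1) (n := 5) (by norm_num)
    (fun θ => ![θ 0]) (fun θ => ![![θ 1, θ 2, θ 3,
      3 * θ 3 ^ 2 / (2 * θ 2), 2 * θ 3 * (3 * θ 3 ^ 2 / (2 * θ 2)) / θ 2]])]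
    with f hf x hx hS hX
  have h1 : f.der 1 x ≠ 0 := (f.der_one_pos hx).ne'
  have h1' : 2 * f.der 1 x ≠ 0 := mul_ne_zero two_ne_zero h1
  simp only [schwarz, schwarz'] at hS hX
  have h3 : f.der 3 x = 3 * f.der 2 x ^ 2 / (2 * f.der 1 x) := by
    field_simp; linear_combination hS
  have h4 : f.der 4 x = 2 * f.der 2 x * (3 * f.der 2 x ^ 2 / (2 * f.der 1 x)) / f.der 1 x := by
    rw [← h3]; field_simp; linear_combination hX
  refine hf ![x, f.der 0 x, f.der 1 x, f.der 2 x] (by fun_prop)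
    (by fun_prop (disch := first | exact h1 | exact h1')) (injective_of_nodup_ofFn ?_) ?_ ?_
  · change [x].Nodup
    simp
  · intro j; fin_cases j; exact hx
  · intro j i
    fin_cases j; fin_cases i
    exacts [rfl, rfl, rfl, h3, h4]

/-- Over one point, two orbits with two elements have projections with different tangent lines:
the tangent direction of the contour at the orbit `{y, w}` is `(r - 1, r y - w)`. If the
directions are parallel, then `r'` is a function of the other parameters. -/
theorem generic_double_tangent : ∀ᶠ f : IncrDiffeo in residual IncrDiffeo,
    ∀ p q r y w r' y' w', f.OffOrbit p q r y w → f.OffOrbit p q r' y' w' → y' ≠ y → y' ≠ w →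
      (r - 1) * (r' * y' - w') - (r' - 1) * (r * y - w) ≠ 0 := by
  filter_upwards [residual_avoid (d := 7) (k := 4) (n := 2) (by norm_num)
    (fun θ => ![θ 2, θ 3, θ 5, θ 6])
    (fun θ => ![![θ 1 - θ 0 * θ 3, θ 0 * θ 4],
      ![θ 1 - θ 0 * θ 2, θ 0 / θ 4],
      ![θ 1 - θ 0 * θ 6, θ 0 * (((θ 4 - 1) * θ 6 - (θ 4 * θ 2 - θ 3)) /
        ((θ 4 - 1) * θ 5 - (θ 4 * θ 2 - θ 3)))],
      ![θ 1 - θ 0 * θ 5, θ 0 / (((θ 4 - 1) * θ 6 - (θ 4 * θ 2 - θ 3)) /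
        ((θ 4 - 1) * θ 5 - (θ 4 * θ 2 - θ 3)))]])] with f hf p q r y w r' y' w' h h' hy hw hX
  have hr := h.r_pos.ne'
  have hr' := h'.r_pos.ne'
  have hD : (r - 1) * y' - (r * y - w) ≠ 0 := by
    intro h0
    have h2 : (r - 1) * (y' - w') = 0 := by linear_combination hX - (r' - 1) * h0
    rcases mul_eq_zero.1 h2 with h3 | h3
    · exact h.sub_ne (by linear_combination -h0 + (y' - y) * h3)
    · exact h'.sub_ne h3
  have hr2 : r' = ((r - 1) * w' - (r * y - w)) / ((r - 1) * y' - (r * y - w)) := by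
    field_simp; linear_combination hX
  have hR : ((r - 1) * w' - (r * y - w)) / ((r - 1) * y' - (r * y - w)) ≠ 0 := hr2 ▸ hr'
  have hy2 : w ≠ w' := h.ne_right h' hy.symm
  have hw2 : y ≠ w' := h.swap.ne_right h' hw.symm
  refine hf ![p, q, y, w, r, y', w'] (by fun_prop)
    (by fun_prop (disch := first | exact hr | exact hD | exact hR)) (injective_of_nodup_ofFn ?_) ?_ ?_
  · change [y, w, y', w'].Nodup
    simp [h.ne, h'.ne, hy2, hw2, hy.symm, hw.symm]
  · intro j
    fin_cases j
    exacts [h.y_mem, h.w_mem, h'.y_mem, h'.w_mem]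
  · intro j i
    fin_cases j <;> fin_cases i
    exacts [h.val_y, h.der_y, h.val_w, h.der_w, h'.val_y, hr2 ▸ h'.der_y, h'.val_w, hr2 ▸ h'.der_w]

theorem generic_schwarz_ne {c : ℝ} (hc : c ∈ Icc (-1 : ℝ) 1) : ∀ᶠ f : IncrDiffeo in residual IncrDiffeo,
    f.schwarz c ≠ 0 := by
  filter_upwards [residual_avoid (d := 3) (k := 1) (n := 4) (by norm_num)
    (fun θ => ![c])
    (fun θ => ![![θ 0, θ 1, θ 2, 3 * θ 2 ^ 2 / (2 * θ 1)]])] with f hf hS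
  have h1 : 2 * f.der 1 c ≠ 0 := mul_ne_zero two_ne_zero (f.der_one_pos hc).ne'
  have h3 : f.der 3 c = 3 * f.der 2 c ^ 2 / (2 * f.der 1 c) := by
    rw [schwarz] at hS; rw [eq_div_iff h1]; linear_combination hS
  refine hf ![f.der 0 c, f.der 1 c, f.der 2 c] (by fun_prop)
    (by fun_prop (disch := exact h1))
    (injective_of_nodup_ofFn ?_) ?_ ?_
  · change [c].Nodup
    simp
  · intro j
    fin_cases j
    exacts [hc]
  · intro j i
    fin_cases j; fin_cases i
    exacts [rfl, rfl, rfl, h3]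

theorem generic_quint : ∀ᶠ f : IncrDiffeo in residual IncrDiffeo,
    ∀ x ∈ Icc (-1 : ℝ) 1, f.schwarz x = 0 → f.quint x ≠ 0 := by
  filter_upwards [residual_avoid (d := 5) (k := 1) (n := 6) (by norm_num)
    (fun θ => ![θ 0])
    (fun θ => ![![θ 1, θ 2, θ 3, 3 * θ 3 ^ 2 / (2 * θ 2), θ 4,
      (15 * θ 3 * θ 4 * θ 2 - 10 * (3 * θ 3 ^ 2 / (2 * θ 2)) ^ 2 * θ 2
        - 5 * θ 3 ^ 2 * (3 * θ 3 ^ 2 / (2 * θ 2))) / (2 * θ 2 ^ 2)]])] with f hf x hx hS hQ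
  have h1 : f.der 1 x ≠ 0 := (f.der_one_pos hx).ne'
  have h1' : 2 * f.der 1 x ≠ 0 := mul_ne_zero two_ne_zero h1
  have h1'' : 2 * f.der 1 x ^ 2 ≠ 0 := mul_ne_zero two_ne_zero (pow_ne_zero 2 h1)
  have h3 : f.der 3 x = 3 * f.der 2 x ^ 2 / (2 * f.der 1 x) := by
    rw [schwarz] at hS; rw [eq_div_iff h1']; linear_combination hS
  have h5 : f.der 5 x = (15 * f.der 2 x * f.der 4 x * f.der 1 x
      - 10 * (3 * f.der 2 x ^ 2 / (2 * f.der 1 x)) ^ 2 * f.der 1 x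
      - 5 * f.der 2 x ^ 2 * (3 * f.der 2 x ^ 2 / (2 * f.der 1 x))) / (2 * f.der 1 x ^ 2) := by
    rw [← h3, eq_div_iff h1'']; rw [quint] at hQ; linear_combination hQ
  refine hf ![x, f.der 0 x, f.der 1 x, f.der 2 x, f.der 4 x] (by fun_prop)
    (by fun_prop (disch := first | exact h1' | exact h1''))
    (injective_of_nodup_ofFn ?_) ?_ ?_
  · change [x].Nodup
    simp
  · intro j
    fin_cases j
    exacts [hx]
  · intro j i
    fin_cases j; fin_cases i
    exacts [rfl, rfl, rfl, h3, rfl, h5]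

/-- At a singular point of the projection, a condition on third derivatives holds which makes the
singularity an ordinary cusp. -/
theorem generic_cusp : ∀ᶠ f : IncrDiffeo in residual IncrDiffeo,
    ∀ p q r y w, f.OffOrbit p q r y w → f.der 2 y = r ^ 3 * f.der 2 w →
      f.der 3 y + r ^ 4 * f.der 3 w - 3 * r ^ 2 * f.der 2 y * f.der 2 w / p ≠ 0 := by
  filter_upwards [residual_avoid (d := 7) (k := 2) (n := 4) (by norm_num)
    (fun θ => ![θ 2, θ 3])
    (fun θ => ![![θ 1 - θ 0 * θ 3, θ 0 * θ 4, θ 5, θ 6],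
      ![θ 1 - θ 0 * θ 2, θ 0 / θ 4, θ 5 / θ 4 ^ 3,
        (3 * θ 4 ^ 2 * θ 5 * (θ 5 / θ 4 ^ 3) / θ 0 - θ 6) / θ 4 ^ 4]])] with f hf p q r y w h hK h3
  have hr := h.r_pos.ne'
  have hp := h.p_pos.ne'
  have hr3 : r ^ 3 ≠ 0 := pow_ne_zero 3 hr
  have hr4 : r ^ 4 ≠ 0 := pow_ne_zero 4 hr
  have h2w : f.der 2 w = f.der 2 y / r ^ 3 := by rw [eq_div_iff hr3]; linear_combination -hK
  have h3w : f.der 3 w = (3 * r ^ 2 * f.der 2 y * (f.der 2 y / r ^ 3) / p - f.der 3 y) / r ^ 4 := by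
    rw [← h2w, eq_div_iff hr4]; linear_combination h3
  refine hf ![p, q, y, w, r, f.der 2 y, f.der 3 y] (by fun_prop)
    (by fun_prop (disch := first | exact hr | exact hp | exact hr3 | exact hr4))
    (injective_of_nodup_ofFn ?_) ?_ ?_
  · change [y, w].Nodup
    simp [h.ne]
  · intro j
    fin_cases j
    exacts [h.y_mem, h.w_mem]
  · intro j i
    fin_cases j <;> fin_cases i
    exacts [h.val_y, h.der_y, rfl, rfl, h.val_w, h.der_w, h2w, h3w]

/-- The horizon is a regular curve at an orbit with two elements: the gradient of the function
`defect` of `(y, w)` does not vanish there. -/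
theorem generic_horizon_regular : ∀ᶠ f : IncrDiffeo in residual IncrDiffeo,
    ∀ p q r y w, f.OffOrbit p q r y w → ¬ (f.der 2 y * (y - w) = 2 * p * r * (r - 1) ∧
      f.der 2 w * r ^ 2 * (y - w) = 2 * p * (r - 1)) := by
  filter_upwards [residual_avoid (d := 5) (k := 2) (n := 3) (by norm_num)
    (fun θ => ![θ 2, θ 3])
    (fun θ => ![![θ 1 - θ 0 * θ 3, θ 0 * θ 4, 2 * θ 0 * θ 4 * (θ 4 - 1) / (θ 2 - θ 3)],
      ![θ 1 - θ 0 * θ 2, θ 0 / θ 4, 2 * θ 0 * (θ 4 - 1) / (θ 4 ^ 2 * (θ 2 - θ 3))]])] with f hf p q r y w h ⟨hy, hw⟩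
  have hr := h.r_pos.ne'
  have hd := h.sub_ne
  have hrd : r ^ 2 * (y - w) ≠ 0 := mul_ne_zero (pow_ne_zero 2 hr) hd
  have h2y : f.der 2 y = 2 * p * r * (r - 1) / (y - w) := by rw [eq_div_iff hd]; exact hy
  have h2w : f.der 2 w = 2 * p * (r - 1) / (r ^ 2 * (y - w)) := by
    rw [eq_div_iff hrd]; linear_combination hw
  refine hf ![p, q, y, w, r] (by fun_prop)
    (by fun_prop (disch := first | exact hr | exact hd | exact hrd))
    (injective_of_nodup_ofFn ?_) ?_ ?_
  · change [y, w].Nodup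
    simp [h.ne]
  · intro j
    fin_cases j
    exacts [h.y_mem, h.w_mem]
  · intro j i
    fin_cases j <;> fin_cases i
    exacts [h.val_y, h.der_y, h2y, h.val_w, h.der_w, h2w]

/-- At an endpoint the horizon is transversal to the boundary of the square of pairs `(y, w)`. -/
theorem generic_endpoint_transversal (c : ℝ) : ∀ᶠ f : IncrDiffeo in residual IncrDiffeo,
    ∀ p q r w, f.OffOrbit p q r c w → f.der 2 w * r ^ 2 * (c - w) ≠ 2 * p * (r - 1) := by
  filter_upwards [residual_avoid (d := 5) (k := 2) (n := 3) (by norm_num)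
    (fun θ => ![c, θ 2])
    (fun θ => ![![θ 1 - θ 0 * θ 2, θ 0 * θ 3, θ 4],
      ![θ 1 - θ 0 * c, θ 0 / θ 3, 2 * θ 0 * (θ 3 - 1) / (θ 3 ^ 2 * (c - θ 2))]])] with f hf p q r w h hw
  have hr := h.r_pos.ne'
  have hrd : r ^ 2 * (c - w) ≠ 0 := mul_ne_zero (pow_ne_zero 2 hr) h.sub_ne
  have h2w : f.der 2 w = 2 * p * (r - 1) / (r ^ 2 * (c - w)) := by
    rw [eq_div_iff hrd]; linear_combination hw
  refine hf ![p, q, w, r, f.der 2 c] (by fun_prop)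
    (by fun_prop (disch := first | exact hr | exact hrd))
    (injective_of_nodup_ofFn ?_) ?_ ?_
  · change [c, w].Nodup
    simp [h.ne]
  · intro j
    fin_cases j
    exacts [h.y_mem, h.w_mem]
  · intro j i
    fin_cases j <;> fin_cases i
    exacts [h.val_y, h.der_y, rfl, h.val_w, h.der_w, h2w]

theorem generic_endpoint_fold (c : ℝ) : ∀ᶠ f : IncrDiffeo in residual IncrDiffeo,
    ∀ p q r w, f.OffOrbit p q r c w → f.der 2 c ≠ r ^ 3 * f.der 2 w := by
  filter_upwards [residual_avoid (d := 5) (k := 2) (n := 3) (by norm_num)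
    (fun θ => ![c, θ 2])
    (fun θ => ![![θ 1 - θ 0 * θ 2, θ 0 * θ 3, θ 4],
      ![θ 1 - θ 0 * c, θ 0 / θ 3, θ 4 / θ 3 ^ 3]])] with f hf p q r w h hK
  have hr := h.r_pos.ne'
  have hr3 : r ^ 3 ≠ 0 := pow_ne_zero 3 hr
  have h2w : f.der 2 w = f.der 2 c / r ^ 3 := by rw [eq_div_iff hr3]; linear_combination -hK
  refine hf ![p, q, w, r, f.der 2 c] (by fun_prop)
    (by fun_prop (disch := first | exact hr | exact hr3))
    (injective_of_nodup_ofFn ?_) ?_ ?_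
  · change [c, w].Nodup
    simp [h.ne]
  · intro j
    fin_cases j
    exacts [h.y_mem, h.w_mem]
  · intro j i
    fin_cases j <;> fin_cases i
    exacts [h.val_y, h.der_y, rfl, h.val_w, h.der_w, h2w]

theorem generic_endpoint_pair (c c' : ℝ) : ∀ᶠ f : IncrDiffeo in residual IncrDiffeo,
    ∀ p q r, ¬ f.OffOrbit p q r c c' := by
  filter_upwards [residual_avoid (d := 3) (k := 2) (n := 2) (by norm_num)
    (fun θ => ![c, c'])
    (fun θ => ![![θ 1 - θ 0 * c', θ 0 * θ 2], ![θ 1 - θ 0 * c, θ 0 / θ 2]])] with f hf p q r h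
  have hr := h.r_pos.ne'
  refine hf ![p, q, r] (by fun_prop)
    (by fun_prop (disch := exact hr))
    (injective_of_nodup_ofFn ?_) ?_ ?_
  · change [c, c'].Nodup
    simp [h.ne]
  · intro j
    fin_cases j
    exacts [h.y_mem, h.w_mem]
  · intro j i
    fin_cases j <;> fin_cases i
    exacts [h.val_y, h.der_y, h.val_w, h.der_w]

theorem generic_diag_double_schwarz : ∀ᶠ f : IncrDiffeo in residual IncrDiffeo,
    ∀ p q r x y w, f.DiagOrbit p q x → f.OffOrbit p q r y w → f.schwarz x ≠ 0 := by
  filter_upwards [residual_avoid (d := 11) (k := 3) (n := 4) (by norm_num)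
    (fun θ => ![θ 2, θ 4, θ 5])
    (fun θ => ![![θ 1 - θ 0 * θ 2, θ 0, θ 3, 3 * θ 3 ^ 2 / (2 * θ 0)],
      ![θ 1 - θ 0 * θ 5, θ 0 * θ 6, θ 7, θ 9],
      ![θ 1 - θ 0 * θ 4, θ 0 / θ 6, θ 8, θ 10]])] with f hf p q r x y w g h hS
  have hr := h.r_pos.ne'
  have hx := g.ne_left h
  have hx2 := g.ne_left h.swap
  have hp : 2 * p ≠ 0 := mul_ne_zero two_ne_zero h.p_pos.ne'
  have h3 : f.der 3 x = 3 * f.der 2 x ^ 2 / (2 * p) := by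
    rw [schwarz, g.der_eq] at hS; rw [eq_div_iff hp]; linear_combination hS
  refine hf ![p, q, x, f.der 2 x, y, w, r, f.der 2 y, f.der 2 w, f.der 3 y, f.der 3 w] (by fun_prop)
    (by fun_prop (disch := first | exact hr | exact hp))
    (injective_of_nodup_ofFn ?_) ?_ ?_
  · change [x, y, w].Nodup
    simp [h.ne, hx, hx2]
  · intro j
    fin_cases j
    exacts [g.mem, h.y_mem, h.w_mem]
  · intro j i
    fin_cases j <;> fin_cases i
    exacts [g.val, g.der_eq, rfl, h3, h.val_y, h.der_y, rfl, rfl, h.val_w, h.der_w, rfl, rfl]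

theorem generic_diag_double_endpoint (c : ℝ) : ∀ᶠ f : IncrDiffeo in residual IncrDiffeo,
    ∀ p q r y w, f.DiagOrbit p q c → ¬ f.OffOrbit p q r y w := by
  filter_upwards [residual_avoid (d := 5) (k := 3) (n := 2) (by norm_num)
    (fun θ => ![c, θ 2, θ 3])
    (fun θ => ![![θ 1 - θ 0 * c, θ 0], ![θ 1 - θ 0 * θ 3, θ 0 * θ 4], ![θ 1 - θ 0 * θ 2, θ 0 / θ 4]])] with f hf p q r y w g h
  have hr := h.r_pos.ne'
  have hx := g.ne_left h
  have hx2 := g.ne_left h.swap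
  refine hf ![p, q, y, w, r] (by fun_prop)
    (by fun_prop (disch := exact hr))
    (injective_of_nodup_ofFn ?_) ?_ ?_
  · change [c, y, w].Nodup
    simp [h.ne, hx, hx2]
  · intro j
    fin_cases j
    exacts [g.mem, h.y_mem, h.w_mem]
  · intro j i
    fin_cases j <;> fin_cases i
    exacts [g.val, g.der_eq, h.val_y, h.der_y, h.val_w, h.der_w]

theorem generic_diag_double_off_endpoint (c : ℝ) : ∀ᶠ f : IncrDiffeo in residual IncrDiffeo,
    ∀ p q r x w, f.DiagOrbit p q x → ¬ f.OffOrbit p q r c w := by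
  filter_upwards [residual_avoid (d := 5) (k := 3) (n := 2) (by norm_num)
    (fun θ => ![θ 2, c, θ 3])
    (fun θ => ![![θ 1 - θ 0 * θ 2, θ 0], ![θ 1 - θ 0 * θ 3, θ 0 * θ 4], ![θ 1 - θ 0 * c, θ 0 / θ 4]])] with f hf p q r x w g h
  have hr := h.r_pos.ne'
  have hx := g.ne_left h
  have hx2 := g.ne_left h.swap
  refine hf ![p, q, x, w, r] (by fun_prop)
    (by fun_prop (disch := exact hr))
    (injective_of_nodup_ofFn ?_) ?_ ?_
  · change [x, c, w].Nodup
    simp [h.ne, hx, hx2]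
  · intro j
    fin_cases j
    exacts [g.mem, h.y_mem, h.w_mem]
  · intro j i
    fin_cases j <;> fin_cases i
    exacts [g.val, g.der_eq, h.val_y, h.der_y, h.val_w, h.der_w]

theorem generic_diag_double_fold : ∀ᶠ f : IncrDiffeo in residual IncrDiffeo,
    ∀ p q r x y w, f.DiagOrbit p q x → f.OffOrbit p q r y w →
      f.der 2 y ≠ r ^ 3 * f.der 2 w := by
  filter_upwards [residual_avoid (d := 8) (k := 3) (n := 3) (by norm_num)
    (fun θ => ![θ 2, θ 4, θ 5])
    (fun θ => ![![θ 1 - θ 0 * θ 2, θ 0, θ 3],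
      ![θ 1 - θ 0 * θ 5, θ 0 * θ 6, θ 7],
      ![θ 1 - θ 0 * θ 4, θ 0 / θ 6, θ 7 / θ 6 ^ 3]])] with f hf p q r x y w g h hK
  have hr := h.r_pos.ne'
  have hx := g.ne_left h
  have hx2 := g.ne_left h.swap
  have hr3 : r ^ 3 ≠ 0 := pow_ne_zero 3 hr
  have h2w : f.der 2 w = f.der 2 y / r ^ 3 := by rw [eq_div_iff hr3]; linear_combination -hK
  refine hf ![p, q, x, f.der 2 x, y, w, r, f.der 2 y] (by fun_prop)
    (by fun_prop (disch := first | exact hr | exact hr3))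
    (injective_of_nodup_ofFn ?_) ?_ ?_
  · change [x, y, w].Nodup
    simp [h.ne, hx, hx2]
  · intro j
    fin_cases j
    exacts [g.mem, h.y_mem, h.w_mem]
  · intro j i
    fin_cases j <;> fin_cases i
    exacts [g.val, g.der_eq, rfl, h.val_y, h.der_y, rfl, h.val_w, h.der_w, h2w]

/-- Over one point, the branches of the contour given by a one-point orbit and by a two-point
orbit have different tangent lines. -/
theorem generic_diag_double_tangent : ∀ᶠ f : IncrDiffeo in residual IncrDiffeo,
    ∀ p q r x y w, f.DiagOrbit p q x → f.OffOrbit p q r y w →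
      f.der 2 x * ((r * y - w) - (r - 1) * x) ≠ 2 * p * (r - 1) := by
  filter_upwards [residual_avoid (d := 8) (k := 3) (n := 3) (by norm_num)
    (fun θ => ![θ 2, θ 3, θ 4])
    (fun θ => ![![θ 1 - θ 0 * θ 2, θ 0, 2 * θ 0 * (θ 5 - 1) / ((θ 5 * θ 3 - θ 4) - (θ 5 - 1) * θ 2)],
      ![θ 1 - θ 0 * θ 4, θ 0 * θ 5, θ 6],
      ![θ 1 - θ 0 * θ 3, θ 0 / θ 5, θ 7]])] with f hf p q r x y w g h hT
  have hr := h.r_pos.ne'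
  have hx := g.ne_left h
  have hx2 := g.ne_left h.swap
  have hD : (r * y - w) - (r - 1) * x ≠ 0 := by
    intro h0
    rw [h0, mul_zero, eq_comm, mul_eq_zero, or_iff_right (mul_ne_zero two_ne_zero h.p_pos.ne')] at hT
    exact h.sub_ne (by linear_combination h0 + (x - y) * hT)
  have h2x : f.der 2 x = 2 * p * (r - 1) / ((r * y - w) - (r - 1) * x) := by rw [eq_div_iff hD]; exact hT
  refine hf ![p, q, x, y, w, r, f.der 2 y, f.der 2 w] (by fun_prop)
    (by fun_prop (disch := first | exact hr | exact hD))
    (injective_of_nodup_ofFn ?_) ?_ ?_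
  · change [x, y, w].Nodup
    simp [h.ne, hx, hx2]
  · intro j
    fin_cases j
    exacts [g.mem, h.y_mem, h.w_mem]
  · intro j i
    fin_cases j <;> fin_cases i
    exacts [g.val, g.der_eq, h2x, h.val_y, h.der_y, rfl, h.val_w, h.der_w, rfl]

theorem generic_double_fold : ∀ᶠ f : IncrDiffeo in residual IncrDiffeo,
    ∀ p q r y w r' y' w', f.OffOrbit p q r y w → f.OffOrbit p q r' y' w' → y' ≠ y → y' ≠ w →
      f.der 2 y ≠ r ^ 3 * f.der 2 w := by
  filter_upwards [residual_avoid (d := 11) (k := 4) (n := 3) (by norm_num)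
    (fun θ => ![θ 2, θ 3, θ 6, θ 7])
    (fun θ => ![![θ 1 - θ 0 * θ 3, θ 0 * θ 4, θ 5],
      ![θ 1 - θ 0 * θ 2, θ 0 / θ 4, θ 5 / θ 4 ^ 3],
      ![θ 1 - θ 0 * θ 7, θ 0 * θ 8, θ 9],
      ![θ 1 - θ 0 * θ 6, θ 0 / θ 8, θ 10]])] with f hf p q r y w r' y' w' h h' hy hw hK
  have hr := h.r_pos.ne'
  have hr' := h'.r_pos.ne'
  have hy2 : w ≠ w' := h.ne_right h' hy.symm
  have hw2 : y ≠ w' := h.swap.ne_right h' (Ne.symm hw)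
  have hr3 : r ^ 3 ≠ 0 := pow_ne_zero 3 hr
  have h2w : f.der 2 w = f.der 2 y / r ^ 3 := by rw [eq_div_iff hr3]; linear_combination -hK
  refine hf ![p, q, y, w, r, f.der 2 y, y', w', r', f.der 2 y', f.der 2 w'] (by fun_prop)
    (by fun_prop (disch := first | exact hr | exact hr' | exact hr3))
    (injective_of_nodup_ofFn ?_) ?_ ?_
  · change [y, w, y', w'].Nodup
    simp [h.ne, h'.ne, hy2, hw2, hy.symm, hw.symm]
  · intro j
    fin_cases j
    exacts [h.y_mem, h.w_mem, h'.y_mem, h'.w_mem]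
  · intro j i
    fin_cases j <;> fin_cases i
    exacts [h.val_y, h.der_y, rfl, h.val_w, h.der_w, h2w, h'.val_y, h'.der_y, rfl, h'.val_w, h'.der_w, rfl]

theorem generic_double_endpoint (c : ℝ) : ∀ᶠ f : IncrDiffeo in residual IncrDiffeo,
    ∀ p q r w r' y' w', f.OffOrbit p q r c w → f.OffOrbit p q r' y' w' → y' ≠ c → y' = w := by
  filter_upwards [residual_avoid (d := 7) (k := 4) (n := 2) (by norm_num)
    (fun θ => ![c, θ 2, θ 4, θ 5])
    (fun θ => ![![θ 1 - θ 0 * θ 2, θ 0 * θ 3],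
      ![θ 1 - θ 0 * c, θ 0 / θ 3],
      ![θ 1 - θ 0 * θ 5, θ 0 * θ 6],
      ![θ 1 - θ 0 * θ 4, θ 0 / θ 6]])] with f hf p q r w r' y' w' h h' hy
  by_contra hw
  have hr := h.r_pos.ne'
  have hr' := h'.r_pos.ne'
  have hy2 : w ≠ w' := h.ne_right h' hy.symm
  have hw2 : c ≠ w' := h.swap.ne_right h' (Ne.symm hw)
  refine hf ![p, q, w, r, y', w', r'] (by fun_prop)
    (by fun_prop (disch := first | exact hr | exact hr'))
    (injective_of_nodup_ofFn ?_) ?_ ?_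
  · change [c, w, y', w'].Nodup
    simp [h.ne, h'.ne, hy2, hw2, hy.symm, Ne.symm hw]
  · intro j
    fin_cases j
    exacts [h.y_mem, h.w_mem, h'.y_mem, h'.w_mem]
  · intro j i
    fin_cases j <;> fin_cases i
    exacts [h.val_y, h.der_y, h.val_w, h.der_w, h'.val_y, h'.der_y, h'.val_w, h'.der_w]

theorem generic_no_diag_triple : ∀ᶠ f : IncrDiffeo in residual IncrDiffeo,
    ∀ p q r x y w r' y' w', f.DiagOrbit p q x → f.OffOrbit p q r y w →
      f.OffOrbit p q r' y' w' → y' ≠ y → y' = w := by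
  filter_upwards [residual_avoid (d := 9) (k := 5) (n := 2) (by norm_num)
    (fun θ => ![θ 2, θ 3, θ 4, θ 6, θ 7])
    (fun θ => ![![θ 1 - θ 0 * θ 2, θ 0],
      ![θ 1 - θ 0 * θ 4, θ 0 * θ 5],
      ![θ 1 - θ 0 * θ 3, θ 0 / θ 5],
      ![θ 1 - θ 0 * θ 7, θ 0 * θ 8],
      ![θ 1 - θ 0 * θ 6, θ 0 / θ 8]])] with f hf p q r x y w r' y' w' g h h' hy
  by_contra hw
  have hr := h.r_pos.ne'
  have hr' := h'.r_pos.ne'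
  have hy2 : w ≠ w' := h.ne_right h' hy.symm
  have hw2 : y ≠ w' := h.swap.ne_right h' (Ne.symm hw)
  have hx := g.ne_left h
  have hx2 := g.ne_left h.swap
  have hx3 := g.ne_left h'
  have hx4 := g.ne_left h'.swap
  refine hf ![p, q, x, y, w, r, y', w', r'] (by fun_prop)
    (by fun_prop (disch := first | exact hr | exact hr'))
    (injective_of_nodup_ofFn ?_) ?_ ?_
  · change [x, y, w, y', w'].Nodup
    simp [h.ne, h'.ne, hy2, hw2, hy.symm, Ne.symm hw, hx, hx2, hx3, hx4]
  · intro j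
    fin_cases j
    exacts [g.mem, h.y_mem, h.w_mem, h'.y_mem, h'.w_mem]
  · intro j i
    fin_cases j <;> fin_cases i
    exacts [g.val, g.der_eq, h.val_y, h.der_y, h.val_w, h.der_w, h'.val_y, h'.der_y, h'.val_w, h'.der_w]

theorem generic_no_triple : ∀ᶠ f : IncrDiffeo in residual IncrDiffeo,
    ∀ p q r y w r' y' w' r'' y'' w'', f.OffOrbit p q r y w → f.OffOrbit p q r' y' w' →
      f.OffOrbit p q r'' y'' w'' → y' ≠ y → y' ≠ w → y'' ≠ y → y'' ≠ w → y'' ≠ y' → y'' = w' := by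
  filter_upwards [residual_avoid (d := 11) (k := 6) (n := 2) (by norm_num)
    (fun θ => ![θ 2, θ 3, θ 5, θ 6, θ 8, θ 9])
    (fun θ => ![![θ 1 - θ 0 * θ 3, θ 0 * θ 4],
      ![θ 1 - θ 0 * θ 2, θ 0 / θ 4],
      ![θ 1 - θ 0 * θ 6, θ 0 * θ 7],
      ![θ 1 - θ 0 * θ 5, θ 0 / θ 7],
      ![θ 1 - θ 0 * θ 9, θ 0 * θ 10],
      ![θ 1 - θ 0 * θ 8, θ 0 / θ 10]])] with f hf p q r y w r' y' w' r'' y'' w'' h h' h'' hy hw ky kw l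
  by_contra lw
  have hr := h.r_pos.ne'
  have hr' := h'.r_pos.ne'
  have hr'' := h''.r_pos.ne'
  have hy2 : w ≠ w' := h.ne_right h' hy.symm
  have hw2 : y ≠ w' := h.swap.ne_right h' (Ne.symm hw)
  have ky2 : w ≠ w'' := h.ne_right h'' ky.symm
  have kw2 : y ≠ w'' := h.swap.ne_right h'' kw.symm
  have l2 : w' ≠ w'' := h'.ne_right h'' (Ne.symm l)
  have lw2 : y' ≠ w'' := h'.swap.ne_right h'' (Ne.symm lw)
  refine hf ![p, q, y, w, r, y', w', r', y'', w'', r''] (by fun_prop)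
    (by fun_prop (disch := first | exact hr | exact hr' | exact hr''))
    (injective_of_nodup_ofFn ?_) ?_ ?_
  · change [y, w, y', w', y'', w''].Nodup
    simp
      [h.ne, h'.ne, h''.ne, hy2, hw2, hy.symm, hw.symm, ky2, kw2, ky.symm, kw.symm, l2, lw2,
        Ne.symm l, Ne.symm lw]
  · intro j
    fin_cases j
    exacts [h.y_mem, h.w_mem, h'.y_mem, h'.w_mem, h''.y_mem, h''.w_mem]
  · intro j i
    fin_cases j <;> fin_cases i
    exacts [h.val_y, h.der_y, h.val_w, h.der_w, h'.val_y, h'.der_y, h'.val_w, h'.der_w,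
      h''.val_y, h''.der_y, h''.val_w, h''.der_w]

/-- The properties of the orbits of `f` that hold generically: each of them excludes a family of
multijets with fewer parameters than conditions. -/
structure IncrDiffeo.IsGeneric (f : IncrDiffeo) : Prop where
  schwarz_simple : ∀ x ∈ Icc (-1 : ℝ) 1, f.schwarz x = 0 → f.schwarz' x ≠ 0
  schwarz_ne : ∀ x, x = 1 ∨ x = -1 → f.schwarz x ≠ 0
  quint_ne : ∀ x ∈ Icc (-1 : ℝ) 1, f.schwarz x = 0 → f.quint x ≠ 0
  cusp : ∀ p q r y w, f.OffOrbit p q r y w → f.der 2 y = r ^ 3 * f.der 2 w →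
    f.der 3 y + r ^ 4 * f.der 3 w - 3 * r ^ 2 * f.der 2 y * f.der 2 w / p ≠ 0
  regular : ∀ p q r y w, f.OffOrbit p q r y w →
    ¬ (f.der 2 y * (y - w) = 2 * p * r * (r - 1) ∧
      f.der 2 w * r ^ 2 * (y - w) = 2 * p * (r - 1))
  end_transversal : ∀ p q r y w, f.OffOrbit p q r y w → y = 1 ∨ y = -1 →
    f.der 2 w * r ^ 2 * (y - w) ≠ 2 * p * (r - 1)
  end_fold : ∀ p q r y w, f.OffOrbit p q r y w → y = 1 ∨ y = -1 →
    f.der 2 y ≠ r ^ 3 * f.der 2 w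
  end_pair : ∀ p q r y w, f.OffOrbit p q r y w → y = 1 ∨ y = -1 → ¬ (w = 1 ∨ w = -1)
  diag_schwarz : ∀ p q r x y w, f.DiagOrbit p q x → f.OffOrbit p q r y w → f.schwarz x ≠ 0
  diag_end : ∀ p q r x y w, f.DiagOrbit p q x → f.OffOrbit p q r y w → ¬ (x = 1 ∨ x = -1)
  diag_off_end : ∀ p q r x y w, f.DiagOrbit p q x → f.OffOrbit p q r y w → ¬ (y = 1 ∨ y = -1)
  diag_fold : ∀ p q r x y w, f.DiagOrbit p q x → f.OffOrbit p q r y w →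
    f.der 2 y ≠ r ^ 3 * f.der 2 w
  diag_tangent : ∀ p q r x y w, f.DiagOrbit p q x → f.OffOrbit p q r y w →
    f.der 2 x * ((r * y - w) - (r - 1) * x) ≠ 2 * p * (r - 1)
  double_fold : ∀ p q r y w r' y' w', f.OffOrbit p q r y w → f.OffOrbit p q r' y' w' →
    y' ≠ y → y' ≠ w → f.der 2 y ≠ r ^ 3 * f.der 2 w
  double_end : ∀ p q r y w r' y' w', f.OffOrbit p q r y w → f.OffOrbit p q r' y' w' →
    y' ≠ y → y' ≠ w → ¬ (y = 1 ∨ y = -1)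
  double_tangent : ∀ p q r y w r' y' w', f.OffOrbit p q r y w → f.OffOrbit p q r' y' w' →
    y' ≠ y → y' ≠ w → (r - 1) * (r' * y' - w') - (r' - 1) * (r * y - w) ≠ 0
  diag_triple : ∀ p q r x y w r' y' w', f.DiagOrbit p q x → f.OffOrbit p q r y w →
    f.OffOrbit p q r' y' w' → y' ≠ y → y' = w
  triple : ∀ p q r y w r' y' w' r'' y'' w'', f.OffOrbit p q r y w → f.OffOrbit p q r' y' w' →
    f.OffOrbit p q r'' y'' w'' → y' ≠ y → y' ≠ w → y'' ≠ y → y'' ≠ w → y'' ≠ y' → y'' = w'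

theorem residual_isGeneric : ∀ᶠ f : IncrDiffeo in residual IncrDiffeo, f.IsGeneric := by
  filter_upwards [generic_schwarz_simple, generic_schwarz_ne (c := 1) (by norm_num),
    generic_schwarz_ne (c := -1) (by norm_num), generic_quint, generic_cusp,
    generic_horizon_regular, generic_endpoint_transversal 1, generic_endpoint_transversal (-1),
    generic_endpoint_fold 1, generic_endpoint_fold (-1), generic_endpoint_pair 1 (-1),
    generic_endpoint_pair (-1) 1, generic_diag_double_schwarz, generic_diag_double_endpoint 1,
    generic_diag_double_endpoint (-1), generic_diag_double_off_endpoint 1,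
    generic_diag_double_off_endpoint (-1), generic_diag_double_fold, generic_diag_double_tangent,
    generic_double_fold, generic_double_endpoint 1, generic_double_endpoint (-1),
    generic_double_tangent, generic_no_diag_triple, generic_no_triple]
    with f h1 h2 h2' h3 h4 h5 h6 h6' h7 h7' h8 h8' h9 h10 h10' h11 h11' h12 h13 h14 h15 h15' h16
      h17 h18
  refine ⟨h1, ?_, h3, h4, h5, ?_, ?_, ?_, h9, ?_, ?_, h12, h13, h14, ?_, h16, h17, h18⟩
  · rintro x (rfl | rfl) <;> assumption
  · rintro p q r y w h (rfl | rfl)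
    exacts [h6 p q r w h, h6' p q r w h]
  · rintro p q r y w h (rfl | rfl)
    exacts [h7 p q r w h, h7' p q r w h]
  · rintro p q r y w h (rfl | rfl) (rfl | rfl)
    exacts [h.ne rfl, h8 p q r h, h8' p q r h, h.ne rfl]
  · rintro p q r x y w g h (rfl | rfl)
    exacts [h10 p q r y w g h, h10' p q r y w g h]
  · rintro p q r x y w g h (rfl | rfl)
    exacts [h11 p q r x w g h, h11' p q r x w g h]
  · rintro p q r y w r' y' w' h h' hy hw (rfl | rfl)
    exacts [hw (h15 p q r w r' y' w' h h' hy), hw (h15' p q r w r' y' w' h h' hy)]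

/-! ### Points of the horizon and their orbits -/

theorem partner_eq_iff (f : IncrDiffeo) {y p q w : ℝ} (hp : 0 < p) :
    partner f (y, p, q) = w ↔ f y = q - p * w := by
  have := hp.ne'
  simp only [partner]
  constructor
  · rintro rfl; field_simp; ring
  · intro h; rw [h]; field_simp; ring

theorem phiY_one (f : IncrDiffeo) (y p q : ℝ) :
    phiY f 1 y p q = -p + f.der 1 (partner f (y, p, q)) * (1 / p * f.der 1 y) := by
  have h1 : HasDerivAt (fun t => -(1 / p) * f t + q / p) (-(1 / p) * f.der 1 y) y :=
    ((f.hasDerivAt y).const_mul _).add_const _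
  have h2 := (f.hasDerivAt (-(1 / p) * f y + q / p)).comp y h1
  have h3 := (((hasDerivAt_id y).const_mul (-p)).add_const q).sub h2
  rw [phiY, iteratedDeriv_one]
  refine (h3.congr_deriv ?_).deriv
  simp only [partner]
  ring

/-- A point of the horizon is a point `y`, with `w = partner`, such that the map
`T(t) = (q - f(t)) / p` exchanges `y` and `w` and `(T²)'(y) = 1`. -/
theorem mem_horizon_iff (f : IncrDiffeo) {y p q w : ℝ} (hw : partner f (y, p, q) = w) :
    (y, p, q) ∈ horizon f ↔ y ∈ Icc (-1 : ℝ) 1 ∧ 0 < p ∧ w ∈ Icc (-1 : ℝ) 1 ∧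
      f y = q - p * w ∧ f w = q - p * y ∧ f.der 1 y * f.der 1 w = p ^ 2 := by
  have h1 : phi f y p q = -p * y + q - f w := by rw [← hw]; rfl
  simp only [horizon, mem_ofPred_eq, hw, phiY_one, h1]
  constructor
  · rintro ⟨h1, hp, h2, h3, h4⟩
    refine ⟨h1, hp, h2, (partner_eq_iff f hp).1 hw, by linarith, ?_⟩
    have := hp.ne'
    field_simp at h4
    linear_combination h4
  · rintro ⟨h1, hp, h2, h3, h4, h5⟩
    refine ⟨h1, hp, h2, by linarith, ?_⟩
    have := hp.ne'
    field_simp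
    linear_combination h5

theorem mem_horizon_swap {f : IncrDiffeo} {h : ℝ × ℝ × ℝ} (hh : h ∈ horizon f) :
    (partner f h, h.2) ∈ horizon f ∧ partner f (partner f h, h.2) = h.1 := by
  obtain ⟨y, p, q⟩ := h
  obtain ⟨h1, hp, h2, h3, h4, h5⟩ := (mem_horizon_iff f rfl).1 hh
  have hw : partner f (partner f (y, p, q), p, q) = y := (partner_eq_iff f hp).2 h4
  exact ⟨(mem_horizon_iff f hw).2 ⟨h2, hp, h1, h4, h3, by rw [mul_comm]; exact h5⟩, hw⟩

theorem offOrbit_of_mem_horizon {f : IncrDiffeo} {h : ℝ × ℝ × ℝ} (hh : h ∈ horizon f)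
    (hne : h.1 ≠ partner f h) :
    f.OffOrbit h.2.1 h.2.2 (f.der 1 h.1 / h.2.1) h.1 (partner f h) := by
  obtain ⟨y, p, q⟩ := h
  obtain ⟨h1, hp, h2, h3, h4, h5⟩ := (mem_horizon_iff f rfl).1 hh
  have hd := f.der_one_pos h1
  refine ⟨h1, h2, hne, hp, div_pos hd hp, by rwa [der_zero], by rwa [der_zero], ?_, ?_⟩
  · field_simp
  · field_simp; linear_combination h5

theorem diagOrbit_of_mem_horizon {f : IncrDiffeo} {h : ℝ × ℝ × ℝ} (hh : h ∈ horizon f)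
    (heq : h.1 = partner f h) : f.DiagOrbit h.2.1 h.2.2 h.1 := by
  obtain ⟨y, p, q⟩ := h
  obtain ⟨h1, hp, h2, h3, h4, h5⟩ := (mem_horizon_iff f heq.symm).1 hh
  refine ⟨h1, by rwa [der_zero], ?_⟩
  have hd := f.der_one_pos h1
  exact (pow_left_inj₀ hd.le hp.le two_ne_zero).1 (by rw [sq]; exact h5)

theorem IncrDiffeo.OffOrbit.mem_horizon {f : IncrDiffeo} {p q r y w : ℝ}
    (h : f.OffOrbit p q r y w) : (y, p, q) ∈ horizon f ∧ partner f (y, p, q) = w := by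
  have h1 := h.val_y
  have h2 := h.val_w
  rw [der_zero] at h1 h2
  have hw := (partner_eq_iff f h.p_pos).2 h1
  refine ⟨(mem_horizon_iff f hw).2 ⟨h.y_mem, h.p_pos, h.w_mem, h1, h2, ?_⟩, hw⟩
  have := h.r_pos.ne'
  rw [h.der_y, h.der_w]
  field_simp

theorem IncrDiffeo.DiagOrbit.mem_horizon {f : IncrDiffeo} {p q x : ℝ}
    (h : f.DiagOrbit p q x) : (x, p, q) ∈ horizon f ∧ partner f (x, p, q) = x := by
  have h1 := h.val
  rw [der_zero] at h1
  have hw := (partner_eq_iff f h.p_pos).2 h1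
  exact ⟨(mem_horizon_iff f hw).2 ⟨h.mem, h.p_pos, h.mem, h1, h1, by rw [h.der_eq, sq]⟩, hw⟩

theorem curveL_eq (f : IncrDiffeo) (x : ℝ) : curveL f x = (f.der 1 x, f.der 1 x * x + f x) := by
  rw [curveL, der_one]

theorem diagOrbit_iff {f : IncrDiffeo} {p q x : ℝ} :
    f.DiagOrbit p q x ↔ x ∈ Icc (-1 : ℝ) 1 ∧ (p, q) = curveL f x := by
  rw [curveL_eq]
  constructor
  · rintro ⟨h1, h2, h3⟩
    rw [der_zero] at h2
    exact ⟨h1, Prod.ext h3.symm (by simp only [h2, h3]; ring)⟩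
  · rintro ⟨h1, h2⟩
    obtain ⟨rfl, rfl⟩ := Prod.ext_iff.1 h2
    exact ⟨h1, by rw [der_zero]; ring, rfl⟩

/-- Over each point there is at most one orbit with a single element, since `p t + f(t)` is
increasing. -/
theorem IncrDiffeo.DiagOrbit.unique {f : IncrDiffeo} {p q x x' : ℝ} (h : f.DiagOrbit p q x)
    (h' : f.DiagOrbit p q x') : x = x' := by
  have hmono : StrictMonoOn f (Icc (-1) 1) :=
    strictMonoOn_of_deriv_pos (convex_Icc _ _) f.smooth.continuous.continuousOn fun x hx =>
      f.deriv_pos x (interior_subset hx)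
  have h1 := h.val
  have h2 := h'.val
  have hp := h.p_pos
  rw [der_zero] at h1 h2
  rcases lt_trichotomy x x' with hlt | heq | hlt
  · nlinarith [hmono h.mem h'.mem hlt]
  · exact heq
  · nlinarith [hmono h'.mem h.mem hlt]

theorem isCompact_horizon (f : IncrDiffeo) : IsCompact (horizon f) := by
  have hc : Continuous f.toFun := f.smooth.continuous
  have hd := f.continuous_der 1
  set g : ℝ × ℝ → ℝ := fun z => √(f.der 1 z.1 * f.der 1 z.2) with hg
  have hgc : Continuous g := by fun_prop
  have hK : IsCompact ((Icc (-1 : ℝ) 1 ×ˢ Icc (-1 : ℝ) 1) ∩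
      {z : ℝ × ℝ | f z.1 - f z.2 = g z * (z.1 - z.2)}) :=
    (isCompact_Icc.prod isCompact_Icc).inter_right (isClosed_eq (by fun_prop) (by fun_prop))
  convert hK.image (f := fun z => (z.1, g z, f z.1 + g z * z.2)) (by fun_prop) using 1
  ext ⟨y, p, q⟩
  constructor
  · intro hh
    obtain ⟨h1, hp, h2, h3, h4, h5⟩ := (mem_horizon_iff f rfl).1 hh
    have hgp : g (y, partner f (y, p, q)) = p := by
      simp only [hg]; rw [h5, Real.sqrt_sq hp.le]
    refine ⟨(y, partner f (y, p, q)), ⟨⟨h1, h2⟩, ?_⟩, ?_⟩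
    · simp only [mem_ofPred_eq, hgp]; linarith
    · simp only [hgp, h3]; ext <;> simp
  · rintro ⟨⟨y', w⟩, ⟨⟨h1, h2⟩, h3⟩, h4⟩
    simp only [Prod.mk.injEq] at h4
    obtain ⟨rfl, rfl, rfl⟩ := h4
    have hpos : 0 < f.der 1 y' * f.der 1 w := mul_pos (f.der_one_pos h1) (f.der_one_pos h2)
    have hg0 : 0 < g (y', w) := Real.sqrt_pos.2 hpos
    simp only [mem_ofPred_eq] at h3
    refine (mem_horizon_iff f ((partner_eq_iff f (w := w) hg0).2 (by ring))).2
      ⟨h1, hg0, h2, by ring, by linarith, (Real.sq_sqrt hpos.le).symm⟩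

theorem continuousAt_partner (f : IncrDiffeo) {h : ℝ × ℝ × ℝ} (hp : 0 < h.2.1) :
    ContinuousAt (partner f) h := by
  have hc : Continuous f.toFun := f.smooth.continuous
  have := hp.ne'
  unfold partner
  refine ContinuousAt.add (ContinuousAt.mul (ContinuousAt.neg ?_) (by fun_prop)) ?_
  · exact continuousAt_const.div (by fun_prop) this
  · exact ContinuousAt.div (by fun_prop) (by fun_prop) this

/-! ### Neighborhoods in the apparent contour -/

/-- As the horizon is compact, a set containing a neighborhood of one point of each orbit over `z`
projects to a neighborhood of `z` in the apparent contour. -/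
theorem image_snd_mem_nhdsWithin_contour {f : IncrDiffeo} {z : ℝ × ℝ} {W : Set (ℝ × ℝ × ℝ)}
    (hW : ∀ k ∈ horizon f, k.2 = z →
      W ∈ 𝓝[horizon f] k ∨ W ∈ 𝓝[horizon f] (partner f k, k.2)) :
    Prod.snd '' W ∈ 𝓝[apparentContour f] z := by
  set O : Set (ℝ × ℝ × ℝ) := {k | ∀ᶠ x in 𝓝 k, x ∈ horizon f → x ∈ W ∨ (partner f x, x.2) ∈ W}
    with hO
  have hOo : IsOpen O := isOpen_setOfPred_eventually_nhds
  have hfib : ∀ k ∈ horizon f, k.2 = z → k ∈ O := by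
    intro k hk hz
    rcases hW k hk hz with h | h
    · rw [mem_nhdsWithin_iff_eventually] at h
      exact h.mono fun x hx hh => Or.inl (hx hh)
    · have hcont : ContinuousAt (fun x : ℝ × ℝ × ℝ => (partner f x, x.2)) k :=
        (continuousAt_partner f hk.2.1).prodMk continuousAt_snd
      rw [mem_nhdsWithin_iff_eventually] at h
      exact (hcont.eventually h).mono fun x hx hh => Or.inr (hx (mem_horizon_swap hh).1)
  have hcl : IsClosed (Prod.snd '' (horizon f \ O)) :=
    (((isCompact_horizon f).diff hOo).image continuous_snd).isClosed
  have hz : z ∉ Prod.snd '' (horizon f \ O) := by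
    rintro ⟨k, ⟨hk, hkO⟩, hkz⟩
    exact hkO (hfib k hk hkz)
  rw [mem_nhdsWithin_iff_eventually]
  filter_upwards [hcl.isOpen_compl.mem_nhds hz] with x hx
  rintro ⟨k, hk, rfl⟩
  have hkO : k ∈ O := by
    by_contra hkO
    exact hx ⟨k, ⟨hk, hkO⟩, rfl⟩
  rcases (mem_of_mem_nhds hkO : k ∈ horizon f → _) hk with h | h
  · exact ⟨k, h, rfl⟩
  · exact ⟨_, h, rfl⟩

/-- A curve `c` that parametrizes the horizon near `h` when restricted to parameters in `T` near
`0`: `T` is the line in the interior and a half-line at an end of the horizon. -/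
structure IsHorizonArc (f : IncrDiffeo) (h : ℝ × ℝ × ℝ) (T : Set ℝ) (c : ℝ → ℝ × ℝ × ℝ) :
    Prop where
  smooth : ∀ᶠ t in 𝓝 0, ContDiffAt ℝ ∞ c t
  base : c 0 = h
  inj : ∃ U ∈ 𝓝 (0 : ℝ), InjOn c U
  mem : ∀ᶠ t in 𝓝 0, t ∈ T → c t ∈ horizon f
  nhds : ∀ U ∈ 𝓝 (0 : ℝ), c '' (U ∩ T) ∈ 𝓝[horizon f] h

theorem eventually_Icc_subset {U : Set ℝ} (hU : U ∈ 𝓝 (0 : ℝ)) :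
    ∀ᶠ ε in 𝓝[>] (0 : ℝ), Icc (-ε) ε ⊆ U := by
  obtain ⟨δ, hδ, h⟩ := Metric.nhds_basis_closedBall.mem_iff.1 hU
  filter_upwards [Ioc_mem_nhdsGT hδ] with ε hε x hx
  apply h
  rw [Real.closedBall_eq_Icc]
  constructor <;> linarith [hx.1, hx.2, hε.2]

theorem eventually_isLocalParam {E : Type*} [NormedAddCommGroup E] [NormedSpace ℝ E] {S : Set E}
    {x : E} {c : ℝ → E} {T : Set ℝ} (hsm : ∀ᶠ t in 𝓝 0, ContDiffAt ℝ ∞ c t) (h0 : c 0 = x)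
    (hinj : ∃ U ∈ 𝓝 (0 : ℝ), InjOn c U) (hmem : ∀ᶠ t in 𝓝 0, t ∈ T → c t ∈ S)
    (hnhds : ∀ U ∈ 𝓝 (0 : ℝ), c '' (U ∩ T) ∈ 𝓝[S] x) :
    ∀ᶠ ε in 𝓝[>] (0 : ℝ), IsLocalParam S x (Icc (-ε) ε ∩ T) ε c := by
  obtain ⟨U, hU, hi⟩ := hinj
  filter_upwards [eventually_Icc_subset hsm, eventually_Icc_subset hU, eventually_Icc_subset hmem,
    self_mem_nhdsWithin] with ε h1 h2 h3 hε
  refine ⟨hε, fun t ht => ContDiffAt.contDiffWithinAt (h1 ht : ContDiffAt ℝ ∞ c t), hi.mono h2, h0, ?_, hnhds _ ?_⟩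
  · rintro _ ⟨t, ht, rfl⟩
    exact h3 ht.1 ht.2
  · exact Icc_mem_nhds (neg_lt_zero.2 hε) hε

theorem IsHorizonArc.eventually_isLocalParam {f : IncrDiffeo} {h : ℝ × ℝ × ℝ} {T : Set ℝ}
    {c : ℝ → ℝ × ℝ × ℝ} (hc : IsHorizonArc f h T c) :
    ∀ᶠ ε in 𝓝[>] (0 : ℝ), IsLocalParam (horizon f) h (Icc (-ε) ε ∩ T) ε c :=
  _root_.eventually_isLocalParam hc.smooth hc.base hc.inj hc.mem hc.nhds

theorem IsHorizonArc.eventually_isContourParam {f : IncrDiffeo} {h : ℝ × ℝ × ℝ} {T : Set ℝ}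
    {c : ℝ → ℝ × ℝ × ℝ} (hc : IsHorizonArc f h T c) (hmeet : ¬ ∃ k, MeetAt f h k)
    (hh : h ∈ horizon f) (hinj : ∃ U ∈ 𝓝 (0 : ℝ), InjOn (fun t => (c t).2) U) :
    ∀ᶠ ε in 𝓝[>] (0 : ℝ), IsContourParam f h (Icc (-ε) ε ∩ T) ε c := by
  refine hc.eventually_isLocalParam.and (_root_.eventually_isLocalParam ?_ ?_ hinj ?_ ?_)
  · exact hc.smooth.mono fun t ht => contDiff_snd.contDiffAt.comp t ht
  · rw [hc.base]
  · exact hc.mem.mono fun t ht hT => ⟨_, ht hT, rfl⟩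
  · intro U hU
    have h1 := hc.nhds U hU
    have h2 : (fun t => (c t).2) '' (U ∩ T) = Prod.snd '' (c '' (U ∩ T)) := by
      rw [image_image]
    rw [h2]
    apply image_snd_mem_nhdsWithin_contour
    intro k hk hkz
    by_cases hk1 : k.1 = h.1
    · left
      rwa [show k = h from Prod.ext hk1 hkz]
    · right
      have hk2 : k.1 = partner f h := by
        by_contra hk2
        exact hmeet ⟨k, hh, hk, hkz.symm, hk1, hk2⟩
      have : (partner f k, k.2) = h := by
        rw [show k = (partner f h, h.2) from Prod.ext hk2 hkz, (mem_horizon_swap hh).2]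
      rwa [this]

theorem IsHorizonArc.of_leftInverse {f : IncrDiffeo} {h : ℝ × ℝ × ℝ} {T : Set ℝ}
    {c : ℝ → ℝ × ℝ × ℝ} (θ : ℝ × ℝ × ℝ → ℝ) (hθ : ContinuousWithinAt θ (horizon f) h)
    (hθ0 : θ h = 0) (hθc : ∀ᶠ t in 𝓝 0, θ (c t) = t)
    (hcθ : ∀ᶠ k in 𝓝[horizon f] h, θ k ∈ T ∧ c (θ k) = k)
    (smooth : ∀ᶠ t in 𝓝 0, ContDiffAt ℝ ∞ c t) (base : c 0 = h)
    (mem : ∀ᶠ t in 𝓝 0, t ∈ T → c t ∈ horizon f) : IsHorizonArc f h T c := by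
  refine ⟨smooth, base, ⟨_, hθc, fun s hs t ht hst => ?_⟩, mem, fun U hU => ?_⟩
  · rw [← (hs : θ (c s) = s), ← (ht : θ (c t) = t), hst]
  · have h1 : Tendsto θ (𝓝[horizon f] h) (𝓝 0) := hθ0 ▸ hθ
    filter_upwards [hcθ, h1 hU] with k hk hkU
    exact ⟨θ k, ⟨hkU, hk.1⟩, hk.2⟩

/-! ### Local inverses and level curves -/

/-- The inverse function theorem, with the smoothness of the local inverse at all points of its
domain rather than at one point. -/
theorem exists_smooth_local_inverse {E : Type*} [NormedAddCommGroup E] [NormedSpace ℝ E]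
    [CompleteSpace E] {F : E → E} {x : E} {n : WithTop ℕ∞} (hn : 1 ≤ n)
    (hF : ∀ᶠ z in 𝓝 x, ContDiffAt ℝ n F z) (e : E ≃L[ℝ] E)
    (he : fderiv ℝ F x = e) : ∃ Φ : OpenPartialHomeomorph E E, x ∈ Φ.source ∧ (Φ : E → E) = F ∧
      (∀ z ∈ Φ.source, ContDiffAt ℝ n F z) ∧ ∀ z ∈ Φ.target, ContDiffAt ℝ n Φ.symm z := by
  have hn0 : n ≠ 0 := fun h => by simp [h] at hn
  have hx : ContDiffAt ℝ n F x := hF.self_of_nhds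
  have hd : HasFDerivAt F (e : E →L[ℝ] E) x :=
    he ▸ (hx.differentiableAt hn0).hasFDerivAt
  have hinv : ∀ᶠ z in 𝓝 x, ∃ e' : E ≃L[ℝ] E, fderiv ℝ F z = e' := by
    have hc : ContinuousAt (fderiv ℝ F) x := (hx.fderiv_right (m := 0) (by simpa)).continuousAt
    have := hc.eventually (he ▸ e.nhds : range ((↑) : (E ≃L[ℝ] E) → E →L[ℝ] E) ∈ 𝓝 _)
    exact this.mono fun z ⟨e', h⟩ => ⟨e', h.symm⟩
  obtain ⟨O, hO, hOo, hxO⟩ := eventually_nhds_iff.1 (hF.and hinv)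
  refine ⟨(hx.toOpenPartialHomeomorph F hd hn0).restrOpen O hOo, ?_, rfl, ?_, ?_⟩
  · exact ⟨hx.mem_toOpenPartialHomeomorph_source hd hn0, hxO⟩
  · intro z hz
    exact (hO z hz.2).1
  · intro z hz
    have hz' := ((hx.toOpenPartialHomeomorph F hd hn0).restrOpen O hOo).map_target hz
    obtain ⟨h1, e', h2⟩ := hO _ hz'.2
    exact OpenPartialHomeomorph.contDiffAt_symm _ hz
      (h2 ▸ (h1.differentiableAt hn0).hasFDerivAt) h1

/-- An injective endomorphism of the plane as a continuous linear equivalence. -/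
theorem exists_equiv_of_injective {L : ℝ × ℝ →L[ℝ] ℝ × ℝ} (hL : ∀ v, L v = 0 → v = 0) :
    ∃ e : (ℝ × ℝ) ≃L[ℝ] ℝ × ℝ, L = e :=
  ⟨(LinearEquiv.ofInjectiveEndo (L : ℝ × ℝ →ₗ[ℝ] ℝ × ℝ)
    ((injective_iff_map_eq_zero _).2 hL)).toContinuousLinearEquiv, by ext <;> rfl⟩

/-- A regular level curve in the plane, parametrized by the value of a linear functional
`a y + b w` that is transversal to it. -/
theorem exists_level_curve {G : ℝ × ℝ → ℝ} {z₀ : ℝ × ℝ}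
    (hG : ∀ᶠ z in 𝓝 z₀, ContDiffAt ℝ ∞ G z) (h0 : G z₀ = 0) {G₁ G₂ : ℝ}
    (h₁ : fderiv ℝ G z₀ (1, 0) = G₁) (h₂ : fderiv ℝ G z₀ (0, 1) = G₂) (a b : ℝ)
    (hab : a * G₂ - b * G₁ ≠ 0) :
    ∃ c : ℝ → ℝ × ℝ, c 0 = z₀ ∧ (∀ᶠ t in 𝓝 0, ContDiffAt ℝ ∞ c t) ∧
      (∀ᶠ t in 𝓝 0, G (c t) = 0) ∧
      (∀ᶠ t in 𝓝 0, a * ((c t).1 - z₀.1) + b * ((c t).2 - z₀.2) = t) ∧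
      ∀ᶠ z in 𝓝 z₀, G z = 0 → c (a * (z.1 - z₀.1) + b * (z.2 - z₀.2)) = z := by
  set F : ℝ × ℝ → ℝ × ℝ := fun z => (a * (z.1 - z₀.1) + b * (z.2 - z₀.2), G z) with hFdef
  have hF : ∀ᶠ z in 𝓝 z₀, ContDiffAt ℝ ∞ F z := hG.mono fun z hz => by
    refine ContDiffAt.prodMk ?_ hz
    fun_prop
  have hGd : HasFDerivAt G (fderiv ℝ G z₀) z₀ :=
    (hG.self_of_nhds.differentiableAt (by simp)).hasFDerivAt
  have hFd : HasFDerivAt F ((a • ContinuousLinearMap.fst ℝ ℝ ℝ +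
      b • ContinuousLinearMap.snd ℝ ℝ ℝ).prod (fderiv ℝ G z₀)) z₀ := by
    refine HasFDerivAt.prodMk ?_ hGd
    exact ((hasFDerivAt_fst.sub_const z₀.1).const_mul a).add
      ((hasFDerivAt_snd.sub_const z₀.2).const_mul b)
  obtain ⟨e, he⟩ := exists_equiv_of_injective (L := fderiv ℝ F z₀) (by
    rw [hFd.fderiv]
    rintro ⟨u, v⟩ huv
    have e1 : a * u + b * v = 0 := by simpa using congrArg Prod.fst huv
    have e2 : u * G₁ + v * G₂ = 0 := by
      have : fderiv ℝ G z₀ (u, v) = 0 := by simpa using congrArg Prod.snd huv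
      rw [show ((u, v) : ℝ × ℝ) = u • (1, 0) + v • (0, 1) by simp, map_add, map_smul, map_smul,
        h₁, h₂] at this
      simpa using this
    have hu : (a * G₂ - b * G₁) * u = 0 := by linear_combination G₂ * e1 - b * e2
    have hv : (a * G₂ - b * G₁) * v = 0 := by linear_combination a * e2 - G₁ * e1
    ext
    · exact (mul_eq_zero.1 hu).resolve_left hab
    · exact (mul_eq_zero.1 hv).resolve_left hab)
  obtain ⟨Φ, hz, hΦ, -, hs⟩ := exists_smooth_local_inverse (by simp) hF e he
  have hF0 : F z₀ = (0, 0) := by simp [hFdef, h0]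
  have ht0 : ((0 : ℝ), (0 : ℝ)) ∈ Φ.target := by
    rw [← hF0, ← hΦ]; exact Φ.map_source hz
  have hi : Continuous fun t : ℝ => (t, (0 : ℝ)) := by fun_prop
  have hev : ∀ᶠ t : ℝ in 𝓝 0, (t, (0 : ℝ)) ∈ Φ.target :=
    hi.continuousAt.eventually (Φ.open_target.mem_nhds ht0)
  refine ⟨fun t => Φ.symm (t, 0), ?_, ?_, ?_, ?_, ?_⟩
  · simp only
    rw [← hF0, ← hΦ, Φ.left_inv hz]
  · filter_upwards [hev] with t ht
    exact (hs _ ht).comp t (by fun_prop)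
  · filter_upwards [hev] with t ht
    have := Φ.right_inv ht
    rw [hΦ] at this
    exact congrArg Prod.snd this
  · filter_upwards [hev] with t ht
    have := Φ.right_inv ht
    rw [hΦ] at this
    exact congrArg Prod.fst this
  · filter_upwards [Φ.open_source.mem_nhds hz] with z hzs hGz
    have := Φ.left_inv hzs
    rw [hΦ] at this
    simpa only [hFdef, hGz] using this

/-! ### Orbits with two elements -/

namespace IncrDiffeo

/-- The slope of the chord of `f` over `y, w`: the value of `p` for which the map
`t ↦ (q - f(t)) / p` exchanges `y` and `w`. -/
noncomputable def slope (f : IncrDiffeo) (z : ℝ × ℝ) : ℝ := (f z.1 - f z.2) / (z.1 - z.2)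

/-- The value of `q` for which the map `t ↦ (q - f(t)) / p` with `p = slope` exchanges `y`
and `w`. -/
noncomputable def intercept (f : IncrDiffeo) (z : ℝ × ℝ) : ℝ := f z.1 + f.slope z * z.2

/-- For `y ≠ w`, the function of `(y, w)` whose vanishing means that `{y, w}` is the orbit of a
horizon point. -/
noncomputable def defect (f : IncrDiffeo) (z : ℝ × ℝ) : ℝ :=
  f.slope z ^ 2 - f.der 1 z.1 * f.der 1 z.2

/-- The function of `(y, w)` that vanishes at the cusps of the contour; where `defect = 0` it is a
positive multiple of `f''(y) - r³ f''(w)` with `r = f'(y) / p`. -/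
noncomputable def cuspFun (f : IncrDiffeo) (z : ℝ × ℝ) : ℝ :=
  f.der 2 z.1 * f.slope z ^ 2 / f.der 1 z.1 - f.der 1 z.1 ^ 2 * f.der 2 z.2 / f.slope z

theorem OffOrbit.slope_eq {f : IncrDiffeo} {p q r y w : ℝ} (h : f.OffOrbit p q r y w) :
    f.slope (y, w) = p := by
  have h1 := h.val_y
  have h2 := h.val_w
  rw [der_zero] at h1 h2
  rw [slope, div_eq_iff h.sub_ne]
  simp only [h1, h2]; ring

theorem OffOrbit.intercept_eq {f : IncrDiffeo} {p q r y w : ℝ} (h : f.OffOrbit p q r y w) :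
    f.intercept (y, w) = q := by
  have h1 := h.val_y
  rw [der_zero] at h1
  rw [intercept, h.slope_eq]
  simp only [h1]; ring

theorem OffOrbit.defect_eq {f : IncrDiffeo} {p q r y w : ℝ} (h : f.OffOrbit p q r y w) :
    f.defect (y, w) = 0 := by
  have := h.r_pos.ne'
  rw [defect, h.slope_eq, h.der_y, h.der_w]
  field_simp; ring

theorem OffOrbit.cuspFun_eq {f : IncrDiffeo} {p q r y w : ℝ} (h : f.OffOrbit p q r y w) :
    f.cuspFun (y, w) = p / r * (f.der 2 y - r ^ 3 * f.der 2 w) := by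
  have := h.r_pos.ne'
  have := h.p_pos.ne'
  rw [cuspFun, h.slope_eq, h.der_y]
  field_simp

theorem OffOrbit.cuspFun_eq_zero_iff {f : IncrDiffeo} {p q r y w : ℝ}
    (h : f.OffOrbit p q r y w) : f.cuspFun (y, w) = 0 ↔ f.der 2 y = r ^ 3 * f.der 2 w := by
  rw [h.cuspFun_eq, mul_eq_zero, or_iff_right (div_ne_zero h.p_pos.ne' h.r_pos.ne'), sub_eq_zero]

/-- A zero of `defect` off the diagonal is the orbit of a horizon point. -/
theorem offOrbit_of_defect_eq_zero {f : IncrDiffeo} {y w : ℝ} (hy : y ∈ Icc (-1 : ℝ) 1)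
    (hw : w ∈ Icc (-1 : ℝ) 1) (hne : y ≠ w) (hp : 0 < f.slope (y, w))
    (h : f.defect (y, w) = 0) :
    f.OffOrbit (f.slope (y, w)) (f.intercept (y, w)) (f.der 1 y / f.slope (y, w)) y w := by
  have hd := f.der_one_pos hy
  have hs : f.slope (y, w) * (y - w) = f y - f w := div_mul_cancel₀ _ (sub_ne_zero.2 hne)
  refine ⟨hy, hw, hne, hp, div_pos hd hp, ?_, ?_, ?_, ?_⟩
  · rw [der_zero, intercept]; ring
  · rw [der_zero, intercept]; linear_combination hs
  · field_simp
  · rw [defect] at h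
    field_simp; linear_combination -h

theorem contDiffAt_slope (f : IncrDiffeo) {z : ℝ × ℝ} (hz : z.1 ≠ z.2) :
    ContDiffAt ℝ ∞ f.slope z := by
  have h1 : ContDiffAt ℝ ∞ (fun z : ℝ × ℝ => f z.1) z := (f.smooth.comp contDiff_fst).contDiffAt
  have h2 : ContDiffAt ℝ ∞ (fun z : ℝ × ℝ => f z.2) z := (f.smooth.comp contDiff_snd).contDiffAt
  exact (h1.sub h2).div (by fun_prop) (sub_ne_zero.2 hz)

theorem contDiffAt_intercept (f : IncrDiffeo) {z : ℝ × ℝ} (hz : z.1 ≠ z.2) :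
    ContDiffAt ℝ ∞ f.intercept z :=
  ((f.smooth.comp contDiff_fst).contDiffAt).add ((f.contDiffAt_slope hz).mul contDiffAt_snd)

theorem contDiffAt_defect (f : IncrDiffeo) {z : ℝ × ℝ} (hz : z.1 ≠ z.2) :
    ContDiffAt ℝ ∞ f.defect z :=
  ((f.contDiffAt_slope hz).pow 2).sub
    ((((f.contDiff_der 1).comp contDiff_fst).contDiffAt).mul
      (((f.contDiff_der 1).comp contDiff_snd).contDiffAt))

section Curve

variable {f : IncrDiffeo} {y w : ℝ → ℝ} {y' w' t : ℝ}

theorem hasDerivAt_slope (hy : HasDerivAt y y' t) (hw : HasDerivAt w w' t) (hne : y t ≠ w t) :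
    HasDerivAt (fun s => f.slope (y s, w s))
      (((f.der 1 (y t) - f.slope (y t, w t)) * y' + (f.slope (y t, w t) - f.der 1 (w t)) * w') /
        (y t - w t)) t := by
  have h0 := sub_ne_zero.2 hne
  have h1 := (((f.hasDerivAt (y t)).comp t hy).sub ((f.hasDerivAt (w t)).comp t hw)).div
    (hy.sub hw) h0
  refine h1.congr_deriv ?_
  simp only [slope, Pi.sub_apply, Function.comp]
  field_simp
  ring

theorem hasDerivAt_defect (hy : HasDerivAt y y' t) (hw : HasDerivAt w w' t) (hne : y t ≠ w t) :
    HasDerivAt (fun s => f.defect (y s, w s))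
      (2 * f.slope (y t, w t) * (((f.der 1 (y t) - f.slope (y t, w t)) * y' +
        (f.slope (y t, w t) - f.der 1 (w t)) * w') / (y t - w t)) -
        (f.der 2 (y t) * y' * f.der 1 (w t) + f.der 1 (y t) * (f.der 2 (w t) * w'))) t := by
  have h1 := ((hasDerivAt_slope (f := f) hy hw hne).pow 2).sub
    (((f.hasDerivAt_der 1 (y t)).comp t hy).mul ((f.hasDerivAt_der 1 (w t)).comp t hw))
  refine h1.congr_deriv ?_
  simp

/-- Along a curve of orbits the image in the `(p,q)`-plane has velocity proportional to
`(f'(y) - p, f'(y) y - p w)`. -/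
theorem hasDerivAt_slope_of_defect (hy : HasDerivAt y y' t) (hw : HasDerivAt w w' t)
    (hne : y t ≠ w t) (h0 : f.defect (y t, w t) = 0) (hd : f.der 1 (y t) ≠ 0) :
    HasDerivAt (fun s => f.slope (y s, w s))
      ((f.slope (y t, w t) * w' + f.der 1 (y t) * y') / (f.der 1 (y t) * (y t - w t)) *
        (f.der 1 (y t) - f.slope (y t, w t))) t := by
  refine (hasDerivAt_slope (f := f) hy hw hne).congr_deriv ?_
  have := sub_ne_zero.2 hne
  rw [defect] at h0
  field_simp
  linear_combination w' * h0

theorem hasDerivAt_intercept_of_defect (hy : HasDerivAt y y' t) (hw : HasDerivAt w w' t)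
    (hne : y t ≠ w t) (h0 : f.defect (y t, w t) = 0) (hd : f.der 1 (y t) ≠ 0) :
    HasDerivAt (fun s => f.intercept (y s, w s))
      ((f.slope (y t, w t) * w' + f.der 1 (y t) * y') / (f.der 1 (y t) * (y t - w t)) *
        (f.der 1 (y t) * y t - f.slope (y t, w t) * w t)) t := by
  have h1 := ((f.hasDerivAt (y t)).comp t hy).add
    ((hasDerivAt_slope_of_defect hy hw hne h0 hd).mul hw)
  refine h1.congr_deriv ?_
  have := sub_ne_zero.2 hne
  field_simp
  ring

/-- The tangent equation of the curve of orbits. The first factor on the left vanishes exactly where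
the projection to the `(p,q)`-plane is singular. -/
theorem tangent_identity (hy : HasDerivAt y y' t) (hw : HasDerivAt w w' t)
    (hne : y t ≠ w t) (h0 : ∀ᶠ s in 𝓝 t, f.defect (y s, w s) = 0) (hd : f.der 1 (y t) ≠ 0)
    (hp : f.slope (y t, w t) ≠ 0) :
    (f.slope (y t, w t) * w' + f.der 1 (y t) * y') *
      (2 * f.slope (y t, w t) * (f.der 1 (y t) - f.slope (y t, w t)) /
        (f.der 1 (y t) * (y t - w t)) - f.der 1 (y t) * f.der 2 (w t) / f.slope (y t, w t)) =
      y' * f.cuspFun (y t, w t) := by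
  have h1 := hasDerivAt_defect (f := f) hy hw hne
  have h2 : HasDerivAt (fun s => f.defect (y s, w s)) 0 t :=
    (hasDerivAt_const t (0 : ℝ)).congr_of_eventuallyEq h0
  have h3 := h1.unique h2
  have h4 := h0.self_of_nhds
  have := sub_ne_zero.2 hne
  rw [defect] at h4
  have h5 : f.der 1 (w t) = f.slope (y t, w t) ^ 2 / f.der 1 (y t) := by
    field_simp; linear_combination -h4
  rw [h5] at h3
  rw [cuspFun]
  field_simp at h3 ⊢
  linear_combination (f.slope (y t, w t)) * h3

end Curve

/-- The partial derivatives of `defect` at an orbit. -/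
theorem OffOrbit.fderiv_defect {f : IncrDiffeo} {p q r y w : ℝ} (h : f.OffOrbit p q r y w) :
    fderiv ℝ f.defect (y, w) (1, 0) = 2 * p ^ 2 * (r - 1) / (y - w) - f.der 2 y * (p / r) ∧
    fderiv ℝ f.defect (y, w) (0, 1) =
      2 * p ^ 2 * (r - 1) / (r * (y - w)) - p * r * f.der 2 w := by
  have hd : HasFDerivAt f.defect (fderiv ℝ f.defect (y, w)) (y, w) :=
    ((f.contDiffAt_defect h.ne).differentiableAt (by simp)).hasFDerivAt
  have hr := h.r_pos.ne'
  have hyw := h.sub_ne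
  constructor
  · have h1 : HasDerivAt (fun s : ℝ => (s, w)) ((1 : ℝ), (0 : ℝ)) y :=
      (hasDerivAt_id y).prodMk (hasDerivAt_const y w)
    have h2 := HasFDerivAt.comp_hasDerivAt (l := f.defect) y hd h1
    have h3 := hasDerivAt_defect (f := f) (hasDerivAt_id y) (hasDerivAt_const y w) h.ne
    have h4 := h2.unique h3
    simp only [id, h.slope_eq, h.der_y, h.der_w] at h4
    rw [h4]; field_simp; ring
  · have h1 : HasDerivAt (fun s : ℝ => (y, s)) ((0 : ℝ), (1 : ℝ)) w :=
      (hasDerivAt_const w y).prodMk (hasDerivAt_id w)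
    have h2 := HasFDerivAt.comp_hasDerivAt (l := f.defect) w hd h1
    have h3 := hasDerivAt_defect (f := f) (hasDerivAt_const w y) (hasDerivAt_id w) h.ne
    have h4 := h2.unique h3
    simp only [id, h.slope_eq, h.der_y, h.der_w] at h4
    rw [h4]; field_simp; ring

/-- A regular curve of zeros of `defect` through `z₀` that contains all zeros of `defect` near
`z₀`. -/
structure IsOffArc (f : IncrDiffeo) (z₀ : ℝ × ℝ) (c : ℝ → ℝ × ℝ) : Prop where
  base : c 0 = z₀
  smooth : ∀ᶠ t in 𝓝 0, ContDiffAt ℝ ∞ c t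
  defect : ∀ᶠ t in 𝓝 0, f.defect (c t) = 0
  deriv_ne : deriv (fun t => (c t).1) 0 ≠ 0 ∨ deriv (fun t => (c t).2) 0 ≠ 0
  covers : ∃ θ : ℝ × ℝ → ℝ, ContDiffAt ℝ ∞ θ z₀ ∧ θ z₀ = 0 ∧
    ∀ᶠ z in 𝓝 z₀, f.defect z = 0 → c (θ z) = z

/-- The horizon point with orbit `{y, w}`. -/
noncomputable def lift (f : IncrDiffeo) (z : ℝ × ℝ) : ℝ × ℝ × ℝ := (z.1, f.slope z, f.intercept z)

theorem contDiffAt_lift (f : IncrDiffeo) {z : ℝ × ℝ} (hz : z.1 ≠ z.2) :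
    ContDiffAt ℝ ∞ f.lift z :=
  contDiffAt_fst.prodMk ((f.contDiffAt_slope hz).prodMk (f.contDiffAt_intercept hz))

theorem OffOrbit.exists_arc {f : IncrDiffeo} {p q r y w : ℝ} (h : f.OffOrbit p q r y w) (a b : ℝ)
    (hab : a * (2 * p ^ 2 * (r - 1) / (r * (y - w)) - p * r * f.der 2 w) -
      b * (2 * p ^ 2 * (r - 1) / (y - w) - f.der 2 y * (p / r)) ≠ 0) :
    ∃ c : ℝ → ℝ × ℝ, f.IsOffArc (y, w) c ∧
      ∀ T : Set ℝ, (∀ᶠ z : ℝ × ℝ in 𝓝 (y, w), a * (z.1 - y) + b * (z.2 - w) ∈ T ↔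
        z.1 ∈ Icc (-1 : ℝ) 1 ∧ z.2 ∈ Icc (-1 : ℝ) 1) →
      IsHorizonArc f (y, p, q) T (fun t => f.lift (c t)) := by
  obtain ⟨g1, g2⟩ := h.fderiv_defect
  have hev : ∀ᶠ z : ℝ × ℝ in 𝓝 (y, w), z.1 ≠ z.2 :=
    (continuousAt_fst.ne_iff_eventually_ne continuousAt_snd).1 h.ne
  obtain ⟨c, hc0, hcs, hcG, hct, hcz⟩ := exists_level_curve
    (hev.mono fun z hz => f.contDiffAt_defect hz) h.defect_eq g1 g2 a b hab
  have hcc : ContinuousAt c 0 := hcs.self_of_nhds.continuousAt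
  have hcc' : Tendsto c (𝓝 0) (𝓝 (y, w)) := hc0 ▸ hcc
  have hθ : ContDiffAt ℝ ∞ (fun z : ℝ × ℝ => a * (z.1 - y) + b * (z.2 - w)) (y, w) := by fun_prop
  have hp : ∀ᶠ z : ℝ × ℝ in 𝓝 (y, w), 0 < f.slope z :=
    (f.contDiffAt_slope h.ne).continuousAt.eventually (lt_mem_nhds (by
      rw [h.slope_eq]; exact h.p_pos))
  refine ⟨c, ⟨hc0, hcs, hcG, ?_, _, hθ, by simp, hcz⟩, fun T hT => ?_⟩
  · by_contra! hcon
    have hd := (hcs.self_of_nhds.differentiableAt (by simp))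
    have h1 : HasDerivAt (fun t => (c t).1) 0 0 := by
      exact hd.fst.hasDerivAt.congr_deriv hcon.1
    have h2 : HasDerivAt (fun t => (c t).2) 0 0 := by
      exact hd.snd.hasDerivAt.congr_deriv hcon.2
    have h3 := ((h1.sub_const y).const_mul a).add ((h2.sub_const w).const_mul b)
    have h4 : HasDerivAt (fun t : ℝ => t) (a * 0 + b * 0) 0 :=
      h3.congr_of_eventuallyEq (hct.mono fun t ht => ht.symm)
    have := h4.unique (hasDerivAt_id 0)
    simp at this
  · have hlift0 : f.lift (y, w) = (y, p, q) := by
      rw [lift, h.slope_eq, h.intercept_eq]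
    have hpart : partner f (y, p, q) = w := h.mem_horizon.2
    have hpairc : ContinuousAt (fun k : ℝ × ℝ × ℝ => (k.1, partner f k)) (y, p, q) :=
      continuousAt_fst.prodMk (continuousAt_partner f h.p_pos)
    have hpair : Tendsto (fun k : ℝ × ℝ × ℝ => (k.1, partner f k)) (𝓝 (y, p, q)) (𝓝 (y, w)) := by
      have := hpairc.tendsto
      rwa [hpart] at this
    have hlift : ∀ᶠ z : ℝ × ℝ in 𝓝 (y, w), partner f (f.lift z) = z.2 := by
      filter_upwards [hp, hev] with z hz hz'
      refine (partner_eq_iff f hz).2 ?_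
      rw [intercept]; ring
    refine IsHorizonArc.of_leftInverse
      (fun k => a * (k.1 - y) + b * (partner f k - w)) ?_ ?_ ?_ ?_ ?_ ?_ ?_
    · exact (ContinuousAt.comp (f := fun k : ℝ × ℝ × ℝ => (k.1, partner f k))
        (g := fun z : ℝ × ℝ => a * (z.1 - y) + b * (z.2 - w)) (by fun_prop) hpairc).continuousWithinAt
    · simp [hpart]
    · filter_upwards [hct, hcc'.eventually hlift] with t h1 h2
      rw [h2]; exact h1
    · rw [eventually_nhdsWithin_iff]
      filter_upwards [hpair.eventually hcz, hpair.eventually hT, hpair.eventually hev]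
        with k h1 h2 h3 hk
      have ho := offOrbit_of_mem_horizon hk h3
      refine ⟨h2.2 ⟨ho.y_mem, ho.w_mem⟩, ?_⟩
      rw [h1 ho.defect_eq, lift, ho.slope_eq, ho.intercept_eq]
    · filter_upwards [hcs, hcc'.eventually hev] with t h1 h2
      exact (f.contDiffAt_lift h2).comp t h1
    · rw [hc0, hlift0]
    · filter_upwards [hct, hcc'.eventually hev, hcc'.eventually hT, hcc'.eventually hp, hcG]
        with t h1 h2 h3 h4 h5 hT
      have h6 := h3.1 (by rw [h1]; exact hT)
      exact (offOrbit_of_defect_eq_zero h6.1 h6.2 h2 h4 h5).mem_horizon.1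

end IncrDiffeo

/-! ### Regular points and cusps of plane curves -/

theorem HasDerivAt.fst_comp {γ : ℝ → ℝ × ℝ} {v : ℝ × ℝ} {t : ℝ} (h : HasDerivAt γ v t) :
    HasDerivAt (fun s => (γ s).1) v.1 t :=
  (hasFDerivAt_fst (p := γ t)).comp_hasDerivAt t h

theorem HasDerivAt.snd_comp {γ : ℝ → ℝ × ℝ} {v : ℝ × ℝ} {t : ℝ} (h : HasDerivAt γ v t) :
    HasDerivAt (fun s => (γ s).2) v.2 t :=
  (hasFDerivAt_snd (p := γ t)).comp_hasDerivAt t h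

theorem ContDiffAt.deriv_of_succ_le {F : Type*} [NormedAddCommGroup F] [NormedSpace ℝ F]
    {g : ℝ → F} {t : ℝ} {m n : WithTop ℕ∞} (h : ContDiffAt ℝ n g t) (hmn : m + 1 ≤ n) :
    ContDiffAt ℝ m (deriv g) t :=
  (h.fderiv_right hmn).clm_apply contDiffAt_const

theorem exists_injOn_of_hasStrictDerivAt {g : ℝ → ℝ} {g' t : ℝ} (hg : HasStrictDerivAt g g' t)
    (h : g' ≠ 0) : ∃ U ∈ 𝓝 t, InjOn g U := by
  have h1 := hg.hasStrictFDerivAt_equiv h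
  exact ⟨_, (h1.toOpenPartialHomeomorph g).open_source.mem_nhds
    h1.mem_toOpenPartialHomeomorph_source, (h1.toOpenPartialHomeomorph g).injOn⟩

theorem exists_injOn_of_deriv_ne_zero {γ : ℝ → ℝ × ℝ} {t : ℝ} (hγ : ContDiffAt ℝ 1 γ t)
    (h : deriv γ t ≠ 0) : ∃ U ∈ 𝓝 t, InjOn γ U := by
  have hd := hγ.hasStrictDerivAt one_ne_zero
  have h1 : HasStrictDerivAt (fun s => (γ s).1) (deriv γ t).1 t :=
    (hasStrictFDerivAt_fst (p := γ t)).comp_hasStrictDerivAt t hd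
  have h2 : HasStrictDerivAt (fun s => (γ s).2) (deriv γ t).2 t :=
    (hasStrictFDerivAt_snd (p := γ t)).comp_hasStrictDerivAt t hd
  by_cases h0 : (deriv γ t).1 = 0
  · have h0' : (deriv γ t).2 ≠ 0 := fun h0' => h (Prod.ext h0 h0')
    obtain ⟨U, hU, hi⟩ := exists_injOn_of_hasStrictDerivAt h2 h0'
    exact ⟨U, hU, fun a ha b hb hab => hi ha hb (congrArg Prod.snd hab)⟩
  · obtain ⟨U, hU, hi⟩ := exists_injOn_of_hasStrictDerivAt h1 h0
    exact ⟨U, hU, fun a ha b hb hab => hi ha hb (congrArg Prod.fst hab)⟩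

theorem eventually_mul_pos_of_deriv {μ ν : ℝ → ℝ} {m n : ℝ} (hμ : HasDerivAt μ m 0)
    (hν : HasDerivAt ν n 0) (hμ0 : μ 0 = 0) (hν0 : ν 0 = 0) (hm : m ≠ 0) (hn : n ≠ 0) :
    ∀ᶠ t in 𝓝[≠] (0 : ℝ), 0 < m * n * (μ t * ν t) := by
  have h1 := hasDerivAt_iff_tendsto_slope_zero.1 hμ
  have h2 := hasDerivAt_iff_tendsto_slope_zero.1 hν
  have h3 := (h1.mul h2).const_mul (m * n)
  have h4 : 0 < m * n * (m * n) := mul_self_pos.2 (mul_ne_zero hm hn)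
  filter_upwards [h3.eventually (lt_mem_nhds h4), self_mem_nhdsWithin] with t ht ht0
  simp only [zero_add, hμ0, hν0, sub_zero, smul_eq_mul] at ht
  have ht0' : t ≠ 0 := ht0
  have : m * n * (μ t * ν t) = t ^ 2 * (m * n * (t⁻¹ * μ t * (t⁻¹ * ν t))) := by
    field_simp
  rw [this]
  positivity

theorem exists_injOn_of_deriv_pos {v v' : ℝ → ℝ} (hv : ∀ᶠ t in 𝓝 (0 : ℝ), HasDerivAt v (v' t) t)
    (hpos : ∀ᶠ t in 𝓝[≠] (0 : ℝ), 0 < v' t) : ∃ U ∈ 𝓝 (0 : ℝ), InjOn v U := by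
  obtain ⟨δ, hδ, h⟩ := Metric.nhds_basis_closedBall.mem_iff.1
    (hv.and (eventually_nhdsWithin_iff.1 hpos))
  rw [Real.closedBall_eq_Icc, zero_sub, zero_add] at h
  have hcont : ContinuousOn v (Icc (-δ) δ) := fun t ht => (h ht).1.continuousAt.continuousWithinAt
  have m1 : StrictMonoOn v (Icc (-δ) 0) := by
    refine strictMonoOn_of_deriv_pos (convex_Icc _ _)
      (hcont.mono (Icc_subset_Icc_right hδ.le)) fun t ht => ?_
    rw [interior_Icc] at ht
    have := h ⟨ht.1.le, ht.2.le.trans hδ.le⟩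
    rw [this.1.deriv]
    exact this.2 ht.2.ne
  have m2 : StrictMonoOn v (Icc 0 δ) := by
    refine strictMonoOn_of_deriv_pos (convex_Icc _ _)
      (hcont.mono (Icc_subset_Icc_left (by linarith))) fun t ht => ?_
    rw [interior_Icc] at ht
    have := h ⟨by linarith [ht.1], ht.2.le⟩
    rw [this.1.deriv]
    exact this.2 ht.1.ne'
  have m3 := m1.union m2 (isGreatest_Icc (by linarith)) (isLeast_Icc hδ.le)
  rw [Icc_union_Icc_eq_Icc (by linarith) hδ.le] at m3
  exact ⟨_, Icc_mem_nhds (by linarith) hδ, m3.injOn⟩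

/-- The derivatives of a plane curve with velocity `μ σ` at a zero of `μ`. -/
theorem derivs_of_front {γ σ : ℝ → ℝ × ℝ} {μ : ℝ → ℝ}
    (hγ : ∀ᶠ t in 𝓝 0, HasDerivAt γ (μ t • σ t) t) (hμ : ContDiffAt ℝ 2 μ 0)
    (hσ : ContDiffAt ℝ 2 σ 0) (hμ0 : μ 0 = 0) :
    deriv γ 0 = 0 ∧ iteratedDeriv 2 γ 0 = deriv μ 0 • σ 0 ∧
      iteratedDeriv 3 γ 0 = (2 * deriv μ 0) • deriv σ 0 + deriv (deriv μ) 0 • σ 0 := by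
  have hμe : ∀ᶠ t in 𝓝 0, HasDerivAt μ (deriv μ t) t :=
    (hμ.eventually (by simp)).mono fun t ht => (ht.differentiableAt (by simp)).hasDerivAt
  have hσe : ∀ᶠ t in 𝓝 0, HasDerivAt σ (deriv σ t) t :=
    (hσ.eventually (by simp)).mono fun t ht => (ht.differentiableAt (by simp)).hasDerivAt
  have hd1 : deriv γ =ᶠ[𝓝 0] fun t => μ t • σ t := hγ.mono fun t ht => ht.deriv
  have hd2 : deriv (deriv γ) =ᶠ[𝓝 0] fun t => μ t • deriv σ t + deriv μ t • σ t := by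
    filter_upwards [hd1.eventuallyEq_nhds, hμe, hσe] with t h1 h2 h3
    rw [h1.deriv_eq]
    exact (h2.smul h3).deriv
  have hμ2 : HasDerivAt (deriv μ) (deriv (deriv μ) 0) 0 :=
    ((hμ.deriv_of_succ_le (m := 1) (by norm_num)).differentiableAt (by simp)).hasDerivAt
  have hσ2 : HasDerivAt (deriv σ) (deriv (deriv σ) 0) 0 :=
    ((hσ.deriv_of_succ_le (m := 1) (by norm_num)).differentiableAt (by simp)).hasDerivAt
  refine ⟨by rw [hd1.eq_of_nhds, hμ0, zero_smul], ?_, ?_⟩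
  · rw [iteratedDeriv_succ', iteratedDeriv_one, hd2.eq_of_nhds, hμ0]; simp
  · rw [iteratedDeriv_succ', iteratedDeriv_succ', iteratedDeriv_one, hd2.deriv_eq]
    have := (hμe.self_of_nhds.smul hσ2).add (hμ2.smul hσe.self_of_nhds)
    refine this.deriv.trans ?_
    rw [hμ0]
    module

/-- A curve that runs in a regular curve has no ordinary cusp. -/
theorem not_linearIndependent_of_comp {γ : ℝ → ℝ × ℝ} {θ : ℝ → ℝ}
    (hγ : ContDiffAt ℝ 3 γ (θ 0)) (hθ : ContDiffAt ℝ 3 θ 0) (hd : deriv γ (θ 0) ≠ 0)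
    (h0 : deriv (fun t => γ (θ t)) 0 = 0) :
    ¬ LinearIndependent ℝ
      ![iteratedDeriv 2 (fun t => γ (θ t)) 0, iteratedDeriv 3 (fun t => γ (θ t)) 0] := by
  have h1 : ∀ᶠ t in 𝓝 0, HasDerivAt (fun t => γ (θ t)) (deriv θ t • deriv γ (θ t)) t := by
    filter_upwards [hθ.eventually (by simp),
      hθ.continuousAt.eventually (hγ.eventually (by simp))] with t a1 a2
    exact (a2.differentiableAt (by simp)).hasDerivAt.scomp t
      (a1.differentiableAt (by simp)).hasDerivAt
  have h2 : deriv θ 0 = 0 := by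
    have := h1.self_of_nhds.deriv.symm.trans h0
    exact (smul_eq_zero.1 this).resolve_right hd
  have h3 := derivs_of_front h1 (hθ.deriv_of_succ_le (by norm_num))
    (ContDiffAt.comp (g := deriv γ) 0 (hγ.deriv_of_succ_le (m := 2) (by norm_num))
      (hθ.of_le (by norm_num))) h2
  have h4 : deriv (fun t => deriv γ (θ t)) 0 = 0 := by
    have a1 := ((hγ.deriv_of_succ_le (m := 2) (by norm_num)).differentiableAt
      (by simp)).hasDerivAt.scomp 0 (hθ.differentiableAt (by simp)).hasDerivAt
    rw [h2, zero_smul] at a1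
    exact a1.deriv
  rw [h3.2.1, h3.2.2, h4, smul_zero, zero_add, LinearIndependent.pair_iff]
  intro h
  have h5 := h (deriv (deriv (deriv θ)) 0) (-deriv (deriv θ) 0) (by module)
  have h6 := h 1 0 (by rw [neg_eq_zero.1 h5.2]; simp)
  exact one_ne_zero h6.1

/-- A plane curve with velocity `μ σ`, where `μ` has a simple zero and `σ` turns at that time, has an
ordinary cusp; it is injective since its component transversal to `σ` is strictly monotone. -/
theorem cusp_of_front {γ σ : ℝ → ℝ × ℝ} {μ : ℝ → ℝ}
    (hγ : ∀ᶠ t in 𝓝 0, HasDerivAt γ (μ t • σ t) t) (hμ : ContDiffAt ℝ 2 μ 0)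
    (hσ : ContDiffAt ℝ 2 σ 0) (hμ0 : μ 0 = 0) (hμ1 : deriv μ 0 ≠ 0)
    (hcross : (σ 0).1 * (deriv σ 0).2 - (σ 0).2 * (deriv σ 0).1 ≠ 0) :
    deriv γ 0 = 0 ∧ LinearIndependent ℝ ![iteratedDeriv 2 γ 0, iteratedDeriv 3 γ 0] ∧
      ∃ U ∈ 𝓝 (0 : ℝ), InjOn γ U := by
  obtain ⟨e1, e2, e3⟩ := derivs_of_front hγ hμ hσ hμ0
  have hμe : HasDerivAt μ (deriv μ 0) 0 := (hμ.differentiableAt (by simp)).hasDerivAt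
  have hσe : HasDerivAt σ (deriv σ 0) 0 := (hσ.differentiableAt (by simp)).hasDerivAt
  refine ⟨e1, ?_, ?_⟩
  · rw [LinearIndependent.pair_iff]
    intro a b hab
    rw [e2, e3] at hab
    have h1 := congrArg Prod.fst hab
    have h2 := congrArg Prod.snd hab
    simp only [Prod.fst_add, Prod.snd_add, Prod.smul_fst, Prod.smul_snd, smul_eq_mul,
      Prod.fst_zero, Prod.snd_zero] at h1 h2
    have hb : b * (2 * deriv μ 0 * ((σ 0).1 * (deriv σ 0).2 - (σ 0).2 * (deriv σ 0).1)) = 0 := by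
      linear_combination (σ 0).1 * h2 - (σ 0).2 * h1
    have hb0 : b = 0 := (mul_eq_zero.1 hb).resolve_right
      (mul_ne_zero (mul_ne_zero two_ne_zero hμ1) hcross)
    subst hb0
    refine ⟨?_, rfl⟩
    by_contra ha
    apply hcross
    have h3 : a * deriv μ 0 ≠ 0 := mul_ne_zero ha hμ1
    have h4 : (σ 0).1 = 0 := (mul_eq_zero.1 (by linear_combination h1 :
      a * deriv μ 0 * (σ 0).1 = 0)).resolve_left h3
    have h5 : (σ 0).2 = 0 := (mul_eq_zero.1 (by linear_combination h2 :
      a * deriv μ 0 * (σ 0).2 = 0)).resolve_left h3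
    rw [h4, h5]; ring
  · set ν : ℝ → ℝ := fun t => (σ 0).1 * (σ t).2 - (σ 0).2 * (σ t).1 with hν
    set n := (σ 0).1 * (deriv σ 0).2 - (σ 0).2 * (deriv σ 0).1 with hn
    have hνd : HasDerivAt ν n 0 :=
      (hσe.snd_comp.const_mul _).sub (hσe.fst_comp.const_mul _)
    have hpos := eventually_mul_pos_of_deriv hμe hνd hμ0 (by simp [hν, mul_comm])
      hμ1 hcross
    have hv : ∀ᶠ t in 𝓝 (0 : ℝ), HasDerivAt
        (fun s => deriv μ 0 * n * ((σ 0).1 * (γ s).2 - (σ 0).2 * (γ s).1))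
        (deriv μ 0 * n * (μ t * ν t)) t := by
      filter_upwards [hγ] with t ht
      refine (((ht.snd_comp.const_mul _).sub (ht.fst_comp.const_mul _)).const_mul _).congr_deriv ?_
      simp only [hν, Prod.smul_fst, Prod.smul_snd, smul_eq_mul]
      ring
    obtain ⟨U, hU, hi⟩ := exists_injOn_of_deriv_pos hv hpos
    refine ⟨U, hU, fun a ha b hb hab => hi ha hb ?_⟩
    simp only [hab]

/-! ### Folds and cusps of the contour -/

namespace IncrDiffeo

/-- The tangent direction of the contour at the projection of the orbit `{y, w}`. -/
noncomputable def arcDir (f : IncrDiffeo) (z : ℝ × ℝ) : ℝ × ℝ :=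
  (f.der 1 z.1 - f.slope z, f.der 1 z.1 * z.1 - f.slope z * z.2)

/-- The numerator of the speed, with respect to `arcDir`, of the projection of a curve of orbits. -/
noncomputable def arcNum (f : IncrDiffeo) (c : ℝ → ℝ × ℝ) (t : ℝ) : ℝ :=
  f.slope (c t) * deriv (fun s => (c s).2) t + f.der 1 (c t).1 * deriv (fun s => (c s).1) t

/-- The speed, with respect to `arcDir`, of the projection of a curve of orbits. -/
noncomputable def arcSpeed (f : IncrDiffeo) (c : ℝ → ℝ × ℝ) (t : ℝ) : ℝ :=
  f.arcNum c t / (f.der 1 (c t).1 * ((c t).1 - (c t).2))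

section

variable {f : IncrDiffeo} {p q r y w : ℝ} {c : ℝ → ℝ × ℝ}

theorem _root_.ContDiffAt.der_comp {f : IncrDiffeo} {u : ℝ → ℝ} {t : ℝ} (i : ℕ)
    (hu : ContDiffAt ℝ ∞ u t) :
    ContDiffAt ℝ ∞ (fun s => f.der i (u s)) t :=
  (f.contDiff_der i).contDiffAt.comp t hu

theorem IsOffArc.eventually_facts (hc : f.IsOffArc (y, w) c) (h : f.OffOrbit p q r y w) :
    ∀ᶠ t in 𝓝 0, ContDiffAt ℝ ∞ (fun s => (c s).1) t ∧ ContDiffAt ℝ ∞ (fun s => (c s).2) t ∧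
      (c t).1 ≠ (c t).2 ∧ f.slope (c t) ≠ 0 ∧ f.der 1 (c t).1 ≠ 0 ∧
      ∀ᶠ s in 𝓝 t, f.defect (c s) = 0 := by
  have hcc : Tendsto c (𝓝 0) (𝓝 (y, w)) := by
    have := hc.smooth.self_of_nhds.continuousAt.tendsto
    rwa [hc.base] at this
  have h1 : ∀ᶠ z : ℝ × ℝ in 𝓝 (y, w), z.1 ≠ z.2 :=
    (continuousAt_fst.ne_iff_eventually_ne continuousAt_snd).1 h.ne
  have h2 : ∀ᶠ z : ℝ × ℝ in 𝓝 (y, w), f.slope z ≠ 0 :=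
    (f.contDiffAt_slope h.ne).continuousAt.eventually_ne (by rw [h.slope_eq]; exact h.p_pos.ne')
  have h3 : ∀ᶠ z : ℝ × ℝ in 𝓝 (y, w), f.der 1 z.1 ≠ 0 :=
    ((f.continuous_der 1).comp continuous_fst).continuousAt.eventually_ne
      (f.der_one_pos h.y_mem).ne'
  filter_upwards [hc.smooth, hcc.eventually h1, hcc.eventually h2, hcc.eventually h3,
    hc.defect.eventually_nhds] with t h1 h2 h3 h4 h5
  exact ⟨contDiffAt_fst.comp t h1, contDiffAt_snd.comp t h1, h2, h3, h4, h5⟩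

theorem IsOffArc.hasDerivAt_proj (hc : f.IsOffArc (y, w) c) (h : f.OffOrbit p q r y w) :
    ∀ᶠ t in 𝓝 0, HasDerivAt (fun s => (f.lift (c s)).2) (f.arcSpeed c t • f.arcDir (c t)) t := by
  filter_upwards [hc.eventually_facts h] with t ⟨h1, h2, h3, h4, h5, h6⟩
  have d1 := (h1.differentiableAt (by simp)).hasDerivAt
  have d2 := (h2.differentiableAt (by simp)).hasDerivAt
  exact (hasDerivAt_slope_of_defect d1 d2 h3 h6.self_of_nhds h5).prodMk
    (hasDerivAt_intercept_of_defect d1 d2 h3 h6.self_of_nhds h5)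

theorem IsOffArc.tangent_identity (hc : f.IsOffArc (y, w) c) (h : f.OffOrbit p q r y w) :
    ∀ᶠ t in 𝓝 0, f.arcNum c t *
      (2 * f.slope (c t) * (f.der 1 (c t).1 - f.slope (c t)) /
        (f.der 1 (c t).1 * ((c t).1 - (c t).2)) -
        f.der 1 (c t).1 * f.der 2 (c t).2 / f.slope (c t)) =
      deriv (fun s => (c s).1) t * f.cuspFun (c t) := by
  filter_upwards [hc.eventually_facts h] with t ⟨h1, h2, h3, h4, h5, h6⟩
  have d1 := (h1.differentiableAt (by simp)).hasDerivAt
  have d2 := (h2.differentiableAt (by simp)).hasDerivAt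
  exact IncrDiffeo.tangent_identity d1 d2 h3 h6 h5 h4

theorem IsOffArc.contDiffAt_slope (hc : f.IsOffArc (y, w) c) (h : f.OffOrbit p q r y w) :
    ContDiffAt ℝ ∞ (fun t => f.slope (c t)) 0 := by
  have h1 := f.contDiffAt_slope (z := (y, w)) h.ne
  rw [← hc.base] at h1
  exact h1.comp 0 hc.smooth.self_of_nhds

theorem IsOffArc.contDiffAt_arcNum (hc : f.IsOffArc (y, w) c) (h : f.OffOrbit p q r y w) :
    ContDiffAt ℝ ∞ (f.arcNum c) 0 := by
  obtain ⟨h1, h2, -⟩ := (hc.eventually_facts h).self_of_nhds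
  exact ((hc.contDiffAt_slope h).mul (h2.deriv_of_succ_le (by simp))).add
    ((h1.der_comp 1).mul (h1.deriv_of_succ_le (by simp)))

theorem IsOffArc.contDiffAt_arcDir (hc : f.IsOffArc (y, w) c) (h : f.OffOrbit p q r y w) :
    ContDiffAt ℝ ∞ (fun t => f.arcDir (c t)) 0 := by
  obtain ⟨h1, h2, -⟩ := (hc.eventually_facts h).self_of_nhds
  exact ((h1.der_comp 1).sub (hc.contDiffAt_slope h)).prodMk
    (((h1.der_comp 1).mul h1).sub ((hc.contDiffAt_slope h).mul h2))

theorem IsOffArc.contDiffAt_arcSpeed (hc : f.IsOffArc (y, w) c) (h : f.OffOrbit p q r y w) :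
    ContDiffAt ℝ ∞ (f.arcSpeed c) 0 := by
  obtain ⟨h1, h2, h3, -, h5, -⟩ := (hc.eventually_facts h).self_of_nhds
  exact (hc.contDiffAt_arcNum h).div ((h1.der_comp 1).mul (h1.sub h2))
    (mul_ne_zero h5 (sub_ne_zero.2 h3))

theorem OffOrbit.arcDir_eq (h : f.OffOrbit p q r y w) :
    f.arcDir (y, w) = p • (r - 1, r * y - w) := by
  rw [arcDir, h.slope_eq, h.der_y]
  ext <;> simp <;> ring

theorem IsOffArc.arcSpeed_eq_zero_iff (hc : f.IsOffArc (y, w) c) (h : f.OffOrbit p q r y w) :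
    f.arcSpeed c 0 = 0 ↔ f.arcNum c 0 = 0 := by
  obtain ⟨h1, h2, h3, -, h5, -⟩ := (hc.eventually_facts h).self_of_nhds
  rw [arcSpeed, div_eq_zero_iff, or_iff_left (mul_ne_zero h5 (sub_ne_zero.2 h3))]

theorem IsOffArc.deriv_fst_ne_zero (hc : f.IsOffArc (y, w) c) (h : f.OffOrbit p q r y w)
    (h0 : f.arcNum c 0 = 0) : deriv (fun s => (c s).1) 0 ≠ 0 := by
  intro h1
  have h2 := hc.deriv_ne.resolve_left (not_not.2 h1)
  rw [arcNum, h1, mul_zero, add_zero, hc.base, h.slope_eq] at h0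
  exact mul_ne_zero h.p_pos.ne' h2 h0

theorem IsOffArc.arcSpeed_ne_zero (hc : f.IsOffArc (y, w) c) (h : f.OffOrbit p q r y w)
    (hK : f.der 2 y ≠ r ^ 3 * f.der 2 w) : f.arcSpeed c 0 ≠ 0 := by
  rw [Ne, hc.arcSpeed_eq_zero_iff h]
  intro h0
  have h1 := (hc.tangent_identity h).self_of_nhds
  rw [h0, zero_mul, hc.base, eq_comm, mul_eq_zero,
    or_iff_right (hc.deriv_fst_ne_zero h h0), h.cuspFun_eq_zero_iff] at h1
  exact hK h1

/-- At a cusp the condition `regular` of a generic `f` makes the second factor in `tangent_identity`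
nonzero. -/
theorem OffOrbit.transversal_ne_zero (h : f.OffOrbit p q r y w)
    (hreg : ¬ (f.der 2 y * (y - w) = 2 * p * r * (r - 1) ∧
      f.der 2 w * r ^ 2 * (y - w) = 2 * p * (r - 1)))
    (hK : f.der 2 y = r ^ 3 * f.der 2 w) :
    2 * p * (p * r - p) / (p * r * (y - w)) - p * r * f.der 2 w / p ≠ 0 := by
  have hr := h.r_pos.ne'
  have hp := h.p_pos.ne'
  have hd := h.sub_ne
  intro h0
  field_simp at h0
  have h0' : f.der 2 w * r ^ 2 * (y - w) = 2 * p * (r - 1) := by linear_combination -h0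
  exact hreg ⟨by rw [hK]; linear_combination r * h0', h0'⟩

theorem IsOffArc.arcNum_eq_zero (hc : f.IsOffArc (y, w) c) (h : f.OffOrbit p q r y w)
    (hreg : ¬ (f.der 2 y * (y - w) = 2 * p * r * (r - 1) ∧
      f.der 2 w * r ^ 2 * (y - w) = 2 * p * (r - 1)))
    (hK : f.der 2 y = r ^ 3 * f.der 2 w) : f.arcNum c 0 = 0 := by
  have h1 := (hc.tangent_identity h).self_of_nhds
  rw [hc.base, h.cuspFun_eq_zero_iff.2 hK, mul_zero, mul_eq_zero, h.slope_eq] at h1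
  simp only [h.der_y] at h1
  exact h1.resolve_right (h.transversal_ne_zero hreg hK)

/-- At a cusp the speed has a simple zero: its derivative is computed from the tangent equation. -/
theorem IsOffArc.deriv_arcNum_ne_zero (hc : f.IsOffArc (y, w) c) (h : f.OffOrbit p q r y w)
    (hreg : ¬ (f.der 2 y * (y - w) = 2 * p * r * (r - 1) ∧
      f.der 2 w * r ^ 2 * (y - w) = 2 * p * (r - 1)))
    (hK : f.der 2 y = r ^ 3 * f.der 2 w)
    (hK' : f.der 3 y + r ^ 4 * f.der 3 w - 3 * r ^ 2 * f.der 2 y * f.der 2 w / p ≠ 0) :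
    deriv (f.arcNum c) 0 ≠ 0 := by
  have hr := h.r_pos.ne'
  have hp := h.p_pos.ne'
  have hn0 := hc.arcNum_eq_zero h hreg hK
  have hy0 := hc.deriv_fst_ne_zero h hn0
  obtain ⟨h1, h2, h3, h4, h5, h6⟩ := (hc.eventually_facts h).self_of_nhds
  have d1 := (h1.differentiableAt (by simp)).hasDerivAt
  have d2 := (h2.differentiableAt (by simp)).hasDerivAt
  have dN := ((hc.contDiffAt_arcNum h).differentiableAt (by simp)).hasDerivAt
  have dS : HasDerivAt (fun t => f.slope (c t)) 0 0 := by
    refine (hasDerivAt_slope_of_defect d1 d2 h3 h6.self_of_nhds h5).congr_deriv ?_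
    have : f.slope (c 0) * deriv (fun s => (c s).2) 0 +
      f.der 1 (c 0).1 * deriv (fun s => (c s).1) 0 = 0 := hn0
    rw [this]; simp
  -- the factor multiplying the speed is only needed to be differentiable
  have hg : DifferentiableAt ℝ (fun t => 2 * f.slope (c t) * (f.der 1 (c t).1 - f.slope (c t)) /
        (f.der 1 (c t).1 * ((c t).1 - (c t).2)) -
        f.der 1 (c t).1 * f.der 2 (c t).2 / f.slope (c t)) 0 := by
    have e1 := ((h1.der_comp (f := f) 1).differentiableAt (by simp))
    have e2 := ((h2.der_comp (f := f) 2).differentiableAt (by simp))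
    have e3 := dS.differentiableAt
    have e4 := d1.differentiableAt
    have e5 := d2.differentiableAt
    refine DifferentiableAt.sub (DifferentiableAt.div ?_ ?_ (mul_ne_zero h5 (sub_ne_zero.2 h3)))
      ((e1.mul e2).div e3 h4)
    · exact (e3.const_mul 2).mul (e1.sub e3)
    · exact e1.mul (e4.sub e5)
  have dY : HasDerivAt (deriv fun s => (c s).1) (deriv (deriv fun s => (c s).1) 0) 0 :=
    ((h1.deriv_of_succ_le (m := ∞) (by simp)).differentiableAt (by simp)).hasDerivAt
  have dK : HasDerivAt (fun t => f.cuspFun (c t)) (deriv (fun s => (c s).1) 0 * (p / r) *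
      (f.der 3 y + r ^ 4 * f.der 3 w - 3 * r ^ 2 * f.der 2 y * f.der 2 w / p)) 0 := by
    have b1 := (f.hasDerivAt_der 1 (c 0).1).comp 0 d1
    have b2 := (f.hasDerivAt_der 2 (c 0).1).comp 0 d1
    have b3 := (f.hasDerivAt_der 2 (c 0).2).comp 0 d2
    refine (((b2.mul (dS.pow 2)).div b1 h5).sub (((b1.pow 2).mul b3).div dS h4)).congr_deriv ?_
    rw [arcNum, hc.base, h.slope_eq] at hn0
    simp only [h.der_y] at hn0
    have hw' : deriv (fun s => (c s).2) 0 = -r * deriv (fun s => (c s).1) 0 := by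
      apply mul_left_cancel₀ hp
      linear_combination hn0
    simp only [Function.comp, Pi.mul_apply, Pi.pow_apply, hc.base, h.slope_eq, h.der_y, hw', hK]
    field_simp
    ring
  have hL := dN.mul hg.hasDerivAt
  have hR := dY.mul dK
  have heq := (hL.congr_of_eventuallyEq ((hc.tangent_identity h).mono fun t ht => ht.symm)).unique hR
  rw [hn0, zero_mul, add_zero, hc.base, h.cuspFun_eq_zero_iff.2 hK, mul_zero, zero_add] at heq
  intro h0
  rw [h0, zero_mul, eq_comm] at heq
  exact mul_ne_zero hy0 (mul_ne_zero (mul_ne_zero hy0 (div_ne_zero hp hr)) hK') heq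

theorem IsOffArc.deriv_arcSpeed_ne_zero (hc : f.IsOffArc (y, w) c) (h : f.OffOrbit p q r y w)
    (h0 : f.arcNum c 0 = 0) (h1 : deriv (f.arcNum c) 0 ≠ 0) : deriv (f.arcSpeed c) 0 ≠ 0 := by
  obtain ⟨e1, e2, e3, -, e5, -⟩ := (hc.eventually_facts h).self_of_nhds
  have dN := ((hc.contDiffAt_arcNum h).differentiableAt (by simp)).hasDerivAt
  have dD := (((e1.der_comp (f := f) 1).mul (e1.sub e2)).differentiableAt (by simp)).hasDerivAt
  have hne : f.der 1 (c 0).1 * ((c 0).1 - (c 0).2) ≠ 0 := mul_ne_zero e5 (sub_ne_zero.2 e3)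
  have := dN.div dD hne
  have h2 : deriv (f.arcSpeed c) 0 = _ := this.deriv
  rw [h2, h0, zero_mul, sub_zero]
  exact div_ne_zero (mul_ne_zero h1 hne) (pow_ne_zero 2 hne)

/-- At a cusp the tangent direction turns. -/
theorem IsOffArc.cross_ne_zero (hc : f.IsOffArc (y, w) c) (h : f.OffOrbit p q r y w)
    (hreg : ¬ (f.der 2 y * (y - w) = 2 * p * r * (r - 1) ∧
      f.der 2 w * r ^ 2 * (y - w) = 2 * p * (r - 1)))
    (hK : f.der 2 y = r ^ 3 * f.der 2 w) :
    (f.arcDir (c 0)).1 * (deriv (fun t => f.arcDir (c t)) 0).2 -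
      (f.arcDir (c 0)).2 * (deriv (fun t => f.arcDir (c t)) 0).1 ≠ 0 := by
  have hr := h.r_pos.ne'
  have hp := h.p_pos.ne'
  have hn0 := hc.arcNum_eq_zero h hreg hK
  have hy0 := hc.deriv_fst_ne_zero h hn0
  obtain ⟨h1, h2, h3, h4, h5, h6⟩ := (hc.eventually_facts h).self_of_nhds
  have d1 := (h1.differentiableAt (by simp)).hasDerivAt
  have d2 := (h2.differentiableAt (by simp)).hasDerivAt
  have dS : HasDerivAt (fun t => f.slope (c t)) 0 0 := by
    refine (hasDerivAt_slope_of_defect d1 d2 h3 h6.self_of_nhds h5).congr_deriv ?_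
    have : f.slope (c 0) * deriv (fun s => (c s).2) 0 +
      f.der 1 (c 0).1 * deriv (fun s => (c s).1) 0 = 0 := hn0
    rw [this]; simp
  have b1 := (f.hasDerivAt_der 1 (c 0).1).comp 0 d1
  have hd : deriv (fun t => f.arcDir (c t)) 0 = _ :=
    ((b1.sub dS).prodMk ((b1.mul d1).sub (dS.mul d2))).deriv
  rw [arcNum, hc.base, h.slope_eq] at hn0
  simp only [h.der_y] at hn0
  have hw' : deriv (fun s => (c s).2) 0 = -r * deriv (fun s => (c s).1) 0 := by
    apply mul_left_cancel₀ hp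
    linear_combination hn0
  rw [hd, hc.base, arcDir, h.slope_eq]
  simp only [Function.comp, hc.base, h.der_y, hw']
  intro h0
  have h7 : p * deriv (fun s => (c s).1) 0 * (2 * p * r * (r - 1) - f.der 2 y * (y - w)) = 0 := by
    linear_combination h0
  have h8 := (mul_eq_zero.1 h7).resolve_left (mul_ne_zero hp hy0)
  refine hreg ⟨by linear_combination -h8, ?_⟩
  rw [hK] at h8
  have h9 : r * (f.der 2 w * r ^ 2 * (y - w) - 2 * p * (r - 1)) = 0 := by linear_combination -h8
  exact sub_eq_zero.1 ((mul_eq_zero.1 h9).resolve_left hr)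

/-- Zeros of `cuspFun` on the curve of orbits are isolated. -/
theorem IsOffArc.eventually_cuspFun_ne_zero (hc : f.IsOffArc (y, w) c)
    (h : f.OffOrbit p q r y w)
    (hreg : ¬ (f.der 2 y * (y - w) = 2 * p * r * (r - 1) ∧
      f.der 2 w * r ^ 2 * (y - w) = 2 * p * (r - 1)))
    (hK : f.der 2 y = r ^ 3 * f.der 2 w)
    (hK' : f.der 3 y + r ^ 4 * f.der 3 w - 3 * r ^ 2 * f.der 2 y * f.der 2 w / p ≠ 0) :
    ∀ᶠ z in 𝓝[≠] (y, w), f.defect z = 0 → f.cuspFun z ≠ 0 := by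
  have hn0 := hc.arcNum_eq_zero h hreg hK
  have dN := ((hc.contDiffAt_arcNum h).differentiableAt (by simp)).hasDerivAt
  have hN : ∀ᶠ t in 𝓝 (0 : ℝ), t ≠ 0 → f.arcNum c t ≠ 0 := by
    have := dN.eventually_ne (c := 0) (hc.deriv_arcNum_ne_zero h hreg hK hK')
    exact eventually_nhdsWithin_iff.1 this
  have hg : ∀ᶠ z : ℝ × ℝ in 𝓝 (y, w), 2 * f.slope z * (f.der 1 z.1 - f.slope z) /
        (f.der 1 z.1 * (z.1 - z.2)) - f.der 1 z.1 * f.der 2 z.2 / f.slope z ≠ 0 := by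
    have e1 : ContinuousAt (fun z : ℝ × ℝ => f.der 1 z.1) (y, w) :=
      ((f.continuous_der 1).comp continuous_fst).continuousAt
    have e2 : ContinuousAt (fun z : ℝ × ℝ => f.der 2 z.2) (y, w) :=
      ((f.continuous_der 2).comp continuous_snd).continuousAt
    have e3 : ContinuousAt f.slope (y, w) := (f.contDiffAt_slope h.ne).continuousAt
    have hne : f.der 1 y * (y - w) ≠ 0 := mul_ne_zero (f.der_one_pos h.y_mem).ne' h.sub_ne
    refine ContinuousAt.eventually_ne (ContinuousAt.sub (ContinuousAt.div ?_ ?_ hne)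
      ((e1.mul e2).div e3 (by rw [h.slope_eq]; exact h.p_pos.ne'))) ?_
    · exact (continuousAt_const.mul e3).mul (e1.sub e3)
    · exact e1.mul (continuousAt_fst.sub continuousAt_snd)
    · have := h.transversal_ne_zero hreg hK
      rw [h.slope_eq]
      simp only [h.der_y]
      exact this
  obtain ⟨θ, hθ, hθ0, hθc⟩ := hc.covers
  have hθt : Tendsto θ (𝓝 (y, w)) (𝓝 0) := hθ0 ▸ hθ.continuousAt.tendsto
  rw [eventually_nhdsWithin_iff]
  filter_upwards [hg, hθt.eventually hN, hθt.eventually (hc.tangent_identity h), hθc]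
    with z h1 h2 h3 h4 hz hd hcz
  have h5 := h4 hd
  rw [h5, hcz, mul_zero] at h3
  refine mul_ne_zero (h2 fun h0 => hz ?_) h1 h3
  rw [← h5, h0, hc.base]; rfl

end

end IncrDiffeo

/-! ### Weighted averages over chords -/

/-- The integral of `g` over the chord with center `z.1` and half-length `z.2`, parametrized by
`[-1,1]`, with weight `k`. -/
noncomputable def chordAvg (k g : ℝ → ℝ) (z : ℝ × ℝ) : ℝ :=
  ∫ θ in (-1 : ℝ)..1, k θ * g (z.1 + z.2 * θ)

theorem hasFDerivAt_chordAvg {k g g' : ℝ → ℝ} (hk : Continuous k)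
    (hg : ∀ x, HasDerivAt g (g' x) x) (hg' : Continuous g') (z : ℝ × ℝ) :
    HasFDerivAt (chordAvg k g) (chordAvg k g' z • ContinuousLinearMap.fst ℝ ℝ ℝ +
      chordAvg (fun θ => θ * k θ) g' z • ContinuousLinearMap.snd ℝ ℝ ℝ) z := by
  have hgc : Continuous g := continuous_iff_continuousAt.2 fun x => (hg x).continuousAt
  set F' : ℝ × ℝ → ℝ → (ℝ × ℝ →L[ℝ] ℝ) := fun z θ =>
    (k θ * g' (z.1 + z.2 * θ)) • ContinuousLinearMap.fst ℝ ℝ ℝ +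
      (θ * k θ * g' (z.1 + z.2 * θ)) • ContinuousLinearMap.snd ℝ ℝ ℝ with hF'
  have hF'c : Continuous fun x : (ℝ × ℝ) × ℝ => F' x.1 x.2 := by
    simp only [hF']; fun_prop
  obtain ⟨C, hC⟩ := ((isCompact_closedBall z 1).prod (isCompact_Icc (a := (-1 : ℝ)) (b := 1))
    ).exists_bound_of_continuousOn hF'c.continuousOn
  have hd : ∀ θ (x : ℝ × ℝ), HasFDerivAt (fun x : ℝ × ℝ => k θ * g (x.1 + x.2 * θ)) (F' x θ) x := by
    intro θ x
    have h1 : HasFDerivAt (fun x : ℝ × ℝ => x.1 + x.2 * θ)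
        (ContinuousLinearMap.fst ℝ ℝ ℝ + θ • ContinuousLinearMap.snd ℝ ℝ ℝ) x :=
      hasFDerivAt_fst.add (hasFDerivAt_snd.mul_const θ)
    refine (((hg _).comp_hasFDerivAt x h1).const_mul (k θ)).congr_fderiv ?_
    simp only [hF']
    ext <;> simp [mul_comm, mul_left_comm]
  have h := intervalIntegral.hasFDerivAt_integral_of_dominated_of_fderiv_le
    (μ := MeasureTheory.volume) (a := (-1 : ℝ)) (b := 1) (bound := fun _ => C)
    (F := fun (x : ℝ × ℝ) θ => k θ * g (x.1 + x.2 * θ)) (F' := F') (x₀ := z)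
    (Metric.closedBall_mem_nhds z one_pos)
    (Eventually.of_forall fun x => Continuous.aestronglyMeasurable (by fun_prop))
    (Continuous.intervalIntegrable (by fun_prop) _ _)
    (Continuous.aestronglyMeasurable (by simp only [hF']; fun_prop))
    (Eventually.of_forall fun θ hθ x hx => hC (x, θ) ⟨hx, by
      rw [uIoc_of_le (by norm_num)] at hθ; exact ⟨hθ.1.le, hθ.2⟩⟩)
    (by simp) (Eventually.of_forall fun θ _ x _ => hd θ x)
  refine h.congr_fderiv ?_
  simp only [hF']
  rw [intervalIntegral.integral_add (Continuous.intervalIntegrable (by fun_prop) _ _)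
    (Continuous.intervalIntegrable (by fun_prop) _ _), intervalIntegral.integral_smul_const,
    intervalIntegral.integral_smul_const]
  rfl

theorem contDiff_chordAvg {k g : ℝ → ℝ} (hk : Continuous k) (hg : ContDiff ℝ ∞ g) :
    ContDiff ℝ ∞ (chordAvg k g) := by
  have key : ∀ n : ℕ, ∀ k g : ℝ → ℝ, Continuous k → ContDiff ℝ ∞ g →
      ContDiff ℝ n (chordAvg k g) := by
    intro n
    induction n with
    | zero =>
      intro k g hk hg
      have hg1 : ContDiff ℝ ∞ (deriv g) := (contDiff_infty_iff_deriv.1 hg).2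
      exact contDiff_zero.2 (continuous_iff_continuousAt.2 fun z =>
        (hasFDerivAt_chordAvg hk (fun x => (hg.differentiable (by simp) x).hasDerivAt)
          hg1.continuous z).continuousAt)
    | succ n ih =>
      intro k g hk hg
      have hg1 : ContDiff ℝ ∞ (deriv g) := (contDiff_infty_iff_deriv.1 hg).2
      rw [Nat.cast_add, Nat.cast_one, contDiff_succ_iff_hasFDerivAt]
      refine ⟨_, ?_, hasFDerivAt_chordAvg hk
        (fun x => (hg.differentiable (by simp) x).hasDerivAt) hg1.continuous⟩
      have h1 := ih k _ hk hg1
      have h2 := ih (fun θ => θ * k θ) _ (by fun_prop) hg1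
      fun_prop
  exact contDiff_infty.2 fun n => key n k g hk hg

/-- Integration by parts. -/
theorem mul_chordAvg {K k g g' : ℝ → ℝ} (hK : ∀ x, HasDerivAt K (k x) x) (hk : Continuous k)
    (hg : ∀ x, HasDerivAt g (g' x) x) (hg' : Continuous g') (z : ℝ × ℝ) :
    z.2 * chordAvg K g' z =
      K 1 * g (z.1 + z.2) - K (-1) * g (z.1 - z.2) - chordAvg k g z := by
  have hKc : Continuous K := continuous_iff_continuousAt.2 fun x => (hK x).continuousAt
  have hgc : Continuous g := continuous_iff_continuousAt.2 fun x => (hg x).continuousAt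
  have hd : ∀ θ ∈ uIcc (-1 : ℝ) 1, HasDerivAt (fun θ => K θ * g (z.1 + z.2 * θ))
      (k θ * g (z.1 + z.2 * θ) + z.2 * (K θ * g' (z.1 + z.2 * θ))) θ := by
    intro θ _
    have h1 : HasDerivAt (fun θ => z.1 + z.2 * θ) z.2 θ := by
      simpa using ((hasDerivAt_id θ).const_mul z.2).const_add z.1
    refine ((hK θ).mul ((hg _).comp θ h1)).congr_deriv ?_
    simp only [Function.comp]
    ring
  have h := intervalIntegral.integral_eq_sub_of_hasDerivAt hd
    (Continuous.intervalIntegrable (by fun_prop) _ _)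
  rw [intervalIntegral.integral_add (Continuous.intervalIntegrable (by fun_prop) _ _)
    (Continuous.intervalIntegrable (by fun_prop) _ _), intervalIntegral.integral_const_mul] at h
  simp only [chordAvg]
  rw [mul_one, mul_neg_one, ← sub_eq_add_neg] at h
  linarith

theorem chordAvg_zero (k g : ℝ → ℝ) (m : ℝ) :
    chordAvg k g (m, 0) = (∫ θ in (-1 : ℝ)..1, k θ) * g m := by
  simp [chordAvg]

namespace IncrDiffeo

/-- The average of the `i`-th derivative of `f` over a chord. -/
noncomputable def avg₁ (f : IncrDiffeo) (i : ℕ) (z : ℝ × ℝ) : ℝ :=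
  1 / 2 * chordAvg (fun _ => 1) (f.der i) z

/-- The average over a chord that appears in the derivative of `avg₁` with respect to the
half-length of the chord, divided by this half-length. -/
noncomputable def avg₂ (f : IncrDiffeo) (i : ℕ) (z : ℝ × ℝ) : ℝ :=
  1 / 4 * chordAvg (fun θ => 1 - θ ^ 2) (f.der i) z

/-- The average over a chord that appears in the derivative of `avg₂` with respect to the
half-length of the chord, divided by this half-length. -/
noncomputable def avg₃ (f : IncrDiffeo) (i : ℕ) (z : ℝ × ℝ) : ℝ :=
  1 / 16 * chordAvg (fun θ => (1 - θ ^ 2) ^ 2) (f.der i) z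

variable (f : IncrDiffeo) (i : ℕ)

theorem contDiff_avg₁ : ContDiff ℝ ∞ (f.avg₁ i) :=
  contDiff_const.mul (contDiff_chordAvg (by fun_prop) (f.contDiff_der i))

theorem contDiff_avg₂ : ContDiff ℝ ∞ (f.avg₂ i) :=
  contDiff_const.mul (contDiff_chordAvg (by fun_prop) (f.contDiff_der i))

theorem contDiff_avg₃ : ContDiff ℝ ∞ (f.avg₃ i) :=
  contDiff_const.mul (contDiff_chordAvg (by fun_prop) (f.contDiff_der i))

theorem avg₁_zero (m : ℝ) : f.avg₁ i (m, 0) = f.der i m := by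
  rw [avg₁, chordAvg_zero]; norm_num; ring

theorem avg₂_zero (m : ℝ) : f.avg₂ i (m, 0) = f.der i m / 3 := by
  rw [avg₂, chordAvg_zero, intervalIntegral.integral_sub (by simp) (by simp)]
  simp; ring

theorem avg₃_zero (m : ℝ) : f.avg₃ i (m, 0) = f.der i m / 15 := by
  have h : ∫ θ in (-1 : ℝ)..1, (1 - θ ^ 2) ^ 2 = 16 / 15 := by
    have : ∀ θ : ℝ, (1 - θ ^ 2) ^ 2 = 1 - 2 * θ ^ 2 + θ ^ 4 := fun θ => by ring
    simp only [this]
    rw [intervalIntegral.integral_add (Continuous.intervalIntegrable (by fun_prop) _ _)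
      (Continuous.intervalIntegrable (by fun_prop) _ _), intervalIntegral.integral_sub
      (Continuous.intervalIntegrable (by fun_prop) _ _)
      (Continuous.intervalIntegrable (by fun_prop) _ _), intervalIntegral.integral_const_mul]
    simp; norm_num
  rw [avg₃, chordAvg_zero, h]; ring

theorem mul_avg₁ (z : ℝ × ℝ) :
    z.2 * f.avg₁ (i + 1) z = (f.der i (z.1 + z.2) - f.der i (z.1 - z.2)) / 2 := by
  have h := mul_chordAvg (K := fun _ => 1) (k := fun _ => 0) (fun x => hasDerivAt_const x 1)
    (by fun_prop) (f.hasDerivAt_der i) (f.continuous_der (i + 1)) z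
  have h0 : chordAvg (fun _ => 0) (f.der i) z = 0 := by simp [chordAvg]
  rw [h0] at h
  rw [avg₁]
  linarith

theorem mul_chordAvg_id (z : ℝ × ℝ) : z.2 * chordAvg (fun θ => θ) (f.der (i + 1)) z =
    f.der i (z.1 + z.2) + f.der i (z.1 - z.2) - 2 * f.avg₁ i z := by
  have h := mul_chordAvg (K := fun θ => θ) (k := fun _ => 1) (fun x => hasDerivAt_id x)
    (by fun_prop) (f.hasDerivAt_der i) (f.continuous_der (i + 1)) z
  rw [h, avg₁]; ring

theorem mul_avg₂ (z : ℝ × ℝ) :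
    z.2 * f.avg₂ (i + 1) z = 1 / 2 * chordAvg (fun θ => θ) (f.der i) z := by
  have h := mul_chordAvg (K := fun θ => 1 - θ ^ 2) (k := fun θ => -2 * θ)
    (fun x => by simpa using (hasDerivAt_pow 2 x).const_sub 1)
    (by fun_prop) (f.hasDerivAt_der i) (f.continuous_der (i + 1)) z
  have h0 : chordAvg (fun θ => -2 * θ) (f.der i) z = -2 * chordAvg (fun θ => θ) (f.der i) z := by
    simp only [chordAvg, mul_assoc]; rw [intervalIntegral.integral_const_mul]
  rw [h0] at h
  rw [avg₂]
  linear_combination 1 / 4 * h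

theorem mul_avg₃ (z : ℝ × ℝ) :
    z.2 * f.avg₃ (i + 1) z = 1 / 4 * chordAvg (fun θ => θ * (1 - θ ^ 2)) (f.der i) z := by
  have h := mul_chordAvg (K := fun θ => (1 - θ ^ 2) ^ 2) (k := fun θ => -4 * (θ * (1 - θ ^ 2)))
    (fun x => by
      refine (((hasDerivAt_pow 2 x).const_sub 1).pow 2).congr_deriv ?_
      simp; ring)
    (by fun_prop) (f.hasDerivAt_der i) (f.continuous_der (i + 1)) z
  have h0 : chordAvg (fun θ => -4 * (θ * (1 - θ ^ 2))) (f.der i) z =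
      -4 * chordAvg (fun θ => θ * (1 - θ ^ 2)) (f.der i) z := by
    simp only [chordAvg, mul_assoc]; rw [intervalIntegral.integral_const_mul]
  rw [h0] at h
  rw [avg₃]
  linear_combination 1 / 16 * h

theorem avg₁_add_avg₂ (z : ℝ × ℝ) : f.avg₁ i z + z.2 ^ 2 * f.avg₂ (i + 2) z =
    (f.der i (z.1 + z.2) + f.der i (z.1 - z.2)) / 2 := by
  linear_combination z.2 * f.mul_avg₂ (i + 1) z + 1 / 2 * f.mul_chordAvg_id i z

variable {f} {i} {c : ℝ → ℝ × ℝ} {v : ℝ × ℝ} {t : ℝ}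

theorem hasDerivAt_avg₁ (hc : HasDerivAt c v t) : HasDerivAt (fun t => f.avg₁ i (c t))
    (f.avg₁ (i + 1) (c t) * v.1 + (c t).2 * f.avg₂ (i + 2) (c t) * v.2) t := by
  have h := ((hasFDerivAt_chordAvg (k := fun _ => 1) (by fun_prop) (f.hasDerivAt_der i)
    (f.continuous_der (i + 1)) (c t)).comp_hasDerivAt t hc).const_mul (1 / 2)
  refine h.congr_deriv ?_
  rw [mul_avg₂, avg₁]
  simp
  ring

theorem hasDerivAt_avg₂ (hc : HasDerivAt c v t) : HasDerivAt (fun t => f.avg₂ i (c t))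
    (f.avg₂ (i + 1) (c t) * v.1 + (c t).2 * f.avg₃ (i + 2) (c t) * v.2) t := by
  have h := ((hasFDerivAt_chordAvg (k := fun θ => 1 - θ ^ 2) (by fun_prop) (f.hasDerivAt_der i)
    (f.continuous_der (i + 1)) (c t)).comp_hasDerivAt t hc).const_mul (1 / 4)
  refine h.congr_deriv ?_
  rw [mul_avg₃, avg₂]
  simp
  ring

end IncrDiffeo

/-! ### The horizon near the diagonal -/

namespace IncrDiffeo

/-- The function `defect`, divided by the square of half the distance of the two points, in terms of
the center and half-length of the chord. It is smooth also on the diagonal. -/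
noncomputable def redDefect (f : IncrDiffeo) (z : ℝ × ℝ) : ℝ :=
  f.avg₁ 2 z ^ 2 - f.avg₂ 3 z * (2 * f.avg₁ 1 z + z.2 ^ 2 * f.avg₂ 3 z)

variable {f : IncrDiffeo}

theorem contDiff_redDefect (f : IncrDiffeo) : ContDiff ℝ ∞ f.redDefect :=
  ((f.contDiff_avg₁ 2).pow 2).sub ((f.contDiff_avg₂ 3).mul
    ((contDiff_const.mul (f.contDiff_avg₁ 1)).add ((contDiff_snd.pow 2).mul (f.contDiff_avg₂ 3))))

theorem redDefect_zero (f : IncrDiffeo) (m : ℝ) : f.redDefect (m, 0) = -(1 / 3) * f.schwarz m := by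
  rw [redDefect, avg₁_zero, avg₁_zero, avg₂_zero, schwarz]; ring

theorem slope_center {m s : ℝ} (hs : s ≠ 0) : f.slope (m + s, m - s) = f.avg₁ 1 (m, s) := by
  have h := f.mul_avg₁ 0 (m, s)
  rw [zero_add, show f.der 0 = f from f.der_zero] at h
  rw [slope, div_eq_iff (by ring_nf; simpa using hs)]
  simp only
  linear_combination -2 * h

theorem defect_center {m s : ℝ} (hs : s ≠ 0) :
    f.defect (m + s, m - s) = s ^ 2 * f.redDefect (m, s) := by
  have h1 := f.mul_avg₁ 1 (m, s)
  have h2 := f.avg₁_add_avg₂ 1 (m, s)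
  simp only at h1 h2
  have e1 : f.der 1 (m + s) = f.avg₁ 1 (m, s) + s ^ 2 * f.avg₂ 3 (m, s) + s * f.avg₁ 2 (m, s) := by
    linear_combination -h1 - h2
  have e2 : f.der 1 (m - s) = f.avg₁ 1 (m, s) + s ^ 2 * f.avg₂ 3 (m, s) - s * f.avg₁ 2 (m, s) := by
    linear_combination h1 - h2
  rw [defect, slope_center hs, redDefect]
  simp only [e1, e2]
  ring

theorem OffOrbit.redDefect_eq {p q r y w : ℝ} (h : f.OffOrbit p q r y w) :
    f.redDefect ((y + w) / 2, (y - w) / 2) = 0 := by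
  have hs : (y - w) / 2 ≠ 0 := div_ne_zero h.sub_ne two_ne_zero
  have h1 := defect_center (f := f) (m := (y + w) / 2) hs
  rw [show (y + w) / 2 + (y - w) / 2 = y by ring, show (y + w) / 2 - (y - w) / 2 = w by ring,
    h.defect_eq, eq_comm, mul_eq_zero, or_iff_right (pow_ne_zero 2 hs)] at h1
  exact h1

theorem hasDerivAt_curveL (f : IncrDiffeo) (x : ℝ) :
    HasDerivAt (curveL f) (f.der 2 x, f.der 2 x * x + 2 * f.der 1 x) x := by
  have h : curveL f = fun x => (f.der 1 x, f.der 1 x * x + f x) := funext (curveL_eq f)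
  rw [h]
  refine ((f.hasDerivAt_der 1 x).prodMk
    (((f.hasDerivAt_der 1 x).mul (hasDerivAt_id x)).add (f.hasDerivAt x))).congr_deriv ?_
  ext <;> simp; ring

theorem contDiff_curveL (f : IncrDiffeo) : ContDiff ℝ ∞ (curveL f) := by
  have h : curveL f = fun x => (f.der 1 x, f.der 1 x * x + f x) := funext (curveL_eq f)
  rw [h]
  exact (f.contDiff_der 1).prodMk (((f.contDiff_der 1).mul contDiff_id).add f.smooth)

/-- Near a diagonal point with nonzero Schwarzian derivative the horizon is contained in the
diagonal. -/
theorem DiagOrbit.eventually_diag {p q x : ℝ} (h : f.DiagOrbit p q x) (hS : f.schwarz x ≠ 0) :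
    ∀ᶠ k in 𝓝[horizon f] (x, p, q), f.DiagOrbit k.2.1 k.2.2 k.1 := by
  have hpart := h.mem_horizon.2
  have hcont : ContinuousAt (fun k : ℝ × ℝ × ℝ =>
      f.redDefect ((k.1 + partner f k) / 2, (k.1 - partner f k) / 2)) (x, p, q) := by
    have h1 := continuousAt_partner f (h := (x, p, q)) h.p_pos
    refine f.contDiff_redDefect.continuous.continuousAt.comp ?_
    exact ((continuousAt_fst.add h1).div_const 2).prodMk ((continuousAt_fst.sub h1).div_const 2)
  have hne := hcont.eventually_ne (y := 0) (by
    simp only [hpart]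
    rw [show (x + x) / 2 = x by ring, show (x - x) / 2 = 0 by ring, redDefect_zero]
    exact mul_ne_zero (by norm_num) hS)
  rw [eventually_nhdsWithin_iff]
  filter_upwards [hne] with k hk hkh
  by_contra hcon
  refine hk (offOrbit_of_mem_horizon hkh fun heq => hcon ?_).redDefect_eq
  exact diagOrbit_of_mem_horizon hkh heq

theorem DiagOrbit.exists_arc {p q x : ℝ} (h : f.DiagOrbit p q x) (hS : f.schwarz x ≠ 0) (σ : ℝ)
    (hσ : σ * σ = 1) (T : Set ℝ) (hT : ∀ᶠ t in 𝓝 0, t ∈ T ↔ x + σ * t ∈ Icc (-1 : ℝ) 1) :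
    IsHorizonArc f (x, p, q) T (fun t => (x + σ * t, curveL f (x + σ * t))) ∧
      HasDerivAt (fun t => curveL f (x + σ * t))
        (σ • (f.der 2 x, f.der 2 x * x + 2 * f.der 1 x)) 0 := by
  have hL : curveL f x = (p, q) := (diagOrbit_iff.1 h).2.symm
  constructor
  · refine IsHorizonArc.of_leftInverse (fun k => σ * (k.1 - x)) ?_ (by simp) ?_ ?_ ?_ (by simp [hL])
      ?_
    · exact Continuous.continuousWithinAt (by fun_prop)
    · refine Eventually.of_forall fun t => ?_
      simp only
      linear_combination t * hσ
    · have h1 : Tendsto (fun k : ℝ × ℝ × ℝ => σ * (k.1 - x)) (𝓝[horizon f] (x, p, q)) (𝓝 0) := by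
        have : Continuous fun k : ℝ × ℝ × ℝ => σ * (k.1 - x) := by fun_prop
        refine (this.tendsto' (x, p, q) 0 (by simp)).mono_left nhdsWithin_le_nhds
      filter_upwards [h.eventually_diag hS, h1.eventually hT] with k hk hkT
      have e : x + σ * (σ * (k.1 - x)) = k.1 := by linear_combination (k.1 - x) * hσ
      rw [e] at hkT ⊢
      have := diagOrbit_iff.1 hk
      exact ⟨hkT.2 this.1, Prod.ext rfl this.2.symm⟩
    · refine Eventually.of_forall fun t => ?_
      have h1 : ContDiff ℝ ∞ fun t : ℝ => x + σ * t := by fun_prop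
      exact (h1.prodMk (f.contDiff_curveL.comp h1)).contDiffAt
    · filter_upwards [hT] with t ht htT
      exact (diagOrbit_iff.2 ⟨ht.1 htT, rfl⟩).mem_horizon.1
  · have h1 : HasDerivAt (fun t => x + σ * t) σ 0 := by
      simpa using ((hasDerivAt_id (0 : ℝ)).const_mul σ).const_add x
    have h2 := f.hasDerivAt_curveL (x + σ * 0)
    have h3 := HasDerivAt.scomp 0 h2 h1
    rwa [mul_zero, add_zero] at h3

theorem diag_dir_ne_zero {x : ℝ} (hx : 0 < f.der 1 x) :
    ((f.der 2 x, f.der 2 x * x + 2 * f.der 1 x) : ℝ × ℝ) ≠ 0 := by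
  intro h
  have h1 := congrArg Prod.fst h
  have h2 := congrArg Prod.snd h
  simp only [Prod.fst_zero, Prod.snd_zero] at h1 h2
  rw [h1] at h2
  linarith

end IncrDiffeo

/-! ### Derivatives of `φ₀` on the diagonal -/

section

variable (f : IncrDiffeo) (p q : ℝ)

theorem hasDerivAt_der_partner (i : ℕ) (t : ℝ) :
    HasDerivAt (fun t => f.der i (partner f (t, p, q)))
      (f.der (i + 1) (partner f (t, p, q)) * (-(1 / p) * f.der 1 t)) t :=
  (f.hasDerivAt_der i _).comp t (((f.hasDerivAt t).const_mul (-(1 / p))).add_const (q / p))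

theorem phiY_succ {n : ℕ} {g : ℝ → ℝ} {t b : ℝ} (h : ∀ t, phiY f n t p q = g t)
    (hg : HasDerivAt g b t) : phiY f (n + 1) t p q = b := by
  have h1 : iteratedDeriv n (fun t => phi f t p q) = g := funext h
  rw [phiY, iteratedDeriv_succ, h1, hg.deriv]

theorem phiY_two (y : ℝ) : phiY f 2 y p q =
    -(f.der 2 (partner f (y, p, q)) * (1 / p * f.der 1 y) ^ 2) +
      f.der 1 (partner f (y, p, q)) * (1 / p * f.der 2 y) := by
  refine phiY_succ f p q (phiY_one f · p q) ?_
  refine (((hasDerivAt_der_partner f p q 1 y).mul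
    ((f.hasDerivAt_der 1 y).const_mul (1 / p))).const_add (-p)).congr_deriv ?_
  ring

theorem phiY_three (y : ℝ) : phiY f 3 y p q =
    f.der 3 (partner f (y, p, q)) * (1 / p * f.der 1 y) ^ 3 -
      3 * f.der 2 (partner f (y, p, q)) * (1 / p) ^ 2 * f.der 1 y * f.der 2 y +
      f.der 1 (partner f (y, p, q)) * (1 / p * f.der 3 y) := by
  refine phiY_succ f p q (phiY_two f p q) ?_
  refine ((((hasDerivAt_der_partner f p q 2 y).mul
    (((f.hasDerivAt_der 1 y).const_mul (1 / p)).pow 2)).neg).add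
    ((hasDerivAt_der_partner f p q 1 y).mul
      ((f.hasDerivAt_der 2 y).const_mul (1 / p)))).congr_deriv ?_
  simp only [Pi.pow_apply]
  push_cast
  ring

theorem phiY_four (y : ℝ) : phiY f 4 y p q =
    -(f.der 4 (partner f (y, p, q)) * (1 / p) ^ 4 * f.der 1 y ^ 4) +
      6 * f.der 3 (partner f (y, p, q)) * (1 / p) ^ 3 * (f.der 1 y ^ 2 * f.der 2 y) -
      f.der 2 (partner f (y, p, q)) * (1 / p) ^ 2 *
        (3 * f.der 2 y ^ 2 + 4 * (f.der 1 y * f.der 3 y)) +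
      f.der 1 (partner f (y, p, q)) * (1 / p * f.der 4 y) := by
  refine phiY_succ f p q (phiY_three f p q) ?_
  refine ((((hasDerivAt_der_partner f p q 3 y).mul
    (((f.hasDerivAt_der 1 y).const_mul (1 / p)).pow 3)).sub
    (((((hasDerivAt_der_partner f p q 2 y).const_mul 3).mul_const ((1 / p) ^ 2)).mul
      (f.hasDerivAt_der 1 y)).mul (f.hasDerivAt_der 2 y))).add
    ((hasDerivAt_der_partner f p q 1 y).mul
      ((f.hasDerivAt_der 3 y).const_mul (1 / p)))).congr_deriv ?_
  simp only [Pi.pow_apply, Pi.mul_apply]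
  push_cast
  ring

theorem phiY_five (y : ℝ) : phiY f 5 y p q =
    f.der 5 (partner f (y, p, q)) * (1 / p) ^ 5 * f.der 1 y ^ 5 -
      10 * f.der 4 (partner f (y, p, q)) * (1 / p) ^ 4 * f.der 1 y ^ 3 * f.der 2 y +
      f.der 3 (partner f (y, p, q)) * (1 / p) ^ 3 *
        (15 * f.der 1 y * f.der 2 y ^ 2 + 10 * f.der 1 y ^ 2 * f.der 3 y) -
      f.der 2 (partner f (y, p, q)) * (1 / p) ^ 2 *
        (10 * f.der 2 y * f.der 3 y + 5 * f.der 1 y * f.der 4 y) +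
      f.der 1 (partner f (y, p, q)) * (1 / p * f.der 5 y) := by
  refine phiY_succ f p q (phiY_four f p q) ?_
  have d1 := f.hasDerivAt_der 1 y
  have d2 := f.hasDerivAt_der 2 y
  have d3 := f.hasDerivAt_der 3 y
  refine ((((((hasDerivAt_der_partner f p q 4 y).mul_const ((1 / p) ^ 4)).mul (d1.pow 4)).neg).add
    ((((hasDerivAt_der_partner f p q 3 y).const_mul 6).mul_const ((1 / p) ^ 3)).mul
      ((d1.pow 2).mul d2))).sub
    (((hasDerivAt_der_partner f p q 2 y).mul_const ((1 / p) ^ 2)).mul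
      (((d2.pow 2).const_mul 3).add ((d1.mul d3).const_mul 4)))).add
    ((hasDerivAt_der_partner f p q 1 y).mul
      ((f.hasDerivAt_der 4 y).const_mul (1 / p))) |>.congr_deriv ?_
  simp only [Pi.pow_apply, Pi.mul_apply, Pi.add_apply]
  push_cast
  ring

end

section

variable {f : IncrDiffeo} {p q x : ℝ}

theorem IncrDiffeo.DiagOrbit.phiY_three (h : f.DiagOrbit p q x) :
    phiY f 3 x p q = f.schwarz x / f.der 1 x := by
  have hp := h.p_pos.ne'
  rw [_root_.phiY_three, h.mem_horizon.2, schwarz, h.der_eq]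
  field_simp
  ring

theorem IncrDiffeo.DiagOrbit.phiY_five (h : f.DiagOrbit p q x) :
    phiY f 5 x p q = f.quint x / f.der 1 x ^ 2 := by
  have hp := h.p_pos.ne'
  rw [_root_.phiY_five, h.mem_horizon.2, quint, h.der_eq]
  field_simp
  ring

theorem IncrDiffeo.DiagOrbit.flipJacobian_eq (h : f.DiagOrbit p q x) (hS : f.schwarz x = 0) :
    flipJacobian f x p q = -2 * f.schwarz' x / f.der 1 x ^ 2 := by
  have hp := h.p_pos.ne'
  have hval := h.val
  rw [der_zero] at hval
  have hw : -(1 / p) * f x + q / p = x := h.mem_horizon.2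
  have dq : HasDerivAt (fun s => -(1 / p) * f x + s / p) (1 / p) q :=
    ((hasDerivAt_id q).div_const p).const_add _
  have di : HasDerivAt (fun s : ℝ => 1 / s) (-(1 / p ^ 2)) p := by
    simpa using hasDerivAt_inv hp
  have dp : HasDerivAt (fun s => -(1 / s) * f x + q / s) (-x / p) p := by
    have h1 : HasDerivAt (fun s => -(1 / s) * f x + q * (1 / s)) (-x / p) p := by
      refine ((di.neg.mul_const (f x)).add (di.const_mul q)).congr_deriv ?_
      rw [hval]; field_simp; ring
    simpa only [mul_one_div] using h1
  have eq (i : ℕ) : HasDerivAt (fun s => f.der i (-(1 / p) * f x + s / p))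
      (f.der (i + 1) x * (1 / p)) q := by
    have := (f.hasDerivAt_der i (-(1 / p) * f x + q / p)).comp q dq
    rwa [hw] at this
  have ep (i : ℕ) : HasDerivAt (fun s => f.der i (-(1 / s) * f x + q / s))
      (f.der (i + 1) x * (-x / p)) p := by
    have := (f.hasDerivAt_der i (-(1 / p) * f x + q / p)).comp p dp
    rwa [hw] at this
  simp only [flipJacobian, phiY_one, _root_.phiY_three, partner]
  have a1 := (((hasDerivAt_id p).neg).add ((ep 1).mul (di.mul_const (f.der 1 x)))).deriv
  have a2 := ((((eq 3).mul_const ((1 / p * f.der 1 x) ^ 3)).sub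
    (((((eq 2).const_mul 3).mul_const ((1 / p) ^ 2)).mul_const (f.der 1 x)).mul_const
      (f.der 2 x))).add ((eq 1).mul_const (1 / p * f.der 3 x))).deriv
  have a3 := (((eq 1).mul_const (1 / p * f.der 1 x)).const_add (-p)).deriv
  have a4 := ((((ep 3).mul ((di.mul_const (f.der 1 x)).pow 3)).sub
    (((((ep 2).const_mul 3).mul (di.pow 2)).mul_const (f.der 1 x)).mul_const
      (f.der 2 x))).add ((ep 1).mul (di.mul_const (f.der 3 x)))).deriv
  refine (congrArg₂ (· - ·) (congrArg₂ (· * ·) a1 a2) (congrArg₂ (· * ·) a3 a4)).trans ?_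
  simp only [Pi.pow_apply, hw, h.der_eq]
  rw [schwarz, h.der_eq] at hS
  rw [schwarz', h.der_eq]
  push_cast
  field_simp
  linear_combination 2 * f.der 2 x * hS

end

/-! ### The curve of two-point orbits near a flip -/

namespace IncrDiffeo

variable (f : IncrDiffeo)

/-- The derivative of `redDefect` with respect to the center of the chord. -/
noncomputable def redDefectCenter (z : ℝ × ℝ) : ℝ :=
  2 * f.avg₁ 2 z * f.avg₁ 3 z - f.avg₂ 4 z * (2 * f.avg₁ 1 z + z.2 ^ 2 * f.avg₂ 3 z) -
    f.avg₂ 3 z * (2 * f.avg₁ 2 z + z.2 ^ 2 * f.avg₂ 4 z)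

/-- The derivative of `redDefect` with respect to the half-length of the chord, divided by this
half-length. -/
noncomputable def redDefectLength (z : ℝ × ℝ) : ℝ :=
  2 * f.avg₁ 2 z * f.avg₂ 4 z - f.avg₃ 5 z * (2 * f.avg₁ 1 z + z.2 ^ 2 * f.avg₂ 3 z) -
    f.avg₂ 3 z * (4 * f.avg₂ 3 z + z.2 ^ 2 * f.avg₃ 5 z)

/-- On the curve `redDefect = 0`, the derivative of the center with respect to the half-length,
divided by the half-length. -/
noncomputable def centerRate (z : ℝ × ℝ) : ℝ := -f.redDefectLength z / f.redDefectCenter z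

/-- The sum of the values of `f'` at the mean and at the slope of the chord. -/
noncomputable def endSum (z : ℝ × ℝ) : ℝ := 2 * f.avg₁ 1 z + z.2 ^ 2 * f.avg₂ 3 z

/-- On the curve `redDefect = 0`, the speed of the corresponding point of the contour in the
direction `(avg₁ 2, avg₁ 2 * m + endSum)`, divided by the half-length of the chord. -/
noncomputable def frontRate (z : ℝ × ℝ) : ℝ := f.centerRate z + f.avg₁ 2 z / f.endSum z

theorem continuous_avg₁ (i : ℕ) : Continuous (f.avg₁ i) := (f.contDiff_avg₁ i).continuous
theorem continuous_avg₂ (i : ℕ) : Continuous (f.avg₂ i) := (f.contDiff_avg₂ i).continuous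
theorem continuous_avg₃ (i : ℕ) : Continuous (f.avg₃ i) := (f.contDiff_avg₃ i).continuous

theorem continuous_redDefectCenter : Continuous f.redDefectCenter := by
  have h1 := f.continuous_avg₁
  have h2 := f.continuous_avg₂
  unfold redDefectCenter
  fun_prop

theorem continuous_redDefectLength : Continuous f.redDefectLength := by
  have h1 := f.continuous_avg₁
  have h2 := f.continuous_avg₂
  have h3 := f.continuous_avg₃
  unfold redDefectLength
  fun_prop

theorem continuous_endSum : Continuous f.endSum := by
  have h1 := f.continuous_avg₁
  have h2 := f.continuous_avg₂
  unfold endSum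
  fun_prop

variable {f} {m : ℝ}

theorem redDefectCenter_zero (f : IncrDiffeo) (m : ℝ) :
    f.redDefectCenter (m, 0) = -(2 / 3) * f.schwarz' m := by
  simp only [redDefectCenter, avg₁_zero, avg₂_zero, schwarz']
  ring

theorem endSum_zero (f : IncrDiffeo) (m : ℝ) : f.endSum (m, 0) = 2 * f.der 1 m := by
  simp only [endSum, avg₁_zero]
  ring

/-- Where the Schwarzian vanishes, the rate of the front is proportional to the fifth derivative
of `φ₀`. -/
theorem frontRate_zero_ne (h1 : f.der 1 m ≠ 0) (hS : f.schwarz m = 0) (hS' : f.schwarz' m ≠ 0)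
    (hQ : f.quint m ≠ 0) : f.frontRate (m, 0) ≠ 0 := by
  rw [frontRate, centerRate, redDefectCenter_zero, endSum_zero, redDefectLength]
  simp only [avg₁_zero, avg₂_zero, avg₃_zero]
  intro h
  apply hQ
  field_simp at h
  rw [schwarz] at hS
  rw [quint]
  rw [schwarz'] at h
  linear_combination -(1 / 9) * h + 5 / 3 * f.der 3 m * hS

theorem continuousAt_centerRate (hS' : f.schwarz' m ≠ 0) : ContinuousAt f.centerRate (m, 0) :=
  f.continuous_redDefectLength.continuousAt.neg.div f.continuous_redDefectCenter.continuousAt (by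
    rw [redDefectCenter_zero]; exact mul_ne_zero (by norm_num) hS')

theorem continuousAt_frontRate (h1 : f.der 1 m ≠ 0) (hS' : f.schwarz' m ≠ 0) :
    ContinuousAt f.frontRate (m, 0) :=
  (continuousAt_centerRate hS').add ((f.continuous_avg₁ 2).continuousAt.div
    f.continuous_endSum.continuousAt (by
      rw [endSum_zero]; exact mul_ne_zero two_ne_zero h1))

theorem hasDerivAt_redDefect {μ : ℝ → ℝ} {v s : ℝ} (hμ : HasDerivAt μ v s) :
    HasDerivAt (fun s => f.redDefect (μ s, s))
      (v * f.redDefectCenter (μ s, s) + s * f.redDefectLength (μ s, s)) s := by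
  have hc : HasDerivAt (fun s => (μ s, s)) (v, 1) s := hμ.prodMk (hasDerivAt_id s)
  have h1 := (hasDerivAt_avg₁ (f := f) (i := 2) hc).pow 2
  have h2 := (hasDerivAt_avg₂ (f := f) (i := 3) hc)
  have h3 := (hasDerivAt_avg₁ (f := f) (i := 1) hc)
  refine (h1.sub (h2.mul ((h3.const_mul 2).add (((hasDerivAt_id s).pow 2).mul h2)))).congr_deriv ?_
  simp only [redDefectCenter, redDefectLength, Pi.mul_apply, Pi.add_apply, Pi.pow_apply, id]
  push_cast
  ring

theorem hasDerivAt_schwarz (f : IncrDiffeo) (x : ℝ) :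
    HasDerivAt f.schwarz (2 * f.schwarz' x) x := by
  refine ((((f.hasDerivAt_der 1 x).const_mul 2).mul (f.hasDerivAt_der 3 x)).sub
    (((f.hasDerivAt_der 2 x).pow 2).const_mul 3)).congr_deriv ?_
  rw [schwarz']; push_cast; ring

/-- The center `μ` of the chord over a two-point orbit near the diagonal point `m`, as a function
of the half-length of the chord. -/
structure IsCenterCurve (f : IncrDiffeo) (m : ℝ) (μ : ℝ → ℝ) : Prop where
  base : μ 0 = m
  smooth : ∀ᶠ s in 𝓝 0, ContDiffAt ℝ ∞ μ s
  zero : ∀ᶠ s in 𝓝 0, f.redDefect (μ s, s) = 0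
  covers : ∀ᶠ z in 𝓝 (m, (0 : ℝ)), f.redDefect z = 0 → z.1 = μ z.2

/-- The function `redDefect` restricts to a multiple of the Schwarzian on the diagonal, so a
simple zero of the latter lets the center be solved for. -/
theorem exists_isCenterCurve (hS : f.schwarz m = 0) (hS' : f.schwarz' m ≠ 0) :
    ∃ μ, f.IsCenterCurve m μ := by
  have hd : HasFDerivAt f.redDefect (fderiv ℝ f.redDefect (m, 0)) (m, 0) :=
    (f.contDiff_redDefect.differentiable (by simp) _).hasFDerivAt
  have hG : fderiv ℝ f.redDefect (m, 0) (1, 0) = -(2 / 3) * f.schwarz' m := by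
    have h1 : HasDerivAt (fun s : ℝ => (s, (0 : ℝ))) ((1 : ℝ), (0 : ℝ)) m :=
      (hasDerivAt_id m).prodMk (hasDerivAt_const m 0)
    have h2 := HasFDerivAt.comp_hasDerivAt (l := f.redDefect) m hd h1
    have h3 : HasDerivAt (fun s => -(1 / 3) * f.schwarz s) (-(2 / 3) * f.schwarz' m) m :=
      ((f.hasDerivAt_schwarz m).const_mul (-(1 / 3))).congr_deriv (by ring)
    have h4 : f.redDefect ∘ (fun s : ℝ => (s, (0 : ℝ))) = fun s => -(1 / 3) * f.schwarz s :=
      funext fun s => f.redDefect_zero s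
    rw [h4] at h2
    exact h2.unique h3
  obtain ⟨c, h0, hc, hz, ht, hcov⟩ := exists_level_curve
    (Eventually.of_forall fun z => f.contDiff_redDefect.contDiffAt (x := z))
    (by rw [redDefect_zero, hS, mul_zero]) hG rfl 0 1 (by
      rw [zero_mul, one_mul, zero_sub]
      exact neg_ne_zero.2 (mul_ne_zero (by norm_num) hS'))
  have e : ∀ᶠ t in 𝓝 0, c t = ((c t).1, t) := ht.mono fun t ht => by
    ext
    · rfl
    · simpa using ht
  refine ⟨fun t => (c t).1, by rw [h0], hc.mono fun t ht => contDiff_fst.contDiffAt.comp t ht,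
    ?_, ?_⟩
  · filter_upwards [hz, e] with t h1 h2
    rwa [h2] at h1
  · filter_upwards [hcov] with z hz hz0
    have := hz hz0
    simp only [zero_mul, one_mul, sub_zero, zero_add] at this
    rw [this]

namespace IsCenterCurve

variable {μ : ℝ → ℝ} (hμ : f.IsCenterCurve m μ)
include hμ

theorem tendsto : Tendsto (fun s => (μ s, s)) (𝓝 0) (𝓝 (m, 0)) := by
  have h : ContinuousAt μ 0 := hμ.smooth.self_of_nhds.continuousAt
  have := h.prodMk (continuousAt_id (x := (0 : ℝ)))
  rw [ContinuousAt, hμ.base] at this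
  exact this

theorem hasDerivAt (hS' : f.schwarz' m ≠ 0) :
    ∀ᶠ s in 𝓝 0, HasDerivAt μ (s * f.centerRate (μ s, s)) s := by
  have h1 : ∀ᶠ z in 𝓝 (m, (0 : ℝ)), f.redDefectCenter z ≠ 0 :=
    f.continuous_redDefectCenter.continuousAt.eventually_ne (by
      rw [redDefectCenter_zero]; exact mul_ne_zero (by norm_num) hS')
  filter_upwards [hμ.smooth, hμ.zero.eventually_nhds, hμ.tendsto.eventually h1] with s h1 h2 h3
  have hd := (h1.differentiableAt (by simp)).hasDerivAt
  have h4 := (hasDerivAt_redDefect hd).unique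
    ((hasDerivAt_const s (0 : ℝ)).congr_of_eventuallyEq h2)
  refine hd.congr_deriv ?_
  rw [centerRate]
  field_simp
  linear_combination h4

end IsCenterCurve

/-- The point of the contour given by the two-point orbit with center `μ s` and half-length `s`. -/
noncomputable def front (f : IncrDiffeo) (μ : ℝ → ℝ) (s : ℝ) : ℝ × ℝ :=
  (f.avg₁ 1 (μ s, s), (f (μ s + s) + f (μ s - s)) / 2 + f.avg₁ 1 (μ s, s) * μ s)

theorem front_zero {μ : ℝ → ℝ} (h : μ 0 = m) : f.front μ 0 = curveL f m := by
  rw [front, h, avg₁_zero, curveL_eq]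
  ext
  · rfl
  · simp; ring

theorem lift_center {s : ℝ} (μ : ℝ → ℝ) (hs : s ≠ 0) :
    (f.lift (μ s + s, μ s - s)).2 = f.front μ s := by
  have h := f.mul_avg₁ 0 (μ s, s)
  rw [zero_add, show f.der 0 = f from f.der_zero] at h
  rw [lift, front, intercept, slope_center hs]
  ext
  · rfl
  · simp only at h ⊢
    linear_combination -h

/-- The front has velocity of order `s`, in a direction that does not vanish at `s = 0`. -/
theorem IsCenterCurve.hasDerivAt_front {μ : ℝ → ℝ} (hμ : f.IsCenterCurve m μ)
    (h1 : f.der 1 m ≠ 0) (hS' : f.schwarz' m ≠ 0) :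
    ∀ᶠ s in 𝓝 0, HasDerivAt (f.front μ) ((s * f.frontRate (μ s, s)) • (f.avg₁ 2 (μ s, s),
      f.avg₁ 2 (μ s, s) * μ s + f.endSum (μ s, s))) s := by
  have hE : ∀ᶠ z in 𝓝 (m, (0 : ℝ)), f.endSum z ≠ 0 :=
    f.continuous_endSum.continuousAt.eventually_ne (by
      rw [endSum_zero]; exact mul_ne_zero two_ne_zero h1)
  filter_upwards [hμ.hasDerivAt hS', hμ.zero, hμ.tendsto.eventually hE] with s d1 h2 h3
  have hc := d1.prodMk (hasDerivAt_id s)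
  have a1 := hasDerivAt_avg₁ (f := f) (i := 1) hc
  have a2 := HasDerivAt.comp (h := fun s => μ s + s) s (f.hasDerivAt (μ s + s))
    (d1.add (hasDerivAt_id s))
  have a3 := HasDerivAt.comp (h := fun s => μ s - s) s (f.hasDerivAt (μ s - s))
    (d1.sub (hasDerivAt_id s))
  refine (a1.prodMk (((a2.add a3).div_const 2).add (a1.mul d1))).congr_deriv ?_
  have b1 := f.mul_avg₁ 1 (μ s, s)
  have b2 := f.avg₁_add_avg₂ 1 (μ s, s)
  simp only at b1 b2
  have e1 : f.der 1 (μ s + s) =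
      f.avg₁ 1 (μ s, s) + s ^ 2 * f.avg₂ 3 (μ s, s) + s * f.avg₁ 2 (μ s, s) := by
    linear_combination -b1 - b2
  have e2 : f.der 1 (μ s - s) =
      f.avg₁ 1 (μ s, s) + s ^ 2 * f.avg₂ 3 (μ s, s) - s * f.avg₁ 2 (μ s, s) := by
    linear_combination b1 - b2
  have e3 : f.endSum (μ s, s) * f.avg₂ 3 (μ s, s) = f.avg₁ 2 (μ s, s) ^ 2 := by
    rw [redDefect] at h2
    rw [endSum]
    linear_combination -h2
  have e4 : f.endSum (μ s, s) = 2 * f.avg₁ 1 (μ s, s) + s ^ 2 * f.avg₂ 3 (μ s, s) := rfl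
  simp only [frontRate, e1, e2, id]
  ext
  · simp only [Prod.smul_mk, smul_eq_mul]
    field_simp
    linear_combination s * e3
  · simp only [Prod.smul_mk, smul_eq_mul]
    field_simp
    linear_combination 2 * s * μ s * e3 -
      2 * s * f.centerRate (μ s, s) * f.endSum (μ s, s) * e4

end IncrDiffeo

/-! ### One-sided limits of derivatives -/

theorem tendsto_div_pow_of_hasDerivAt {g g' : ℝ → ℝ} {l : ℝ} {k : ℕ}
    (hg : ∀ᶠ s in 𝓝[>] 0, HasDerivAt g (g' s) s) (h0 : Tendsto g (𝓝[>] 0) (𝓝 0))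
    (hl : Tendsto (fun s => g' s / s ^ k) (𝓝[>] 0) (𝓝 l)) :
    Tendsto (fun s => g s / s ^ (k + 1)) (𝓝[>] 0) (𝓝 (l / (k + 1))) := by
  refine HasDerivAt.lhopital_zero_nhdsGT hg (g' := fun s : ℝ => (k + 1) * s ^ k) ?_ ?_ h0 ?_ ?_
  · exact Eventually.of_forall fun s => by simpa using hasDerivAt_pow (k + 1) s
  · filter_upwards [self_mem_nhdsWithin] with s hs
    have : (0 : ℝ) < s := hs
    positivity
  · have : Tendsto (fun s : ℝ => s ^ (k + 1)) (𝓝 0) (𝓝 (0 ^ (k + 1))) :=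
      (continuous_pow _).tendsto _
    rw [zero_pow (by simp)] at this
    exact this.mono_left nhdsWithin_le_nhds
  · refine (hl.div_const ((k : ℝ) + 1)).congr fun s => ?_
    rw [div_div, mul_comm]

/-- The extension of a function on `[0,∞)` to the line that is affine with slope `l` on the negative
half-line. -/
noncomputable def affineExt (g : ℝ → ℝ) (l x : ℝ) : ℝ := if x < 0 then g 0 + l * x else g x

theorem affineExt_of_nonneg {g : ℝ → ℝ} {l x : ℝ} (hx : 0 ≤ x) : affineExt g l x = g x :=
  if_neg hx.not_gt

theorem affineExt_of_neg {g : ℝ → ℝ} {l x : ℝ} (hx : x < 0) : affineExt g l x = g 0 + l * x :=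
  if_pos hx

theorem hasDerivAt_affineExt_zero {g : ℝ → ℝ} {l : ℝ}
    (hg : ∀ᶠ x in 𝓝[>] 0, ContDiffAt ℝ 1 g x) (h0 : Tendsto g (𝓝[>] 0) (𝓝 (g 0)))
    (hl : Tendsto (deriv g) (𝓝[>] 0) (𝓝 l)) : HasDerivAt (affineExt g l) l 0 := by
  have h1 : HasDerivWithinAt (affineExt g l) l (Iic 0) 0 := by
    have : HasDerivAt (fun x => g 0 + l * x) l 0 := by
      simpa using ((hasDerivAt_id (0 : ℝ)).const_mul l).const_add (g 0)
    refine this.hasDerivWithinAt.congr (fun x hx => ?_) (by simp [affineExt])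
    rcases (show x ≤ 0 from hx).lt_or_eq with hx | rfl
    · exact affineExt_of_neg hx
    · simp [affineExt]
  have h2 : HasDerivWithinAt g l (Ici 0) 0 := by
    obtain ⟨u, hu, hgu⟩ := (eventually_iff_exists_mem.1 hg)
    refine hasDerivWithinAt_Ici_of_tendsto_deriv (s := u ∩ Ioi 0) (fun x hx =>
      ((hgu x hx.1).differentiableAt (by simp)).differentiableWithinAt) ?_
      (inter_mem hu self_mem_nhdsWithin) hl
    exact (h0.mono_left (nhdsWithin_mono _ inter_subset_right))
  have h3 : HasDerivWithinAt (affineExt g l) l (Ici 0) 0 :=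
    h2.congr (fun x hx => affineExt_of_nonneg hx) (affineExt_of_nonneg le_rfl)
  have h4 := h1.union h3
  rwa [Iic_union_Ici, hasDerivWithinAt_univ] at h4

theorem contDiffAt_affineExt {g : ℝ → ℝ} {l : ℝ}
    (hg : ∀ᶠ x in 𝓝[>] 0, ContDiffAt ℝ 1 g x) (h0 : Tendsto g (𝓝[>] 0) (𝓝 (g 0)))
    (hl : Tendsto (deriv g) (𝓝[>] 0) (𝓝 l)) : ContDiffAt ℝ 1 (affineExt g l) 0 := by
  set G : ℝ → ℝ := fun x => if x ≤ 0 then l else deriv g x with hG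
  have hev : ∀ᶠ x in 𝓝 (0 : ℝ), 0 < x → ContDiffAt ℝ 1 g x := eventually_nhdsWithin_iff.1 hg
  have hGc : ∀ᶠ x in 𝓝 (0 : ℝ), ContinuousAt G x ∧ HasDerivAt (affineExt g l) (G x) x := by
    filter_upwards [hev] with x hx
    rcases lt_trichotomy x 0 with hx0 | rfl | hx0
    · have hn : ∀ᶠ y in 𝓝 x, y < 0 := gt_mem_nhds hx0
      constructor
      · exact (continuousAt_const (y := l)).congr (hn.mono fun y hy => by simp [hG, hy.le])
      · have : HasDerivAt (fun x => g 0 + l * x) l x := by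
          simpa using ((hasDerivAt_id x).const_mul l).const_add (g 0)
        simp only [hG, hx0.le, if_true]
        exact this.congr_of_eventuallyEq (hn.mono fun y hy => affineExt_of_neg hy)
    · constructor
      · have e0 : G 0 = l := by simp [hG]
        rw [continuousAt_iff_continuous_left'_right', ContinuousWithinAt, ContinuousWithinAt, e0]
        constructor
        · refine tendsto_const_nhds.congr' ?_
          filter_upwards [self_mem_nhdsWithin] with y hy
          simp [hG, (show y < 0 from hy).le]
        · refine hl.congr' ?_
          filter_upwards [self_mem_nhdsWithin] with y hy
          simp [hG, (show 0 < y from hy)]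
      · simp only [hG, le_refl, if_true]
        exact hasDerivAt_affineExt_zero hg h0 hl
    · have hn : ∀ᶠ y in 𝓝 x, 0 < y := lt_mem_nhds hx0
      have hgx := hx hx0
      constructor
      · exact ((hgx.deriv_of_succ_le (m := 0) (by simp)).continuousAt).congr
          (hn.mono fun y hy => by simp [hG, hy])
      · have e : G x = deriv g x := by simp [hG, hx0]
        rw [e]
        exact (hgx.differentiableAt (by simp)).hasDerivAt.congr_of_eventuallyEq
          (hn.mono fun y hy => affineExt_of_nonneg hy.le)
  rw [contDiffAt_one_iff]
  refine ⟨fun x => ContinuousLinearMap.toSpanSingleton ℝ (G x), _, hGc, ?_, ?_⟩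
  · intro x hx
    have h1 : ContinuousAt G x := (show ContinuousAt G x ∧ _ from hx).1
    exact ((ContinuousLinearMap.toSpanSingletonCLE (𝕜 := ℝ) (E := ℝ)).continuous.continuousAt.comp
      h1).continuousWithinAt
  · intro x hx
    exact (show ContinuousAt G x ∧ HasDerivAt (affineExt g l) (G x) x from hx).2

/-! ### Coordinates along the tangent developable -/

namespace IncrDiffeo

/-- Coordinates `(u, y)` of the plane adapted to the curve `L₀`, which is given by `u = 0`: the point
lies on the line of all `(p,q)` with `q = p y + f(y)`, at distance `u` in `p` from `L₀(y)`. -/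
noncomputable def chart (f : IncrDiffeo) (z : ℝ × ℝ) : ℝ × ℝ :=
  (z.1 + f.der 1 z.2, (z.1 + f.der 1 z.2) * z.2 + f z.2)

variable {f : IncrDiffeo} {m : ℝ}

theorem chart_zero (f : IncrDiffeo) (y : ℝ) : f.chart (0, y) = curveL f y := by
  rw [chart, curveL_eq]; simp

theorem contDiff_chart (f : IncrDiffeo) : ContDiff ℝ ∞ f.chart := by
  have h1 : ContDiff ℝ ∞ (fun z : ℝ × ℝ => f.der 1 z.2) := (f.contDiff_der 1).comp contDiff_snd
  have h2 : ContDiff ℝ ∞ (fun z : ℝ × ℝ => f z.2) := f.smooth.comp contDiff_snd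
  unfold chart
  fun_prop

theorem hasDerivAt_chart {u y : ℝ → ℝ} {u' y' t : ℝ} (hu : HasDerivAt u u' t)
    (hy : HasDerivAt y y' t) : HasDerivAt (fun t => f.chart (u t, y t))
      (u' + f.der 2 (y t) * y', (u' + f.der 2 (y t) * y') * y t +
        (u t + 2 * f.der 1 (y t)) * y') t := by
  have h1 := hu.add ((f.hasDerivAt_der 1 (y t)).comp t hy)
  refine (h1.prodMk ((h1.mul hy).add ((f.hasDerivAt (y t)).comp t hy))).congr_deriv ?_
  simp only [Pi.add_apply, Function.comp]
  ext <;> simp; ring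

theorem exists_chart_inverse (h1 : 0 < f.der 1 m) : ∃ Φ : OpenPartialHomeomorph (ℝ × ℝ) (ℝ × ℝ),
    (0, m) ∈ Φ.source ∧ (Φ : ℝ × ℝ → ℝ × ℝ) = f.chart ∧
      ∀ z ∈ Φ.target, ContDiffAt ℝ ∞ Φ.symm z := by
  have hd : HasFDerivAt f.chart (fderiv ℝ f.chart (0, m)) (0, m) :=
    (f.contDiff_chart.differentiable (by simp) _).hasFDerivAt
  obtain ⟨e, he⟩ := exists_equiv_of_injective (L := fderiv ℝ f.chart (0, m)) (by
    rintro ⟨a, b⟩ hab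
    have c1 : HasDerivAt (fun t : ℝ => a * t) a 0 := by
      simpa using (hasDerivAt_id (0 : ℝ)).const_mul a
    have c2 : HasDerivAt (fun t : ℝ => m + b * t) b 0 := by
      simpa using ((hasDerivAt_id (0 : ℝ)).const_mul b).const_add m
    have h3 := hasDerivAt_chart (f := f) c1 c2
    have h4 : HasDerivAt (fun t : ℝ => f.chart (a * t, m + b * t)) (fderiv ℝ f.chart (0, m) (a, b))
        0 := by
      refine HasFDerivAt.comp_hasDerivAt (l := f.chart) 0 ?_ (c1.prodMk c2)
      simpa using hd
    have h5 := h3.unique h4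
    rw [hab] at h5
    simp only [mul_zero, add_zero] at h5
    have e1 := congrArg Prod.fst h5
    have e2 := congrArg Prod.snd h5
    simp only [Prod.fst_zero, Prod.snd_zero] at e1 e2
    rw [e1, zero_mul, zero_add, zero_add] at e2
    have hb : b = 0 := (mul_eq_zero.1 e2).resolve_left (by positivity)
    rw [hb, mul_zero, add_zero] at e1
    rw [e1, hb]; rfl)
  obtain ⟨Φ, hz, hΦ, -, hs⟩ := exists_smooth_local_inverse (n := ∞) (by simp)
    (Eventually.of_forall fun z => f.contDiff_chart.contDiffAt (x := z)) e he
  exact ⟨Φ, hz, hΦ, hs⟩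

end IncrDiffeo

/-! ### The front in adapted coordinates -/

namespace IncrDiffeo

variable {f : IncrDiffeo} {m : ℝ} {μ : ℝ → ℝ}

theorem IsCenterCurve.contDiffAt_front (hμ : f.IsCenterCurve m μ) :
    ∀ᶠ s in 𝓝 0, ContDiffAt ℝ ∞ (f.front μ) s := by
  filter_upwards [hμ.smooth] with s hs
  have h1 : ContDiffAt ℝ ∞ (fun s => f.avg₁ 1 (μ s, s)) s :=
    (f.contDiff_avg₁ 1).contDiffAt.comp s (hs.prodMk contDiffAt_id)
  have h2 : ContDiffAt ℝ ∞ (fun s => f (μ s + s)) s :=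
    f.smooth.contDiffAt.comp s (hs.add contDiffAt_id)
  have h3 : ContDiffAt ℝ ∞ (fun s => f (μ s - s)) s :=
    f.smooth.contDiffAt.comp s (hs.sub contDiffAt_id)
  exact h1.prodMk (((h2.add h3).div_const 2).add (h1.mul hs))

/-- The coordinates `(u, y)` of a point of the front: `y` has velocity of order `s`, and `u` has
velocity of order `s³`. -/
structure IsFrontCoords (f : IncrDiffeo) (m : ℝ) (μ u y : ℝ → ℝ) : Prop where
  u_zero : u 0 = 0
  y_zero : y 0 = m
  chart_eq : ∀ᶠ s in 𝓝 0, f.chart (u s, y s) = f.front μ s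
  u_smooth : ∀ᶠ s in 𝓝 0, ContDiffAt ℝ ∞ u s
  y_smooth : ∀ᶠ s in 𝓝 0, ContDiffAt ℝ ∞ y s

theorem IsCenterCurve.exists_isFrontCoords (hμ : f.IsCenterCurve m μ) (h1 : 0 < f.der 1 m) :
    ∃ u y, f.IsFrontCoords m μ u y := by
  obtain ⟨Φ, hz, hΦ, hs⟩ := exists_chart_inverse h1
  have h0 : f.front μ 0 = Φ (0, m) := by rw [front_zero hμ.base, hΦ, chart_zero]
  have hc : Tendsto (f.front μ) (𝓝 0) (𝓝 (Φ (0, m))) :=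
    h0 ▸ hμ.contDiffAt_front.self_of_nhds.continuousAt
  have hT := hc.eventually (Φ.open_target.mem_nhds (Φ.map_source hz))
  have hsm : ∀ᶠ s in 𝓝 0, ContDiffAt ℝ ∞ (fun s => Φ.symm (f.front μ s)) s := by
    filter_upwards [hT, hμ.contDiffAt_front] with s h2 h3
    exact (hs _ h2).comp s h3
  refine ⟨fun s => (Φ.symm (f.front μ s)).1, fun s => (Φ.symm (f.front μ s)).2, ?_, ?_, ?_,
    hsm.mono fun s h => contDiff_fst.contDiffAt.comp s h,
    hsm.mono fun s h => contDiff_snd.contDiffAt.comp s h⟩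
  · simp only [h0, Φ.left_inv hz]
  · simp only [h0, Φ.left_inv hz]
  · filter_upwards [hT] with s h2
    have := Φ.right_inv h2
    rwa [hΦ] at this

/-- The sum of the slopes of the chord and of the tangent that determine the denominators of the
velocities of the coordinates of the front. -/
noncomputable def slopeSum (f : IncrDiffeo) (μ y : ℝ → ℝ) (s : ℝ) : ℝ :=
  f.avg₁ 1 (μ s, s) + f.der 1 (y s)

/-- The numerator of the velocity of the coordinate `y` along the front. -/
noncomputable def yNum (f : IncrDiffeo) (μ y : ℝ → ℝ) (s : ℝ) : ℝ :=
  f.endSum (μ s, s) + (μ s - y s) * f.avg₁ 2 (μ s, s)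

/-- The numerator of the velocity of the coordinate `u` along the front. -/
noncomputable def uNum (f : IncrDiffeo) (μ y : ℝ → ℝ) (s : ℝ) : ℝ :=
  f.avg₁ 2 (μ s, s) * f.slopeSum μ y s - f.der 2 (y s) * f.yNum μ y s

/-- The velocity of `y` along the front, divided by `s`. -/
noncomputable def yRate (f : IncrDiffeo) (μ y : ℝ → ℝ) (s : ℝ) : ℝ :=
  f.frontRate (μ s, s) * f.yNum μ y s / f.slopeSum μ y s

/-- The derivative of `uNum`, divided by `s`. -/
noncomputable def uNumRate (f : IncrDiffeo) (μ y : ℝ → ℝ) (s : ℝ) : ℝ :=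
  (f.avg₁ 3 (μ s, s) * f.centerRate (μ s, s) + f.avg₂ 4 (μ s, s)) * f.slopeSum μ y s +
  f.avg₁ 2 (μ s, s) * (f.avg₁ 2 (μ s, s) * f.centerRate (μ s, s) + f.avg₂ 3 (μ s, s) +
    f.der 2 (y s) * f.yRate μ y s) -
  f.der 3 (y s) * f.yRate μ y s * f.yNum μ y s -
  f.der 2 (y s) * (2 * f.avg₁ 2 (μ s, s) * f.centerRate (μ s, s) + 4 * f.avg₂ 3 (μ s, s) +
    s ^ 2 * (f.avg₂ 4 (μ s, s) * f.centerRate (μ s, s) + f.avg₃ 5 (μ s, s)) +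
    (f.centerRate (μ s, s) - f.yRate μ y s) * f.avg₁ 2 (μ s, s) +
    (μ s - y s) * (f.avg₁ 3 (μ s, s) * f.centerRate (μ s, s) + f.avg₂ 4 (μ s, s)))

namespace IsFrontCoords

variable {u y : ℝ → ℝ} (hu : f.IsFrontCoords m μ u y) (hμ : f.IsCenterCurve m μ)
  (h1 : 0 < f.der 1 m) (hS' : f.schwarz' m ≠ 0)

theorem _root_.IncrDiffeo.IsCenterCurve.continuousAt_frontRate (hμ : f.IsCenterCurve m μ)
    (h1 : 0 < f.der 1 m) (hS' : f.schwarz' m ≠ 0) :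
    ContinuousAt (fun s => f.frontRate (μ s, s)) 0 :=
  ContinuousAt.comp_of_eq (f := fun s => (μ s, s)) (IncrDiffeo.continuousAt_frontRate h1.ne' hS')
    (hμ.smooth.self_of_nhds.continuousAt.prodMk continuousAt_id) (by rw [hμ.base])

include hu

theorem continuousAt_u : ContinuousAt u 0 := hu.u_smooth.self_of_nhds.continuousAt

theorem continuousAt_y : ContinuousAt y 0 := hu.y_smooth.self_of_nhds.continuousAt

include hμ

theorem continuousAt_slopeSum : ContinuousAt (f.slopeSum μ y) 0 :=
  ((f.continuous_avg₁ 1).continuousAt.comp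
    (hμ.smooth.self_of_nhds.continuousAt.prodMk continuousAt_id)).add
    ((f.continuous_der 1).continuousAt.comp hu.continuousAt_y)

theorem slopeSum_zero : f.slopeSum μ y 0 = 2 * f.der 1 m := by
  rw [slopeSum, hμ.base, hu.y_zero, avg₁_zero]; ring

theorem continuousAt_yNum : ContinuousAt (f.yNum μ y) 0 := by
  have hc := hμ.smooth.self_of_nhds.continuousAt
  have h := hc.prodMk (continuousAt_id (x := (0 : ℝ)))
  exact (f.continuous_endSum.continuousAt.comp h).add ((hc.sub hu.continuousAt_y).mul
    ((f.continuous_avg₁ 2).continuousAt.comp h))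

theorem yNum_zero : f.yNum μ y 0 = 2 * f.der 1 m := by
  rw [yNum, hμ.base, hu.y_zero, endSum_zero]; ring

theorem uNum_zero : f.uNum μ y 0 = 0 := by
  rw [uNum, hu.slopeSum_zero hμ, hu.yNum_zero hμ, hμ.base, hu.y_zero, avg₁_zero]; ring

include h1

theorem yRate_zero : f.yRate μ y 0 = f.frontRate (m, 0) := by
  rw [yRate, hu.slopeSum_zero hμ, hu.yNum_zero hμ, hμ.base]
  field_simp

theorem uNumRate_zero (hS : f.schwarz m = 0) : f.uNumRate μ y 0 = 2 / 3 * f.schwarz' m := by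
  simp only [uNumRate, hu.slopeSum_zero hμ, hu.yNum_zero hμ, hu.yRate_zero hμ h1, hμ.base,
    hu.y_zero, avg₁_zero, avg₂_zero, avg₃_zero]
  rw [frontRate, endSum_zero, avg₁_zero, schwarz']
  rw [schwarz] at hS
  have hk : f.der 2 m - 2 * f.der 1 m * (f.der 2 m / (2 * f.der 1 m)) = 0 := by field_simp; ring
  linear_combination 1 / 3 * f.der 3 m * hk - 2 / 3 * (f.der 2 m / (2 * f.der 1 m)) * hS

include hS'

theorem continuousAt_yRate : ContinuousAt (f.yRate μ y) 0 :=
  ((hμ.continuousAt_frontRate h1 hS').mul (hu.continuousAt_yNum hμ)).div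
    (hu.continuousAt_slopeSum hμ) (by rw [hu.slopeSum_zero hμ]; positivity)

theorem continuousAt_uNumRate : ContinuousAt (f.uNumRate μ y) 0 := by
  have hc := hμ.smooth.self_of_nhds.continuousAt
  have h := hc.prodMk (continuousAt_id (x := (0 : ℝ)))
  have hy := hu.continuousAt_y
  have a1 (i) : ContinuousAt (fun s => f.avg₁ i (μ s, s)) 0 :=
    (f.continuous_avg₁ i).continuousAt.comp h
  have a2 (i) : ContinuousAt (fun s => f.avg₂ i (μ s, s)) 0 :=
    (f.continuous_avg₂ i).continuousAt.comp h
  have a3 : ContinuousAt (fun s => f.avg₃ 5 (μ s, s)) 0 :=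
    (f.continuous_avg₃ 5).continuousAt.comp h
  have d (i) : ContinuousAt (fun s => f.der i (y s)) 0 :=
    (f.continuous_der i).continuousAt.comp hy
  have hM : ContinuousAt (fun s => f.centerRate (μ s, s)) 0 :=
    ContinuousAt.comp_of_eq (f := fun s => (μ s, s)) (continuousAt_centerRate hS') h
      (by simp [hμ.base])
  have b1 := hu.continuousAt_yRate hμ h1 hS'
  have b2 := hu.continuousAt_yNum hμ
  have b3 := hu.continuousAt_slopeSum hμ
  unfold uNumRate
  fun_prop

/-- The velocities of the coordinates of the front are found by expressing its velocity in the
frame of `chart`. -/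
theorem hasDerivAt_u_y : ∀ᶠ s in 𝓝 0,
    HasDerivAt u (s * f.frontRate (μ s, s) * f.uNum μ y s / f.slopeSum μ y s) s ∧
    HasDerivAt y (s * f.yRate μ y s) s := by
  have hne : ∀ᶠ s in 𝓝 0, f.slopeSum μ y s ≠ 0 :=
    (hu.continuousAt_slopeSum hμ).eventually_ne (by rw [hu.slopeSum_zero hμ]; positivity)
  filter_upwards [hu.u_smooth, hu.y_smooth, hu.chart_eq.eventually_nhds,
    hμ.hasDerivAt_front h1.ne' hS', hne] with s hus hys hch hfr hne
  have du := (hus.differentiableAt (by simp)).hasDerivAt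
  have dy := (hys.differentiableAt (by simp)).hasDerivAt
  have h2 := (hasDerivAt_chart (f := f) du dy).unique (hfr.congr_of_eventuallyEq hch)
  have e0 := congrArg Prod.fst hch.self_of_nhds
  have e1 := congrArg Prod.fst h2
  have e2 := congrArg Prod.snd h2
  simp only [chart, front, Prod.smul_mk, smul_eq_mul] at e0 e1 e2
  have e3 : f.slopeSum μ y s = u s + 2 * f.der 1 (y s) := by rw [slopeSum]; linear_combination -e0
  have e4 : deriv y s * f.slopeSum μ y s = s * f.frontRate (μ s, s) * f.yNum μ y s := by
    rw [e3, yNum]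
    linear_combination e2 - y s * e1
  have e5 : deriv y s = s * f.yRate μ y s := by
    rw [yRate]; field_simp; linear_combination e4
  refine ⟨du.congr_deriv ?_, dy.congr_deriv e5⟩
  rw [uNum]
  field_simp
  linear_combination f.slopeSum μ y s * e1 - f.der 2 (y s) * e4

theorem hasDerivAt_uNum : ∀ᶠ s in 𝓝 0, HasDerivAt (f.uNum μ y) (s * f.uNumRate μ y s) s := by
  filter_upwards [hμ.hasDerivAt hS', hu.hasDerivAt_u_y hμ h1 hS'] with s dμ d
  have dy := d.2
  have hc : HasDerivAt (fun s => (μ s, s)) _ s := dμ.prodMk (hasDerivAt_id s)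
  have a1 := hasDerivAt_avg₁ (f := f) (i := 1) hc
  have a2 := hasDerivAt_avg₁ (f := f) (i := 2) hc
  have a3 := hasDerivAt_avg₂ (f := f) (i := 3) hc
  have d1 := HasDerivAt.comp (h := y) s (f.hasDerivAt_der 1 (y s)) dy
  have d2 := HasDerivAt.comp (h := y) s (f.hasDerivAt_der 2 (y s)) dy
  have dE : HasDerivAt (fun s => f.endSum (μ s, s)) _ s :=
    (a1.const_mul 2).add (((hasDerivAt_id s).pow 2).mul a3)
  have dS : HasDerivAt (f.slopeSum μ y) _ s := a1.add d1
  have dW : HasDerivAt (f.yNum μ y) _ s := dE.add ((dμ.sub dy).mul a2)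
  refine ((a2.mul dS).sub (d2.mul dW)).congr_deriv ?_
  simp only [uNumRate, Function.comp, Pi.pow_apply, Pi.sub_apply, id]
  push_cast
  ring

theorem tendsto_uNum (hS : f.schwarz m = 0) :
    Tendsto (fun s => f.uNum μ y s / s ^ 2) (𝓝[>] 0) (𝓝 (f.schwarz' m / 3)) := by
  have h2 := hu.hasDerivAt_uNum hμ h1 hS'
  have hc : ContinuousAt (f.uNum μ y) 0 := h2.self_of_nhds.continuousAt
  rw [ContinuousAt, hu.uNum_zero hμ] at hc
  have hr := hu.continuousAt_uNumRate hμ h1 hS'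
  rw [ContinuousAt, hu.uNumRate_zero hμ h1 hS] at hr
  have := tendsto_div_pow_of_hasDerivAt (k := 1) (h2.filter_mono nhdsWithin_le_nhds)
    (hc.mono_left nhdsWithin_le_nhds) ((hr.mono_left nhdsWithin_le_nhds).congr' (by
      filter_upwards [self_mem_nhdsWithin] with s hs
      have : s ≠ 0 := (show 0 < s from hs).ne'
      field_simp))
  convert this using 2
  push_cast; ring

/-- The velocity of `u` is of exact order `s³`. -/
theorem tendsto_deriv_u (hS : f.schwarz m = 0) :
    Tendsto (fun s => deriv u s / s ^ 3) (𝓝[>] 0)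
      (𝓝 (f.frontRate (m, 0) * (f.schwarz' m / 3) / (2 * f.der 1 m))) := by
  have h2 := (hu.hasDerivAt_u_y hμ h1 hS').filter_mono (nhdsWithin_le_nhds (s := Ioi 0))
  have c1 := (hμ.continuousAt_frontRate h1 hS').tendsto.mono_left
    (nhdsWithin_le_nhds (s := Ioi 0))
  have c2 := (hu.continuousAt_slopeSum hμ).tendsto.mono_left (nhdsWithin_le_nhds (s := Ioi 0))
  rw [hu.slopeSum_zero hμ] at c2
  rw [hμ.base] at c1
  refine ((c1.mul (hu.tendsto_uNum hμ h1 hS' hS)).div c2 (by positivity)).congr' ?_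
  filter_upwards [h2, self_mem_nhdsWithin] with s h3 hs
  have : s ≠ 0 := (show 0 < s from hs).ne'
  rw [h3.1.deriv]
  simp only [Pi.div_apply]
  field_simp

theorem tendsto_u (hS : f.schwarz m = 0) :
    Tendsto (fun s => u s / s ^ 4) (𝓝[>] 0)
      (𝓝 (f.frontRate (m, 0) * (f.schwarz' m / 3) / (2 * f.der 1 m) / 4)) := by
  have hc := hu.continuousAt_u
  rw [ContinuousAt, hu.u_zero] at hc
  have := tendsto_div_pow_of_hasDerivAt (k := 3) (g := u) (g' := deriv u)
    ((hu.u_smooth.mono fun s h => (h.differentiableAt (by simp)).hasDerivAt).filter_mono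
      nhdsWithin_le_nhds) (hc.mono_left nhdsWithin_le_nhds) (hu.tendsto_deriv_u hμ h1 hS' hS)
  convert this using 2
  push_cast; ring

end IsFrontCoords

end IncrDiffeo

/-! ### The normal form of a flip -/

/-- The contour of the model is the union of the line and of the half-parabola. -/
theorem mem_flipModel {z : ℝ × ℝ} :
    z ∈ flipModel ↔ z.1 = 0 ∨ (0 ≤ z.2 ∧ z.1 = -z.2 ^ 2 / 4) := by
  constructor
  · rintro ⟨y, h1, h2⟩
    by_cases hy : y = 0
    · left
      simpa [hy] using h2
    · right
      have h3 : z.1 + z.2 * y ^ 2 - y ^ 4 = 0 :=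
        (mul_eq_zero.1 (by linear_combination h1 : y * (z.1 + z.2 * y ^ 2 - y ^ 4) = 0)).resolve_left
          hy
      have h4 : z.2 = 2 * y ^ 2 := by
        refine mul_left_cancel₀ (pow_ne_zero 2 hy) ?_
        linear_combination (h2 - h3) / 2
      exact ⟨h4 ▸ by positivity, by rw [h4] at h3 ⊢; linear_combination h3⟩
  · rintro (h | ⟨h1, h2⟩)
    · exact ⟨0, by simp, by simp [h]⟩
    · have h3 : √(z.2 / 2) ^ 2 = z.2 / 2 := Real.sq_sqrt (by positivity)
      refine ⟨√(z.2 / 2), ?_, ?_⟩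
      · rw [h2]
        linear_combination √(z.2 / 2) * (z.2 / 2 - √(z.2 / 2) ^ 2) * h3
      · rw [h2]
        linear_combination (3 * z.2 - 5 * √(z.2 / 2) ^ 2 - 5 * z.2 / 2) * h3

/-- Two charts of the plane in which a set `S` and a set `M` look the same combine to a local
`C¹` diffeomorphism that carries `S` to `M`. -/
theorem exists_local_diffeo {F G : ℝ × ℝ → ℝ × ℝ} {S M : Set (ℝ × ℝ)} {z : ℝ × ℝ}
    (hF : ContDiffAt ℝ 1 F z) (hF' : ∀ v, fderiv ℝ F z v = 0 → v = 0)
    (hG : ContDiffAt ℝ 1 G z) (hG' : ∀ v, fderiv ℝ G z v = 0 → v = 0)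
    (h : ∀ᶠ x in 𝓝 z, F x ∈ S ↔ G x ∈ M) :
    ∃ Ψ : OpenPartialHomeomorph (ℝ × ℝ) (ℝ × ℝ), F z ∈ Ψ.source ∧ Ψ (F z) = G z ∧
      ContDiffOn ℝ 1 Ψ Ψ.source ∧ ContDiffOn ℝ 1 Ψ.symm Ψ.target ∧
      Ψ '' (S ∩ Ψ.source) = M ∩ Ψ.target := by
  obtain ⟨e, he⟩ := exists_equiv_of_injective hF'
  obtain ⟨e', he'⟩ := exists_equiv_of_injective hG'
  obtain ⟨Φ, hz, hΦ, hs, ht⟩ := exists_smooth_local_inverse le_rfl (hF.eventually (by simp)) e he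
  obtain ⟨Θ, hz', hΘ, hs', ht'⟩ :=
    exists_smooth_local_inverse le_rfl (hG.eventually (by simp)) e' he'
  obtain ⟨O, hO, hOo, hzO⟩ := eventually_nhds_iff.1 h
  have hzr : z ∈ (Φ.restrOpen O hOo).source := ⟨hz, hzO⟩
  have hsub : ∀ {x}, x ∈ ((Φ.restrOpen O hOo).symm.trans Θ).source →
      x ∈ Φ.target ∧ Φ.symm x ∈ O ∧ Φ.symm x ∈ Θ.source := by
    intro x hx
    have h1 := (Φ.restrOpen O hOo).map_target hx.1
    exact ⟨((Φ.restrOpen_toPartialEquiv O hOo) ▸ hx.1).1, h1.2, hx.2⟩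
  refine ⟨(Φ.restrOpen O hOo).symm.trans Θ, ?_, ?_, ?_, ?_, ?_⟩
  · rw [OpenPartialHomeomorph.trans_source]
    refine ⟨?_, ?_⟩
    · have := (Φ.restrOpen O hOo).map_source hzr
      rw [← hΦ]; exact this
    · change Φ.symm (F z) ∈ Θ.source
      rw [← hΦ, Φ.left_inv hz]; exact hz'
  · change Θ (Φ.symm (F z)) = G z
    rw [← hΦ, Φ.left_inv hz, hΘ]
  · intro x hx
    obtain ⟨h1, h2, h3⟩ := hsub hx
    have h4 : ContDiffAt ℝ 1 Θ (Φ.symm x) := hΘ ▸ hs' _ h3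
    exact (h4.comp x (ht _ h1)).contDiffWithinAt
  · intro x hx
    have h1 := ((Φ.restrOpen O hOo).symm.trans Θ).map_target hx
    have hx1 : x ∈ Θ.target := hx.1
    have h2 : Θ.symm x ∈ Φ.source := ((Φ.restrOpen O hOo).symm.map_target hx.2).elim fun _ _ => hx.2.1
    have h3 : ContDiffAt ℝ 1 Φ (Θ.symm x) := hΦ ▸ hs _ h2
    exact (h3.comp x (ht' _ hx1)).contDiffWithinAt
  · have himg : ((Φ.restrOpen O hOo).symm.trans Θ).IsImage S M := by
      intro x hx
      obtain ⟨h1, h2, h3⟩ := hsub hx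
      have h4 := hO _ h2
      have h5 : F (Φ.symm x) = x := by rw [← hΦ]; exact Φ.right_inv h1
      rw [h5] at h4
      change Θ (Φ.symm x) ∈ M ↔ x ∈ S
      rw [h4, hΘ]
    rw [inter_comm S, inter_comm M]
    exact himg.image_eq

namespace IncrDiffeo

variable {f : IncrDiffeo} {m : ℝ} {μ : ℝ → ℝ}

theorem curveL_mem_contour {y : ℝ} (hy : y ∈ Icc (-1 : ℝ) 1) : curveL f y ∈ apparentContour f :=
  ⟨_, (diagOrbit_iff.2 ⟨hy, rfl⟩ : f.DiagOrbit (curveL f y).1 (curveL f y).2 y).mem_horizon.1, rfl⟩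

theorem IsCenterCurve.front_mem_contour (hμ : f.IsCenterCurve m μ) (hm : m ∈ Ioo (-1 : ℝ) 1) :
    ∀ᶠ s in 𝓝 0, f.front μ s ∈ apparentContour f := by
  have hc : ContinuousAt μ 0 := hμ.smooth.self_of_nhds.continuousAt
  have h1 : ∀ᶠ s in 𝓝 0, μ s + s ∈ Icc (-1 : ℝ) 1 :=
    (hc.add continuousAt_id).eventually (by
      simp only [Pi.add_apply, id, hμ.base, add_zero]; exact Icc_mem_nhds hm.1 hm.2)
  have h2 : ∀ᶠ s in 𝓝 0, μ s - s ∈ Icc (-1 : ℝ) 1 :=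
    (hc.sub continuousAt_id).eventually (by
      simp only [Pi.sub_apply, id, hμ.base, sub_zero]; exact Icc_mem_nhds hm.1 hm.2)
  have h3 : ∀ᶠ z in 𝓝 (m, (0 : ℝ)), 0 < f.avg₁ 1 z :=
    (f.continuous_avg₁ 1).continuousAt.eventually (lt_mem_nhds (by
      rw [avg₁_zero]; exact f.der_one_pos ⟨hm.1.le, hm.2.le⟩))
  filter_upwards [h1, h2, hμ.tendsto.eventually h3, hμ.zero] with s h1 h2 h3 h4
  by_cases hs : s = 0
  · subst hs
    rw [front_zero hμ.base]
    exact curveL_mem_contour ⟨hm.1.le, hm.2.le⟩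
  · rw [← lift_center μ hs]
    have h5 := offOrbit_of_defect_eq_zero (f := f) h1 h2 (fun h => hs (by linarith))
      (by rw [slope_center hs]; exact h3) (by rw [defect_center hs, h4, mul_zero])
    exact ⟨_, h5.mem_horizon.1, rfl⟩

theorem OffOrbit.eq_front {p q r y w : ℝ}
    (h : f.OffOrbit p q r y w) (hc : (y + w) / 2 = μ ((y - w) / 2)) :
    (p, q) = f.front μ ((y - w) / 2) := by
  have hs : (y - w) / 2 ≠ 0 := div_ne_zero h.sub_ne two_ne_zero
  rw [← lift_center μ hs, ← hc, show (y + w) / 2 + (y - w) / 2 = y by ring,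
    show (y + w) / 2 - (y - w) / 2 = w by ring, lift, h.slope_eq, h.intercept_eq]

/-- Near the diagonal point `m` the horizon consists of the diagonal and of the two-point orbits on
the center curve. -/
theorem IsCenterCurve.eventually_orbit (hμ : f.IsCenterCurve m μ) (hm : m ∈ Icc (-1 : ℝ) 1)
    {N : Set ℝ} (hN : N ∈ 𝓝 (0 : ℝ)) : ∀ᶠ k in 𝓝 (m, curveL f m), k ∈ horizon f →
      (k.1 - m ∈ N ∧ k.2 = curveL f k.1) ∨ ∃ s ∈ N, 0 < s ∧ k.2 = f.front μ s := by
  have hd : f.DiagOrbit (curveL f m).1 (curveL f m).2 m := diagOrbit_iff.2 ⟨hm, rfl⟩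
  have hpart : partner f (m, curveL f m) = m := hd.mem_horizon.2
  have hp : ContinuousAt (partner f) (m, curveL f m) := continuousAt_partner f hd.p_pos
  have t1 : Tendsto (fun k : ℝ × ℝ × ℝ => k.1 - m) (𝓝 (m, curveL f m)) (𝓝 0) := by
    have : Continuous fun k : ℝ × ℝ × ℝ => k.1 - m := by fun_prop
    exact this.tendsto' _ _ (by simp)
  have t2 : Tendsto (fun k : ℝ × ℝ × ℝ => ((k.1 + partner f k) / 2, (k.1 - partner f k) / 2))
      (𝓝 (m, curveL f m)) (𝓝 (m, 0)) := by
    have := ((continuousAt_fst.add hp).div_const 2).prodMk ((continuousAt_fst.sub hp).div_const 2)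
    simpa [ContinuousAt, hpart] using this
  have t3 : Tendsto (fun k : ℝ × ℝ × ℝ => ((partner f k + k.1) / 2, (partner f k - k.1) / 2))
      (𝓝 (m, curveL f m)) (𝓝 (m, 0)) := by
    have := ((hp.add continuousAt_fst).div_const 2).prodMk ((hp.sub continuousAt_fst).div_const 2)
    simpa [ContinuousAt, hpart] using this
  have hev : ∀ᶠ z in 𝓝 (m, (0 : ℝ)), z.2 ∈ N := continuousAt_snd.eventually hN
  filter_upwards [t1.eventually hN, t2.eventually (hμ.covers.and hev),
    t3.eventually (hμ.covers.and hev)] with k h1 h2 h3 hk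
  by_cases heq : k.1 = partner f k
  · exact Or.inl ⟨h1, (diagOrbit_iff.1 (diagOrbit_of_mem_horizon hk heq)).2⟩
  · right
    have ho := offOrbit_of_mem_horizon hk heq
    rcases lt_or_gt_of_ne heq with hlt | hlt
    · exact ⟨_, h3.2, by linarith, ho.swap.eq_front (h3.1 ho.swap.redDefect_eq)⟩
    · exact ⟨_, h2.2, by linarith, ho.eq_front (h2.1 ho.redDefect_eq)⟩

/-- If the only orbit over `L₀(m)` is `{m}`, then the contour near `L₀(m)` is the union of the
curve `L₀` and of the front: by compactness of the horizon, points of the contour near `L₀(m)`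
lift to points of the horizon near `(m, L₀(m))`. -/
theorem IsCenterCurve.eventually_contour (hμ : f.IsCenterCurve m μ) (hm : m ∈ Icc (-1 : ℝ) 1)
    (hfib : ∀ k ∈ horizon f, k.2 = curveL f m → k.1 = m)
    {N : Set ℝ} (hN : N ∈ 𝓝 (0 : ℝ)) : ∀ᶠ z in 𝓝 (curveL f m), z ∈ apparentContour f →
      (∃ y, y - m ∈ N ∧ z = curveL f y) ∨ ∃ s ∈ N, 0 < s ∧ z = f.front μ s := by
  have h := image_snd_mem_nhdsWithin_contour (f := f) (z := curveL f m) (W := {k |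
      (k.1 - m ∈ N ∧ k.2 = curveL f k.1) ∨ ∃ s ∈ N, 0 < s ∧ k.2 = f.front μ s}) (by
    intro k hk hkz
    left
    rw [show k = (m, curveL f m) from Prod.ext (hfib k hk hkz) hkz]
    exact mem_nhdsWithin_iff_eventually.2 (hμ.eventually_orbit hm hN))
  rw [mem_nhdsWithin_iff_eventually] at h
  filter_upwards [h] with z hz hzc
  obtain ⟨k, hk, rfl⟩ := hz hzc
  rcases hk with hk | hk
  · exact Or.inl ⟨k.1, hk⟩
  · exact Or.inr hk

end IncrDiffeo

/-! ### Straightening the front at a flip -/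

namespace IncrDiffeo

variable {f : IncrDiffeo} {m : ℝ} {μ u y : ℝ → ℝ}

theorem tendsto_sqrt_nhdsGT : Tendsto Real.sqrt (𝓝[>] 0) (𝓝[>] 0) := by
  refine tendsto_nhdsWithin_iff.2 ⟨?_, ?_⟩
  · have := Real.continuous_sqrt.tendsto 0
    rw [Real.sqrt_zero] at this
    exact this.mono_left nhdsWithin_le_nhds
  · filter_upwards [self_mem_nhdsWithin] with x hx
    exact Real.sqrt_pos.2 hx

theorem eventually_comp_sqrt {n : WithTop ℕ∞} {g : ℝ → ℝ} (hg : ∀ᶠ s in 𝓝 0, ContDiffAt ℝ n g s) :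
    ∀ᶠ x in 𝓝[>] 0, ContDiffAt ℝ n (fun x => g (√x)) x := by
  filter_upwards [tendsto_sqrt_nhdsGT.eventually (hg.filter_mono nhdsWithin_le_nhds),
    self_mem_nhdsWithin] with x h1 h2
  exact h1.comp x (Real.contDiffAt_sqrt (show 0 < x from h2).ne')

namespace IsFrontCoords

variable (hu : f.IsFrontCoords m μ u y) (hμ : f.IsCenterCurve m μ)
  (h1 : 0 < f.der 1 m) (hS' : f.schwarz' m ≠ 0)
include hu hμ h1 hS'

/-- As a function of the square of the half-length of the chord, the coordinate `y` is `C¹` up to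
the flip. -/
theorem tendsto_deriv_y : Tendsto (deriv fun x => y (√x)) (𝓝[>] 0) (𝓝 (f.frontRate (m, 0) / 2)) := by
  have hr := (hu.continuousAt_yRate hμ h1 hS').tendsto
  rw [hu.yRate_zero hμ h1] at hr
  refine (((hr.mono_left nhdsWithin_le_nhds).comp tendsto_sqrt_nhdsGT).div_const 2).congr' ?_
  filter_upwards [tendsto_sqrt_nhdsGT.eventually
    ((hu.hasDerivAt_u_y hμ h1 hS').filter_mono nhdsWithin_le_nhds), self_mem_nhdsWithin] with x h2 h3
  have hx : 0 < x := h3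
  have h4 := (Real.sqrt_pos.2 hx).ne'
  have h5 : HasDerivAt (fun x => y (√x)) _ x := h2.2.comp x (Real.hasDerivAt_sqrt hx.ne')
  rw [h5.deriv, Function.comp]
  field_simp

variable {σ : ℝ} (hL : 0 < σ * (f.frontRate (m, 0) * (f.schwarz' m / 3) / (2 * f.der 1 m)))
include hL

theorem eventually_u_pos (hS : f.schwarz m = 0) : ∀ᶠ s in 𝓝[>] 0, 0 < σ * u s := by
  have h2 := (hu.tendsto_u hμ h1 hS' hS).const_mul σ
  filter_upwards [h2.eventually (lt_mem_nhds (a := 0) (by linarith)), self_mem_nhdsWithin] with s h3 h4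
  have h5 : 0 < s := h4
  have h6 := mul_pos h3 (pow_pos h5 4)
  have h7 : σ * (u s / s ^ 4) * s ^ 4 = σ * u s := by field_simp
  rwa [h7] at h6

/-- As a function of the square of the half-length of the chord, `√|u|` is `C¹` up to the flip. -/
theorem tendsto_deriv_sqrt_u (hS : f.schwarz m = 0) :
    Tendsto (deriv fun x => 2 * √(σ * u (√x))) (𝓝[>] 0)
      (𝓝 √(σ * (f.frontRate (m, 0) * (f.schwarz' m / 3) / (2 * f.der 1 m)))) := by
  set L := f.frontRate (m, 0) * (f.schwarz' m / 3) / (2 * f.der 1 m) with hLdef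
  have a1 := (hu.tendsto_deriv_u hμ h1 hS' hS).const_mul σ
  have a2 := (Real.continuous_sqrt.tendsto _).comp ((hu.tendsto_u hμ h1 hS' hS).const_mul σ)
  have hne : 2 * √(σ * (L / 4)) ≠ 0 :=
    mul_ne_zero two_ne_zero (Real.sqrt_pos.2 (by linarith)).ne'
  have a3 := (a1.div (a2.const_mul 2) hne).comp tendsto_sqrt_nhdsGT
  have e : σ * L / (2 * √(σ * (L / 4))) = √(σ * L) := by
    rw [show σ * (L / 4) = σ * L / 2 ^ 2 by ring, Real.sqrt_div' _ (by positivity),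
      Real.sqrt_sq (by norm_num), mul_div_cancel₀ _ two_ne_zero, div_eq_iff, ← sq,
      Real.sq_sqrt hL.le]
    exact (Real.sqrt_pos.2 hL).ne'
  rw [← hLdef, e] at a3
  refine a3.congr' ?_
  filter_upwards [tendsto_sqrt_nhdsGT.eventually (((hu.hasDerivAt_u_y hμ h1 hS').filter_mono
    nhdsWithin_le_nhds).and (hu.eventually_u_pos hμ h1 hS' hL hS)), self_mem_nhdsWithin]
    with x h2 h3
  have hx : 0 < x := h3
  have h4 := Real.sqrt_pos.2 hx
  have h5 : HasDerivAt (fun x => 2 * √(σ * u (√x))) _ x :=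
    (((h2.1.1.differentiableAt.hasDerivAt.comp x (Real.hasDerivAt_sqrt hx.ne')).const_mul σ).sqrt
      h2.2.ne').const_mul 2
  rw [h5.deriv]
  simp only [Function.comp, Pi.div_apply]
  have h6 : √(σ * (u √x / √x ^ 4)) = √(σ * u √x) / √x ^ 2 := by
    rw [← mul_div_assoc, show √x ^ 4 = (√x ^ 2) ^ 2 by ring, Real.sqrt_div' _ (by positivity),
      Real.sqrt_sq (by positivity)]
  have h7 := (Real.sqrt_pos.2 h2.2).ne'
  rw [h6]
  field_simp

end IsFrontCoords

/-- The normal form of a flip. The parameter `x = s²` turns both coordinates of the front into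
`C¹` functions: `y` has a nonzero derivative at `x = 0`, and `σ u`, for a suitable sign `σ`, is
the square of a function `R(x) / 2` whose derivative at `x = 0` is nonzero as well. In the
coordinates `(u, x)` the curve `L₀` becomes the line `u = 0`, the front becomes `u = σ R(x)² / 4`
with `x > 0`, and the map `(u, x) ↦ (-σ u, R(x))` carries these to the model. Both functions are
extended to `x < 0` as affine functions. -/
theorem exists_flip_diffeo (hm : m ∈ Ioo (-1 : ℝ) 1) (hS : f.schwarz m = 0)
    (hS' : f.schwarz' m ≠ 0) (hQ : f.quint m ≠ 0)
    (hfib : ∀ k ∈ horizon f, k.2 = curveL f m → k.1 = m) :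
    ∃ Ψ : OpenPartialHomeomorph (ℝ × ℝ) (ℝ × ℝ),
      curveL f m ∈ Ψ.source ∧ Ψ (curveL f m) = 0 ∧
      ContDiffOn ℝ 1 Ψ Ψ.source ∧ ContDiffOn ℝ 1 Ψ.symm Ψ.target ∧
      Ψ '' (apparentContour f ∩ Ψ.source) = flipModel ∩ Ψ.target := by
  have hmI : m ∈ Icc (-1 : ℝ) 1 := ⟨hm.1.le, hm.2.le⟩
  have h1 := f.der_one_pos hmI
  obtain ⟨μ, hμ⟩ := exists_isCenterCurve hS hS'
  obtain ⟨u, y, hu⟩ := hμ.exists_isFrontCoords h1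
  have hB := frontRate_zero_ne h1.ne' hS hS' hQ
  set B := f.frontRate (m, 0) with hBdef
  have hL0 : B * (f.schwarz' m / 3) / (2 * f.der 1 m) ≠ 0 := by positivity
  obtain ⟨σ, hσ, hL⟩ : ∃ σ : ℝ, σ * σ = 1 ∧
      0 < σ * (B * (f.schwarz' m / 3) / (2 * f.der 1 m)) := by
    rcases lt_or_gt_of_ne hL0 with h | h
    · exact ⟨-1, by norm_num, by linarith⟩
    · exact ⟨1, by norm_num, by linarith⟩
  have hσ0 : σ ≠ 0 := fun h => by simp [h] at hσ
  -- the two coordinate functions, in terms of `x = s²`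
  have y0 : y √0 = m := by rw [Real.sqrt_zero, hu.y_zero]
  have u0 : 2 * √(σ * u √0) = 0 := by rw [Real.sqrt_zero, hu.u_zero]; simp
  have ty : Tendsto (fun x => y (√x)) (𝓝[>] 0) (𝓝 (y √0)) :=
    ((hu.continuousAt_y.comp_of_eq Real.continuous_sqrt.continuousAt Real.sqrt_zero).tendsto
      ).mono_left nhdsWithin_le_nhds
  have tu : Tendsto (fun x => 2 * √(σ * u (√x))) (𝓝[>] 0) (𝓝 (2 * √(σ * u √0))) := by
    have : ContinuousAt (fun x => u √x) 0 :=
      hu.continuousAt_u.comp_of_eq Real.continuous_sqrt.continuousAt Real.sqrt_zero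
    exact (((this.const_mul σ).sqrt.const_mul 2).tendsto).mono_left nhdsWithin_le_nhds
  have sy : ∀ᶠ x in 𝓝[>] 0, ContDiffAt ℝ 1 (fun x => y (√x)) x :=
    eventually_comp_sqrt (hu.y_smooth.mono fun s h => h.of_le (by simp))
  have su : ∀ᶠ x in 𝓝[>] 0, ContDiffAt ℝ 1 (fun x => 2 * √(σ * u (√x))) x := by
    filter_upwards [eventually_comp_sqrt (hu.u_smooth.mono fun s h => h.of_le (m := 1) (by simp)),
      tendsto_sqrt_nhdsGT.eventually (hu.eventually_u_pos hμ h1 hS' hL hS)] with x h2 h3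
    exact contDiffAt_const.mul ((contDiffAt_const.mul h2).sqrt h3.ne')
  have dy := hu.tendsto_deriv_y hμ h1 hS'
  have du := hu.tendsto_deriv_sqrt_u hμ h1 hS' hL hS
  rw [← hBdef] at dy du
  set l := √(σ * (B * (f.schwarz' m / 3) / (2 * f.der 1 m))) with hl
  have hl0 : 0 < l := Real.sqrt_pos.2 hL
  set V := affineExt (fun x => y (√x)) (B / 2) with hV
  set R := affineExt (fun x => 2 * √(σ * u (√x))) l with hR
  have cV : ContDiffAt ℝ 1 V 0 := contDiffAt_affineExt sy ty dy
  have cR : ContDiffAt ℝ 1 R 0 := contDiffAt_affineExt su tu du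
  have dV : HasDerivAt V (B / 2) 0 := hasDerivAt_affineExt_zero sy ty dy
  have dR : HasDerivAt R l 0 := hasDerivAt_affineExt_zero su tu du
  have V0 : V 0 = m := by rw [hV, affineExt_of_nonneg le_rfl, y0]
  have R0 : R 0 = 0 := by rw [hR, affineExt_of_nonneg le_rfl, u0]
  set F : ℝ × ℝ → ℝ × ℝ := fun z => f.chart (z.1, V z.2) with hF
  set G : ℝ × ℝ → ℝ × ℝ := fun z => (-σ * z.1, R z.2) with hG
  have cF : ContDiffAt ℝ 1 F 0 := by
    refine (f.contDiff_chart.of_le (by simp)).contDiffAt.comp 0 (contDiffAt_fst.prodMk ?_)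
    exact ContDiffAt.comp (g := V) (f := Prod.snd) 0 cV contDiffAt_snd
  have cG : ContDiffAt ℝ 1 G 0 := (contDiffAt_const.mul contDiffAt_fst).prodMk
    (ContDiffAt.comp (g := R) (f := Prod.snd) 0 cR contDiffAt_snd)
  have hline : ∀ a b : ℝ, HasDerivAt (fun t : ℝ => (a * t, b * t)) (a, b) 0 := fun a b => by
    simpa using ((hasDerivAt_id (0 : ℝ)).const_mul a).prodMk ((hasDerivAt_id (0 : ℝ)).const_mul b)
  have hFz : F 0 = curveL f m := by simp only [hF, Prod.fst_zero, Prod.snd_zero, V0, chart_zero]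
  have hGz : G 0 = 0 := by simp [hG, R0]
  obtain ⟨Φ, hz, hΦ, -⟩ := exists_chart_inverse h1
  obtain ⟨U, hU, hVi⟩ := exists_injOn_of_hasStrictDerivAt (cV.hasStrictDerivAt' dV (by simp))
    (by positivity)
  have hi := Φ.injOn
  rw [hΦ] at hi
  have hsrc := Φ.open_source.mem_nhds hz
  have n1 : ∀ᶠ s in 𝓝 (0 : ℝ), (u s, y s) ∈ Φ.source := by
    have : ContinuousAt (fun s => (u s, y s)) 0 := hu.continuousAt_u.prodMk hu.continuousAt_y
    exact this.eventually (by
      simp only [hu.u_zero, hu.y_zero]; exact hsrc)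
  have n2 : ∀ᶠ s in 𝓝 (0 : ℝ), ((0 : ℝ), m + s) ∈ Φ.source := by
    have : ContinuousAt (fun s : ℝ => ((0 : ℝ), m + s)) 0 := by fun_prop
    exact this.eventually (by simp only [add_zero]; exact hsrc)
  have n3 : ∀ᶠ s in 𝓝 (0 : ℝ), 0 ≤ s → 0 ≤ σ * u s := by
    filter_upwards [eventually_nhdsWithin_iff.1 (hu.eventually_u_pos hμ h1 hS' hL hS)] with s hs h0
    rcases h0.eq_or_lt with rfl | h0
    · simp [hu.u_zero]
    · exact (hs h0).le
  have n4 : ∀ᶠ s in 𝓝 (0 : ℝ), s ^ 2 ∈ U := by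
    have : ContinuousAt (fun s : ℝ => s ^ 2) 0 := by fun_prop
    exact this.eventually (by simpa using hU)
  have hN := n1.and (n2.and (n3.and (n4.and (hu.chart_eq.and (hμ.front_mem_contour hm)))))
  have tF : Tendsto F (𝓝 0) (𝓝 (curveL f m)) := hFz ▸ cF.continuousAt
  have tsq : Tendsto (fun z : ℝ × ℝ => √z.2) (𝓝 0) (𝓝 0) := by
    have : Continuous fun z : ℝ × ℝ => √z.2 := by fun_prop
    exact this.tendsto' _ _ (by simp)
  have t2 : Tendsto (fun z : ℝ × ℝ => z.2) (𝓝 0) (𝓝 0) := continuous_snd.tendsto' _ _ rfl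
  have tV : Tendsto (fun z : ℝ × ℝ => V z.2) (𝓝 0) (𝓝 m) := by
    have := dV.continuousAt.tendsto.comp t2
    rwa [V0] at this
  have tz : Tendsto (fun z : ℝ × ℝ => (z.1, V z.2)) (𝓝 0) (𝓝 (0, m)) :=
    (continuous_fst.tendsto' _ _ rfl).prodMk_nhds tV
  have key : ∀ᶠ z in 𝓝 (0 : ℝ × ℝ), F z ∈ apparentContour f ↔ G z ∈ flipModel := by
    filter_upwards [tF.eventually (hμ.eventually_contour hmI hfib hN), tsq.eventually hN,
      tz.eventually hsrc, t2.eventually hU, tV.eventually (Icc_mem_nhds hm.1 hm.2)]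
      with z z1 z2 z3 z4 z5
    rw [mem_flipModel]
    constructor
    · intro hz
      rcases z1 hz with ⟨x, hx, hzx⟩ | ⟨s, hs, hs0, hzs⟩
      · left
        rw [← chart_zero] at hzx
        have hx2 := hx.2.1
        rw [add_sub_cancel] at hx2
        have := congrArg Prod.fst (hi z3 hx2 hzx)
        simp only at this
        simp [hG, this]
      · right
        obtain ⟨s1, -, s3, s4, s5, -⟩ := hs
        rw [← s5] at hzs
        have h2 := hi z3 s1 hzs
        have e1 := congrArg Prod.fst h2
        have e2 := congrArg Prod.snd h2
        simp only at e1 e2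
        have e3 : V (s ^ 2) = y s := by
          rw [hV, affineExt_of_nonneg (by positivity), Real.sqrt_sq hs0.le]
        have e4 : z.2 = s ^ 2 := hVi z4 s4 (e2.trans e3.symm)
        have e5 : R z.2 = 2 * √(σ * u s) := by
          rw [hR, e4, affineExt_of_nonneg (by positivity), Real.sqrt_sq hs0.le]
        simp only [hG, e5, e1]
        refine ⟨by positivity, ?_⟩
        rw [mul_pow, Real.sq_sqrt (s3 hs0.le)]
        ring
    · obtain ⟨s1, -, s3, -, s5, s6⟩ := z2
      rintro (h0 | ⟨h2, h3⟩)
      · have h0' : z.1 = 0 := by simpa [hG, hσ0] using h0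
        simp only [hF, h0', chart_zero]
        exact curveL_mem_contour z5
      · have hx : 0 ≤ z.2 := by
          by_contra hx
          push Not at hx
          have : R z.2 = 2 * √(σ * u √0) + l * z.2 := by rw [hR, affineExt_of_neg hx]
          simp only [hG, this, u0] at h2
          nlinarith
        have e5 : R z.2 = 2 * √(σ * u √z.2) := by rw [hR, affineExt_of_nonneg hx]
        have e6 : V z.2 = y √z.2 := by rw [hV, affineExt_of_nonneg hx]
        simp only [hG, e5] at h3
        rw [mul_pow, Real.sq_sqrt (s3 (Real.sqrt_nonneg _))] at h3
        have e7 : z.1 = u √z.2 := mul_left_cancel₀ hσ0 (by linear_combination -h3)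
        simp only [hF]
        rw [e6, e7, s5]
        exact s6
  -- `F` and `G` are charts of the plane near `0` in which the contour and the model agree
  obtain ⟨Ψ, p1, p2, p3⟩ := exists_local_diffeo cF (by
    rintro ⟨a, b⟩ hab
    have c1 := (hasDerivAt_id (0 : ℝ)).const_mul a
    have c2 : HasDerivAt (fun t : ℝ => V (b * t)) (B / 2 * b) 0 := by
      have h3 : HasDerivAt (fun t : ℝ => b * t) b 0 := by
        simpa using (hasDerivAt_id (0 : ℝ)).const_mul b
      exact HasDerivAt.comp (h := fun t => b * t) 0 (by simpa using dV) h3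
    have h3 := hasDerivAt_chart (f := f) c1 c2
    have h4 : HasDerivAt (fun t : ℝ => F (a * t, b * t)) (fderiv ℝ F 0 (a, b)) 0 := by
      refine HasFDerivAt.comp_hasDerivAt (l := F) 0 ?_ (hline a b)
      rw [mul_zero, mul_zero]
      exact (cF.differentiableAt (by simp)).hasFDerivAt
    have h5 := h3.unique h4
    rw [hab] at h5
    simp only [mul_zero, V0, id, mul_one] at h5
    have e1 := congrArg Prod.fst h5
    have e2 := congrArg Prod.snd h5
    simp only [Prod.fst_zero, Prod.snd_zero] at e1 e2
    rw [e1, zero_mul, zero_add, zero_add] at e2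
    have hb : b = 0 := by
      have : B / 2 * b = 0 := (mul_eq_zero.1 e2).resolve_left (by positivity)
      exact (mul_eq_zero.1 this).resolve_left (by positivity)
    rw [hb, mul_zero, mul_zero, add_zero] at e1
    rw [e1, hb]; rfl) cG (by
    rintro ⟨a, b⟩ hab
    have h3 : HasDerivAt (fun t : ℝ => b * t) b 0 := by
      simpa using (hasDerivAt_id (0 : ℝ)).const_mul b
    have h4 : HasDerivAt (fun t : ℝ => G (a * t, b * t)) (fderiv ℝ G 0 (a, b)) 0 := by
      refine HasFDerivAt.comp_hasDerivAt (l := G) 0 ?_ (hline a b)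
      rw [mul_zero, mul_zero]
      exact (cG.differentiableAt (by simp)).hasFDerivAt
    have h5 : HasDerivAt (fun t : ℝ => G (a * t, b * t)) (-σ * a, l * b) 0 := by
      refine HasDerivAt.prodMk ?_ (HasDerivAt.comp (h₂ := R) (h := fun t => b * t) 0 (by simpa using dR) h3)
      simpa using ((hasDerivAt_id (0 : ℝ)).const_mul a).const_mul (-σ)
    have h6 := h5.unique h4
    rw [hab] at h6
    have e1 := congrArg Prod.fst h6
    have e2 := congrArg Prod.snd h6
    simp only [Prod.fst_zero, Prod.snd_zero] at e1 e2
    rw [(mul_eq_zero.1 e1).resolve_left (neg_ne_zero.2 hσ0),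
      (mul_eq_zero.1 e2).resolve_left hl0.ne']
    rfl) key
  rw [hFz] at p1 p2
  rw [hGz] at p2
  exact ⟨Ψ, p1, p2, p3⟩

end IncrDiffeo

/-! ### Generic functions: flips -/

namespace IncrDiffeo

variable {f : IncrDiffeo} {m : ℝ}

theorem diagOrbit_curveL {y : ℝ} (hy : y ∈ Icc (-1 : ℝ) 1) :
    f.DiagOrbit (curveL f y).1 (curveL f y).2 y := diagOrbit_iff.2 ⟨hy, rfl⟩

theorem mem_flipSet_iff {y : ℝ} : y ∈ flipSet f ↔ y ∈ Icc (-1 : ℝ) 1 ∧ f.schwarz y = 0 := by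
  refine and_congr_right fun hy => ?_
  rw [(diagOrbit_curveL hy).phiY_three, div_eq_zero_iff, or_iff_left (f.der_one_pos hy).ne']

theorem _root_.Set.finite_of_forall_eventually_notMem {X : Type*} [TopologicalSpace X] {K S : Set X}
    (hK : IsCompact K) (hS : S ⊆ K) (h : ∀ x ∈ K, ∀ᶠ y in 𝓝[≠] x, y ∉ S) : S.Finite := by
  by_contra hinf
  obtain ⟨x, hx, hacc⟩ := Set.Infinite.exists_accPt_of_subset_isCompact hinf hK hS
  exact (accPt_iff_frequently_nhdsNE.1 hacc) ((h x hx).mono fun y hy => hy)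

theorem IsGeneric.finite_flipSet (hf : f.IsGeneric) : (flipSet f).Finite := by
  refine Set.finite_of_forall_eventually_notMem isCompact_Icc (fun y hy => hy.1) fun x hx => ?_
  have h : ∀ᶠ y in 𝓝[≠] x, f.schwarz y ≠ 0 := by
    by_cases h0 : f.schwarz x = 0
    · exact (f.hasDerivAt_schwarz x).eventually_ne
        (mul_ne_zero two_ne_zero (hf.schwarz_simple x hx h0))
    · exact ((f.hasDerivAt_schwarz x).continuousAt.eventually_ne h0).filter_mono nhdsWithin_le_nhds
  exact h.mono fun y hy hyf => hy (mem_flipSet_iff.1 hyf).2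

theorem IsGeneric.mem_Ioo_of_schwarz (hf : f.IsGeneric) (hm : m ∈ Icc (-1 : ℝ) 1)
    (hS : f.schwarz m = 0) : m ∈ Ioo (-1 : ℝ) 1 :=
  ⟨hm.1.lt_of_ne' fun h => hf.schwarz_ne m (Or.inr h) hS,
    hm.2.lt_of_ne fun h => hf.schwarz_ne m (Or.inl h) hS⟩

theorem IsGeneric.isCodimTwoFlip (hf : f.IsGeneric) (hm : m ∈ flipSet f) : IsCodimTwoFlip f m := by
  obtain ⟨hmI, hS⟩ := mem_flipSet_iff.1 hm
  have hd := diagOrbit_curveL (f := f) hmI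
  have h1 := (f.der_one_pos hmI).ne'
  have hS' := hf.schwarz_simple m hmI hS
  have hQ := hf.quint_ne m hmI hS
  have hmo := hf.mem_Ioo_of_schwarz hmI hS
  refine ⟨hmo, hm.2, ?_, ?_, exists_flip_diffeo hmo hS hS' hQ fun k hk hkm => ?_⟩
  · rw [hd.phiY_five]; exact div_ne_zero hQ (pow_ne_zero 2 h1)
  · rw [hd.flipJacobian_eq hS]
    exact div_ne_zero (mul_ne_zero (by norm_num) hS') (pow_ne_zero 2 h1)
  · by_cases heq : k.1 = partner f k
    · have := diagOrbit_of_mem_horizon hk heq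
      rw [hkm] at this
      exact this.unique hd
    · have := offOrbit_of_mem_horizon hk heq
      rw [hkm] at this
      exact absurd hS (hf.diag_schwarz _ _ _ _ _ _ hd this)

/-- Near a flip there are no cusps. -/
theorem IsGeneric.eventually_not_cusp (hf : f.IsGeneric) (hm : m ∈ Icc (-1 : ℝ) 1)
    (hS : f.schwarz m = 0) : ∀ᶠ z in 𝓝 (m, m), ∀ p q r, f.OffOrbit p q r z.1 z.2 →
      f.der 2 z.1 ≠ r ^ 3 * f.der 2 z.2 := by
  have h1 := f.der_one_pos hm
  have hS' := hf.schwarz_simple m hm hS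
  have hB := frontRate_zero_ne h1.ne' hS hS' (hf.quint_ne m hm hS)
  obtain ⟨μ, hμ⟩ := exists_isCenterCurve hS hS'
  have t1 : Tendsto (fun z : ℝ × ℝ => ((z.1 + z.2) / 2, (z.1 - z.2) / 2)) (𝓝 (m, m))
      (𝓝 (m, 0)) := by
    have : Continuous fun z : ℝ × ℝ => ((z.1 + z.2) / 2, (z.1 - z.2) / 2) := by fun_prop
    exact this.tendsto' _ _ (by simp)
  have t2 : Tendsto (fun z : ℝ × ℝ => (z.1 - z.2) / 2) (𝓝 (m, m)) (𝓝 0) := by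
    have : Continuous fun z : ℝ × ℝ => (z.1 - z.2) / 2 := by fun_prop
    exact this.tendsto' _ _ (by simp)
  have e1 : ∀ᶠ z in 𝓝 (m, (0 : ℝ)), f.endSum z ≠ 0 :=
    f.continuous_endSum.continuousAt.eventually_ne (by
      rw [endSum_zero]; exact mul_ne_zero two_ne_zero h1.ne')
  have e2 : ∀ᶠ z in 𝓝 (m, (0 : ℝ)), f.endSum z + z.2 * f.avg₁ 2 z ≠ 0 := by
    have := f.continuous_avg₁ 2
    have := f.continuous_endSum
    refine ContinuousAt.eventually_ne (by fun_prop) ?_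
    rw [endSum_zero]
    simpa using h1.ne'
  have e3 : ∀ᶠ z in 𝓝 (m, (0 : ℝ)), f.frontRate z ≠ 0 :=
    (continuousAt_frontRate h1.ne' hS').eventually_ne hB
  filter_upwards [t1.eventually hμ.covers, t2.eventually (hμ.hasDerivAt hS'),
    t2.eventually hμ.zero.eventually_nhds,
    t2.eventually (hμ.tendsto.eventually (e1.and (e2.and e3)))] with z z1 z2 z3 z4 p q r ho hK
  obtain ⟨y, w⟩ := z
  simp only at z1 z2 z3 z4 ho hK
  set s := (y - w) / 2 with hs
  have hs0 : s ≠ 0 := div_ne_zero ho.sub_ne two_ne_zero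
  have hc : (y + w) / 2 = μ s := z1 ho.redDefect_eq
  obtain ⟨z4, z5, z6⟩ := z4
  have ey : μ s + s = y := by rw [← hc, hs]; ring
  have ew : μ s - s = w := by rw [← hc, hs]; ring
  have hdef : ∀ᶠ t in 𝓝 s, f.defect (μ t + t, μ t - t) = 0 := by
    filter_upwards [z3, continuousAt_id.eventually_ne hs0] with t h2 h3
    rw [defect_center (show t ≠ 0 from h3), h2, mul_zero]
  have hsl : f.slope (y, w) = p := ho.slope_eq
  have hti := tangent_identity (f := f) (z2.add (hasDerivAt_id s)) (z2.sub (hasDerivAt_id s))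
    (t := s) (by simp only [Pi.add_apply, Pi.sub_apply, id, ey, ew]; exact ho.ne) hdef
    (by simp only [Pi.add_apply, id, ey]; exact (f.der_one_pos ho.y_mem).ne')
    (by simp only [Pi.add_apply, Pi.sub_apply, id, ey, ew, hsl]; exact ho.p_pos.ne')
  simp only [Pi.add_apply, Pi.sub_apply, id, ey, ew, hsl, ho.cuspFun_eq_zero_iff.2 hK, mul_zero,
    mul_eq_zero] at hti
  have hnum := hti.resolve_right (by
    have := ho.transversal_ne_zero (hf.regular _ _ _ _ _ ho) hK
    rwa [ho.der_y])
  have b1 := f.mul_avg₁ 1 (μ s, s)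
  have b2 := f.avg₁_add_avg₂ 1 (μ s, s)
  simp only [ey, ew] at b1 b2
  have d1 : f.der 1 y =
      f.avg₁ 1 (μ s, s) + s ^ 2 * f.avg₂ 3 (μ s, s) + s * f.avg₁ 2 (μ s, s) := by
    linear_combination -b1 - b2
  have hp : f.avg₁ 1 (μ s, s) = p := by rw [← slope_center hs0, ey, ew, hsl]
  have h2 := z3.self_of_nhds
  have e3 : f.endSum (μ s, s) * f.avg₂ 3 (μ s, s) = f.avg₁ 2 (μ s, s) ^ 2 := by
    rw [redDefect] at h2
    rw [endSum]
    linear_combination -h2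
  have e4 : f.endSum (μ s, s) = 2 * f.avg₁ 1 (μ s, s) + s ^ 2 * f.avg₂ 3 (μ s, s) := rfl
  have h5 : s * f.frontRate (μ s, s) * (f.endSum (μ s, s) + s * f.avg₁ 2 (μ s, s)) = 0 := by
    rw [d1, ← hp] at hnum
    rw [frontRate]
    have k1 : f.avg₁ 2 (μ s, s) / f.endSum (μ s, s) * f.endSum (μ s, s) = f.avg₁ 2 (μ s, s) :=
      div_mul_cancel₀ _ z4
    have k2 : f.avg₁ 2 (μ s, s) / f.endSum (μ s, s) * f.avg₁ 2 (μ s, s) = f.avg₂ 3 (μ s, s) := by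
      rw [div_mul_eq_mul_div, div_eq_iff z4]
      linear_combination -e3
    linear_combination hnum + s * k1 + s ^ 2 * k2 + s * f.centerRate (μ s, s) * e4
  exact mul_ne_zero (mul_ne_zero hs0 z6) z5 h5

end IncrDiffeo

/-! ### Generic functions: arcs of the horizon -/

theorem linearIndependent_pair_of_cross {v w : ℝ × ℝ} (h : v.1 * w.2 - v.2 * w.1 ≠ 0) :
    LinearIndependent ℝ ![v, w] := by
  rw [LinearIndependent.pair_iff]
  intro a b hab
  have h1 := congrArg Prod.fst hab
  have h2 := congrArg Prod.snd hab
  simp only [Prod.fst_add, Prod.snd_add, Prod.smul_fst, Prod.smul_snd, smul_eq_mul,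
    Prod.fst_zero, Prod.snd_zero] at h1 h2
  have ha : a * (v.1 * w.2 - v.2 * w.1) = 0 := by linear_combination w.2 * h1 - w.1 * h2
  have hb : b * (v.1 * w.2 - v.2 * w.1) = 0 := by linear_combination v.1 * h2 - v.2 * h1
  exact ⟨(mul_eq_zero.1 ha).resolve_right h, (mul_eq_zero.1 hb).resolve_right h⟩

section

variable {f : IncrDiffeo} {h : ℝ × ℝ × ℝ} {c : ℝ → ℝ × ℝ × ℝ}

theorem IsHorizonArc.exists_injOn_proj {T : Set ℝ} (hc : IsHorizonArc f h T c)
    (hd : deriv (fun t => (c t).2) 0 ≠ 0) : ∃ U ∈ 𝓝 (0 : ℝ), InjOn (fun t => (c t).2) U :=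
  exists_injOn_of_deriv_ne_zero
    ((contDiff_snd.contDiffAt.comp 0 hc.smooth.self_of_nhds).of_le (by simp)) hd

theorem IsHorizonArc.isSmoothPoint (hc : IsHorizonArc f h univ c) (hmeet : ¬ ∃ k, MeetAt f h k)
    (hh : h ∈ horizon f) (hd : deriv (fun t => (c t).2) 0 ≠ 0) : IsSmoothPoint f h := by
  obtain ⟨ε, hε⟩ := (hc.eventually_isContourParam hmeet hh (hc.exists_injOn_proj hd)).exists
  rw [inter_univ] at hε
  exact ⟨ε, c, hε, hd⟩

theorem IsHorizonArc.isEndOfSmoothArc (hc : IsHorizonArc f h (Ici 0) c)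
    (hmeet : ¬ ∃ k, MeetAt f h k) (hh : h ∈ horizon f) (hd : deriv (fun t => (c t).2) 0 ≠ 0) :
    IsEndOfSmoothArc f h := by
  obtain ⟨ε, hε, hpos⟩ := ((hc.eventually_isContourParam hmeet hh (hc.exists_injOn_proj hd)).and
    self_mem_nhdsWithin).exists
  have hpos' : (0 : ℝ) < ε := hpos
  have : Icc (-ε) ε ∩ Ici 0 = Icc 0 ε := by
    ext t
    simp only [mem_inter_iff, mem_Icc, mem_Ici]
    constructor
    · rintro ⟨⟨-, h2⟩, h3⟩; exact ⟨h3, h2⟩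
    · rintro ⟨h2, h3⟩; exact ⟨⟨by linarith, h3⟩, h2⟩
  rw [this] at hε
  exact ⟨ε, c, hε, hd⟩

theorem MeetAt.symm {k : ℝ × ℝ × ℝ} (hm : MeetAt f h k) : MeetAt f k h := by
  obtain ⟨h1, h2, h3, h4, h5⟩ := hm
  refine ⟨h2, h1, h3.symm, h4.symm, fun h6 => h5 ?_⟩
  rw [show h = (partner f k, k.2) from Prod.ext h6 h3, (mem_horizon_swap h2).2]

theorem IsHorizonArc.isTransversalDouble {k : ℝ × ℝ × ℝ} {d : ℝ → ℝ × ℝ × ℝ}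
    (hc : IsHorizonArc f h univ c) (hd : IsHorizonArc f k univ d) (hm : MeetAt f h k)
    (hnt : ¬ ∃ h k l, MeetAt f h k ∧ MeetAt f h l ∧ MeetAt f k l)
    (hcross : (deriv (fun t => (c t).2) 0).1 * (deriv (fun t => (d t).2) 0).2 -
      (deriv (fun t => (c t).2) 0).2 * (deriv (fun t => (d t).2) 0).1 ≠ 0) :
    IsTransversalDouble f h k := by
  obtain ⟨ε, hε⟩ := hc.eventually_isLocalParam.exists
  obtain ⟨δ, hδ⟩ := hd.eventually_isLocalParam.exists
  rw [inter_univ] at hε hδ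
  refine ⟨ε, δ, c, d, hε, hδ, linearIndependent_pair_of_cross hcross, ?_⟩
  have e : (fun t => (c t).2) '' Icc (-ε) ε ∪ (fun t => (d t).2) '' Icc (-δ) δ =
      Prod.snd '' (c '' Icc (-ε) ε ∪ d '' Icc (-δ) δ) := by
    rw [image_union, image_image, image_image]
  rw [e]
  have hmem : ∀ l, l ∈ horizon f → l.2 = h.2 → (l.1 = h.1 ∨ l.1 = partner f h) ∨
      (l.1 = k.1 ∨ l.1 = partner f k) := by
    intro l hl hlz
    by_contra! hcon
    exact hnt ⟨h, k, l, hm, ⟨hm.1, hl, hlz.symm, hcon.1⟩, hm.2.1, hl,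
      hm.2.2.1.symm.trans hlz.symm, hcon.2⟩
  have hpart : ∀ {l j : ℝ × ℝ × ℝ}, j ∈ horizon f → l.2 = j.2 → l.1 = partner f j →
      (partner f l, l.2) = j := by
    intro l j hj h1 h2
    rw [show l = (partner f j, j.2) from Prod.ext h2 h1, (mem_horizon_swap hj).2]
  apply image_snd_mem_nhdsWithin_contour
  intro l hl hlz
  have hlk : l.2 = k.2 := hlz.trans hm.2.2.1
  rcases hmem l hl hlz with (h1 | h1) | (h1 | h1)
  · left
    rw [show l = h from Prod.ext h1 hlz]
    exact mem_of_superset hε.mem_nhds subset_union_left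
  · right
    rw [hpart hm.1 hlz h1]
    exact mem_of_superset hε.mem_nhds subset_union_left
  · left
    rw [show l = k from Prod.ext h1 hlk]
    exact mem_of_superset hδ.mem_nhds subset_union_right
  · right
    rw [hpart hm.2.1 hlk h1]
    exact mem_of_superset hδ.mem_nhds subset_union_right

theorem IsOrdinaryCusp.mem_horizon (hh : IsOrdinaryCusp f h) : h ∈ horizon f := by
  obtain ⟨ε, c, ⟨hc, -⟩, -⟩ := hh
  rw [← hc.base]
  exact hc.subset ⟨0, ⟨by linarith [hc.pos], hc.pos.le⟩, rfl⟩

/-- If the horizon projects to a regular curve near `h`, then the projection of `h` is not an ordinary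
cusp. -/
theorem not_isOrdinaryCusp_of_curve {γ : ℝ → ℝ × ℝ} {θ : ℝ × ℝ × ℝ → ℝ} (hθ : ContDiffAt ℝ ∞ θ h)
    (hγ : ContDiffAt ℝ ∞ γ (θ h)) (hd : deriv γ (θ h) ≠ 0)
    (hcov : ∀ᶠ k in 𝓝[horizon f] h, k.2 = γ (θ k)) : ¬ IsOrdinaryCusp f h := by
  rintro ⟨ε, c, ⟨hc, -⟩, h0, hli⟩
  have hI : Icc (-ε) ε ∈ 𝓝 (0 : ℝ) := Icc_mem_nhds (neg_lt_zero.2 hc.pos) hc.pos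
  have hcs : ContDiffAt ℝ ∞ c 0 := hc.smooth.contDiffAt hI
  have ht : Tendsto c (𝓝 0) (𝓝[horizon f] h) := by
    refine tendsto_nhdsWithin_iff.2 ⟨?_, ?_⟩
    · have := hcs.continuousAt.tendsto
      rwa [hc.base] at this
    · filter_upwards [hI] with t ht
      exact hc.subset ⟨t, ht, rfl⟩
  have heq : (fun t => (c t).2) =ᶠ[𝓝 0] fun t => γ (θ (c t)) := ht.eventually hcov
  have e0 : θ (c 0) = θ h := by rw [hc.base]
  rw [heq.deriv_eq] at h0
  rw [heq.iteratedDeriv_eq 2, heq.iteratedDeriv_eq 3] at hli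
  have hθc : ContDiffAt ℝ ∞ (fun t => θ (c t)) 0 :=
    ContDiffAt.comp (g := θ) 0 (by rwa [hc.base]) hcs
  exact not_linearIndependent_of_comp (γ := γ) (θ := fun t => θ (c t))
    (by rw [e0]; exact_mod_cast contDiffAt_infty.1 hγ 3) (by exact_mod_cast contDiffAt_infty.1 hθc 3)
    (by rwa [e0]) h0 hli

end

namespace IncrDiffeo

variable {f : IncrDiffeo} {p q r x y w : ℝ}

theorem orbit_cases {h : ℝ × ℝ × ℝ} (hh : h ∈ horizon f) :
    (f.DiagOrbit h.2.1 h.2.2 h.1 ∧ partner f h = h.1) ∨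
      ∃ r, f.OffOrbit h.2.1 h.2.2 r h.1 (partner f h) := by
  by_cases heq : h.1 = partner f h
  · exact Or.inl ⟨diagOrbit_of_mem_horizon hh heq, heq.symm⟩
  · exact Or.inr ⟨_, offOrbit_of_mem_horizon hh heq⟩

theorem OffOrbit.dir_ne_zero (h : f.OffOrbit p q r y w) : ((r - 1, r * y - w) : ℝ × ℝ) ≠ 0 := by
  intro h0
  have h1 : r - 1 = 0 := congrArg Prod.fst h0
  have h2 : r * y - w = 0 := congrArg Prod.snd h0
  rw [sub_eq_zero.1 h1, one_mul] at h2
  exact h.sub_ne h2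

theorem IsOffArc.deriv_proj {c : ℝ → ℝ × ℝ} (hc : f.IsOffArc (y, w) c)
    (h : f.OffOrbit p q r y w) : deriv (fun t => (f.lift (c t)).2) 0 =
      (f.arcSpeed c 0 * p) • ((r - 1, r * y - w) : ℝ × ℝ) := by
  rw [(hc.hasDerivAt_proj h).self_of_nhds.deriv, hc.base, h.arcDir_eq, smul_smul]

theorem IsOffArc.deriv_proj_ne_zero {c : ℝ → ℝ × ℝ} (hc : f.IsOffArc (y, w) c)
    (h : f.OffOrbit p q r y w) (hK : f.der 2 y ≠ r ^ 3 * f.der 2 w) :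
    deriv (fun t => (f.lift (c t)).2) 0 ≠ 0 := by
  rw [hc.deriv_proj h]
  exact smul_ne_zero (mul_ne_zero (hc.arcSpeed_ne_zero h hK) h.p_pos.ne') h.dir_ne_zero

theorem IsGeneric.exists_isOffArc (hf : f.IsGeneric) (h : f.OffOrbit p q r y w) :
    ∃ c, f.IsOffArc (y, w) c ∧ (y ∈ Ioo (-1 : ℝ) 1 → w ∈ Ioo (-1 : ℝ) 1 →
      IsHorizonArc f (y, p, q) univ (fun t => f.lift (c t))) := by
  have hr := h.r_pos.ne'
  have hp := h.p_pos.ne'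
  have hyw := h.sub_ne
  set G₁ := 2 * p ^ 2 * (r - 1) / (y - w) - f.der 2 y * (p / r) with hG₁
  set G₂ := 2 * p ^ 2 * (r - 1) / (r * (y - w)) - p * r * f.der 2 w with hG₂
  have hne : G₂ * G₂ - -G₁ * G₁ ≠ 0 := by
    intro h0
    have e1 : G₁ = 0 := by nlinarith [sq_nonneg G₁, sq_nonneg G₂]
    have e2 : G₂ = 0 := by nlinarith [sq_nonneg G₁, sq_nonneg G₂]
    refine hf.regular _ _ _ _ _ h ⟨?_, ?_⟩
    · rw [hG₁] at e1
      field_simp at e1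
      rw [mul_zero, mul_eq_zero, or_iff_right hp] at e1
      linear_combination -e1
    · rw [hG₂] at e2
      field_simp at e2
      rw [mul_zero, mul_eq_zero, or_iff_right hp] at e2
      linear_combination -e2
  obtain ⟨c, hc, hT⟩ := h.exists_arc _ _ hne
  refine ⟨c, hc, fun hy hw => hT univ ?_⟩
  filter_upwards [continuousAt_fst.eventually (Icc_mem_nhds hy.1 hy.2),
    continuousAt_snd.eventually (Icc_mem_nhds hw.1 hw.2)] with z h1 h2
  exact ⟨fun _ => ⟨h1, h2⟩, fun _ => mem_univ _⟩

theorem mem_Ioo_of_ne {x : ℝ} (hx : x ∈ Icc (-1 : ℝ) 1) (h : ¬ (x = 1 ∨ x = -1)) :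
    x ∈ Ioo (-1 : ℝ) 1 :=
  ⟨hx.1.lt_of_ne' fun h1 => h (Or.inr h1), hx.2.lt_of_ne fun h1 => h (Or.inl h1)⟩

theorem eventually_Ici_iff {x : ℝ} (hx : x = 1 ∨ x = -1) :
    ∀ᶠ z in 𝓝 x, -x * (z - x) ∈ Ici (0 : ℝ) ↔ z ∈ Icc (-1 : ℝ) 1 := by
  rcases hx with rfl | rfl
  · filter_upwards [lt_mem_nhds (show (-1 : ℝ) < 1 by norm_num)] with z hz
    simp only [mem_Ici, mem_Icc]
    constructor
    · intro h; exact ⟨hz.le, by linarith⟩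
    · intro h; linarith [h.2]
  · filter_upwards [gt_mem_nhds (show (-1 : ℝ) < 1 by norm_num)] with z hz
    simp only [mem_Ici, mem_Icc]
    constructor
    · intro h; exact ⟨by linarith, hz.le⟩
    · intro h; linarith [h.1]

/-- At an endpoint the coordinate of the orbit that is `1` or `-1` is a regular parameter of the
horizon, by transversality to the boundary of the square. -/
theorem IsGeneric.exists_end_arc (hf : f.IsGeneric) (h : f.OffOrbit p q r y w)
    (hend : (y = 1 ∨ y = -1) ∨ (w = 1 ∨ w = -1)) :
    ∃ c, f.IsOffArc (y, w) c ∧ IsHorizonArc f (y, p, q) (Ici 0) (fun t => f.lift (c t)) := by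
  have hr := h.r_pos.ne'
  have hp := h.p_pos.ne'
  have hyw := h.sub_ne
  rcases hend with hy | hw
  · have hy0 : y ≠ 0 := by rcases hy with rfl | rfl <;> norm_num
    have hw := mem_Ioo_of_ne h.w_mem (hf.end_pair _ _ _ _ _ h hy)
    obtain ⟨c, hc, hT⟩ := h.exists_arc (-y) 0 (by
      rw [zero_mul, sub_zero]
      refine mul_ne_zero (neg_ne_zero.2 hy0) fun e => hf.end_transversal _ _ _ _ _ h hy ?_
      field_simp at e
      rw [mul_zero, mul_eq_zero, or_iff_right hp] at e
      linear_combination -e)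
    refine ⟨c, hc, hT _ ?_⟩
    filter_upwards [continuousAt_fst.eventually (eventually_Ici_iff hy),
      continuousAt_snd.eventually (Icc_mem_nhds hw.1 hw.2)] with z h1 h2
    rw [zero_mul, add_zero, h1]
    exact (and_iff_left h2).symm
  · have hw0 : w ≠ 0 := by rcases hw with rfl | rfl <;> norm_num
    have hy := mem_Ioo_of_ne h.y_mem (hf.end_pair _ _ _ _ _ h.swap hw)
    obtain ⟨c, hc, hT⟩ := h.exists_arc 0 (-w) (by
      rw [zero_mul, zero_sub]
      refine neg_ne_zero.2 (mul_ne_zero (neg_ne_zero.2 hw0) fun e =>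
        hf.end_transversal _ _ _ _ _ h.swap hw ?_)
      field_simp at e ⊢
      rw [mul_zero, mul_eq_zero, or_iff_right hp] at e
      linear_combination e)
    refine ⟨c, hc, hT _ ?_⟩
    filter_upwards [continuousAt_snd.eventually (eventually_Ici_iff hw),
      continuousAt_fst.eventually (Icc_mem_nhds hy.1 hy.2)] with z h1 h2
    rw [zero_mul, zero_add, h1]
    exact (and_iff_right h2).symm

theorem IsGeneric.end_fold_ne (hf : f.IsGeneric) (h : f.OffOrbit p q r y w)
    (hend : (y = 1 ∨ y = -1) ∨ (w = 1 ∨ w = -1)) : f.der 2 y ≠ r ^ 3 * f.der 2 w := by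
  rcases hend with hy | hw
  · exact hf.end_fold _ _ _ _ _ h hy
  · intro h1
    have hr := h.r_pos.ne'
    refine hf.end_fold _ _ _ _ _ h.swap hw ?_
    rw [h1]
    field_simp

theorem DiagOrbit.exists_full_arc (h : f.DiagOrbit p q x) (hS : f.schwarz x ≠ 0)
    (hx : x ∈ Ioo (-1 : ℝ) 1) : ∃ c : ℝ → ℝ × ℝ × ℝ, IsHorizonArc f (x, p, q) univ c ∧
      deriv (fun t => (c t).2) 0 = (f.der 2 x, f.der 2 x * x + 2 * f.der 1 x) := by
  have hT : ∀ᶠ t in 𝓝 (0 : ℝ), t ∈ univ ↔ x + 1 * t ∈ Icc (-1 : ℝ) 1 := by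
    have h1 : Tendsto (fun t : ℝ => x + 1 * t) (𝓝 0) (𝓝 x) := by
      have : Continuous fun t : ℝ => x + 1 * t := by fun_prop
      exact this.tendsto' _ _ (by simp)
    filter_upwards [h1.eventually (Icc_mem_nhds hx.1 hx.2)] with t ht
    exact ⟨fun _ => ht, fun _ => mem_univ _⟩
  obtain ⟨h1, h2⟩ := h.exists_arc hS 1 (by norm_num) univ hT
  refine ⟨_, h1, h2.deriv.trans (one_smul _ _)⟩

theorem DiagOrbit.exists_end_arc (h : f.DiagOrbit p q x) (hS : f.schwarz x ≠ 0)
    (hx : x = 1 ∨ x = -1) : ∃ c : ℝ → ℝ × ℝ × ℝ, IsHorizonArc f (x, p, q) (Ici 0) c ∧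
      deriv (fun t => (c t).2) 0 ≠ 0 := by
  have hxx : x * x = 1 := by rcases hx with rfl | rfl <;> norm_num
  have hT : ∀ᶠ t in 𝓝 (0 : ℝ), t ∈ Ici (0 : ℝ) ↔ x + -x * t ∈ Icc (-1 : ℝ) 1 := by
    have h1 : Tendsto (fun t : ℝ => x + -x * t) (𝓝 0) (𝓝 x) := by
      have : Continuous fun t : ℝ => x + -x * t := by fun_prop
      exact this.tendsto' _ _ (by simp)
    filter_upwards [h1.eventually (eventually_Ici_iff hx)] with t ht
    rw [← ht, add_sub_cancel_left, ← mul_assoc, neg_mul_neg, hxx, one_mul]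
  obtain ⟨h1, h2⟩ := h.exists_arc hS (-x) (by rw [neg_mul_neg, hxx]) _ hT
  refine ⟨_, h1, ?_⟩
  rw [h2.deriv]
  refine smul_ne_zero (neg_ne_zero.2 fun h0 => ?_) (diag_dir_ne_zero (f.der_one_pos h.mem))
  rw [h0] at hxx
  norm_num at hxx

end IncrDiffeo

/-! ### Generic functions: cusps and self-intersections -/

theorem contDiffAt_partner (f : IncrDiffeo) {h : ℝ × ℝ × ℝ} (hp : h.2.1 ≠ 0) :
    ContDiffAt ℝ ∞ (partner f) h := by
  have h1 : ContDiffAt ℝ ∞ (fun h : ℝ × ℝ × ℝ => f h.1) h := (f.smooth.comp contDiff_fst).contDiffAt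
  have h2 : ContDiffAt ℝ ∞ (fun h : ℝ × ℝ × ℝ => h.2.1) h := by fun_prop
  have h3 : ContDiffAt ℝ ∞ (fun h : ℝ × ℝ × ℝ => h.2.2) h := by fun_prop
  exact (((contDiffAt_const.div h2 hp).neg).mul h1).add (h3.div h2 hp)

namespace IncrDiffeo

variable {f : IncrDiffeo} {p q r x y w : ℝ}

theorem DiagOrbit.not_isOrdinaryCusp (h : f.DiagOrbit p q x) (hS : f.schwarz x ≠ 0) :
    ¬ IsOrdinaryCusp f (x, p, q) := by
  refine not_isOrdinaryCusp_of_curve (γ := curveL f) (θ := Prod.fst) contDiffAt_fst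
    f.contDiff_curveL.contDiffAt ?_ ?_
  · rw [(f.hasDerivAt_curveL x).deriv]
    exact diag_dir_ne_zero (f.der_one_pos h.mem)
  · exact (h.eventually_diag hS).mono fun k hk => (diagOrbit_iff.1 hk).2

theorem IsOffArc.not_isOrdinaryCusp {c : ℝ → ℝ × ℝ} (hc : f.IsOffArc (y, w) c)
    (h : f.OffOrbit p q r y w) (hK : f.der 2 y ≠ r ^ 3 * f.der 2 w) :
    ¬ IsOrdinaryCusp f (y, p, q) := by
  obtain ⟨θ, hθ, hθ0, hcov⟩ := hc.covers
  have hpart := h.mem_horizon.2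
  have hpairc : ContDiffAt ℝ ∞ (fun k : ℝ × ℝ × ℝ => (k.1, partner f k)) (y, p, q) :=
    contDiffAt_fst.prodMk (contDiffAt_partner f h.p_pos.ne')
  have hpair : Tendsto (fun k : ℝ × ℝ × ℝ => (k.1, partner f k)) (𝓝 (y, p, q)) (𝓝 (y, w)) := by
    have := hpairc.continuousAt.tendsto
    rwa [hpart] at this
  have hl : ContDiffAt ℝ ∞ (fun t => (f.lift (c t)).2) 0 :=
    contDiff_snd.contDiffAt.comp 0 (ContDiffAt.comp (g := f.lift) 0
      (f.contDiffAt_lift (by rw [hc.base]; exact h.ne)) hc.smooth.self_of_nhds)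
  refine not_isOrdinaryCusp_of_curve (γ := fun t => (f.lift (c t)).2)
    (θ := fun k => θ (k.1, partner f k)) (ContDiffAt.comp (g := θ) _ (by rwa [hpart]) hpairc)
    (by rwa [hpart, hθ0]) (by rw [hpart, hθ0]; exact hc.deriv_proj_ne_zero h hK) ?_
  rw [eventually_nhdsWithin_iff]
  have hev : ∀ᶠ z : ℝ × ℝ in 𝓝 (y, w), z.1 ≠ z.2 :=
    (continuousAt_fst.ne_iff_eventually_ne continuousAt_snd).1 h.ne
  filter_upwards [hpair.eventually hcov, hpair.eventually hev] with k h1 h2 hk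
  have ho := offOrbit_of_mem_horizon hk h2
  rw [h1 ho.defect_eq, lift, ho.slope_eq, ho.intercept_eq]

theorem slope_pos (hy : y ∈ Icc (-1 : ℝ) 1) (hw : w ∈ Icc (-1 : ℝ) 1) (hne : y ≠ w) :
    0 < f.slope (y, w) := by
  have hmono : StrictMonoOn f (Icc (-1) 1) :=
    strictMonoOn_of_deriv_pos (convex_Icc _ _) f.smooth.continuous.continuousOn fun x hx =>
      f.deriv_pos x (interior_subset hx)
  rw [slope]
  rcases lt_or_gt_of_ne hne with h | h
  · exact div_pos_of_neg_of_neg (sub_neg.2 (hmono hy hw h)) (sub_neg.2 h)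
  · exact div_pos (sub_pos.2 (hmono hw hy h)) (sub_pos.2 h)

/-- The orbits over singular points of the projection are isolated in the closed square of pairs
`(y, w)`, the diagonal included, and hence finite in number. -/
theorem IsGeneric.finite_cusp_orbits (hf : f.IsGeneric) :
    {z : ℝ × ℝ | ∃ p q r, f.OffOrbit p q r z.1 z.2 ∧
      f.der 2 z.1 = r ^ 3 * f.der 2 z.2}.Finite := by
  refine Set.finite_of_forall_eventually_notMem
    (isCompact_Icc (a := (-1 : ℝ)) (b := 1) |>.prod (isCompact_Icc (a := (-1 : ℝ)) (b := 1))) ?_ ?_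
  · rintro z ⟨p, q, r, h, -⟩
    exact ⟨h.y_mem, h.w_mem⟩
  rintro ⟨y, w⟩ ⟨hy, hw⟩
  simp only at hy hw
  by_cases hne : y = w
  · subst hne
    by_cases hS : f.schwarz y = 0
    · refine (hf.eventually_not_cusp hy hS).filter_mono nhdsWithin_le_nhds |>.mono ?_
      rintro z hz ⟨p, q, r, h, hK⟩
      exact hz p q r h hK
    · have hc : ContinuousAt (fun z : ℝ × ℝ =>
          f.redDefect ((z.1 + z.2) / 2, (z.1 - z.2) / 2)) (y, y) :=
        f.contDiff_redDefect.continuous.continuousAt.comp (by fun_prop)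
      refine (hc.eventually_ne (y := 0) ?_).filter_mono nhdsWithin_le_nhds |>.mono ?_
      · simp only
        rw [show (y + y) / 2 = y by ring, show (y - y) / 2 = 0 by ring, redDefect_zero]
        exact mul_ne_zero (by norm_num) hS
      · rintro z hz ⟨p, q, r, h, -⟩
        exact hz h.redDefect_eq
  have hp := slope_pos (f := f) hy hw hne
  have hd := f.der_one_pos hy
  by_cases h0 : f.defect (y, w) = 0
  · have ho := offOrbit_of_defect_eq_zero hy hw hne hp h0
    by_cases hK : f.cuspFun (y, w) = 0
    · have hK' := ho.cuspFun_eq_zero_iff.1 hK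
      obtain ⟨c, hc, -⟩ := hf.exists_isOffArc ho
      refine (hc.eventually_cuspFun_ne_zero ho (hf.regular _ _ _ _ _ ho) hK'
        (hf.cusp _ _ _ _ _ ho hK')).mono ?_
      rintro z hz ⟨p, q, r, h, hK⟩
      exact hz h.defect_eq (h.cuspFun_eq_zero_iff.2 hK)
    · have hc : ContinuousAt f.cuspFun (y, w) := by
        have h1 := (f.contDiffAt_slope (z := (y, w)) hne).continuousAt
        have h2 (i) : ContinuousAt (fun z : ℝ × ℝ => f.der i z.1) (y, w) :=
          ((f.continuous_der i).comp continuous_fst).continuousAt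
        have h3 : ContinuousAt (fun z : ℝ × ℝ => f.der 2 z.2) (y, w) :=
          ((f.continuous_der 2).comp continuous_snd).continuousAt
        exact (((h2 2).mul (h1.pow 2)).div (h2 1) hd.ne').sub
          ((((h2 1).pow 2).mul h3).div h1 hp.ne')
      refine (hc.eventually_ne hK).filter_mono nhdsWithin_le_nhds |>.mono ?_
      rintro z hz ⟨p, q, r, h, hK⟩
      exact hz (h.cuspFun_eq_zero_iff.2 hK)
  · have hc : ContinuousAt f.defect (y, w) := (f.contDiffAt_defect (z := (y, w)) hne).continuousAt
    refine (hc.eventually_ne h0).filter_mono nhdsWithin_le_nhds |>.mono ?_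
    rintro z hz ⟨p, q, r, h, -⟩
    exact hz h.defect_eq

theorem IsGeneric.finite_cusps (hf : f.IsGeneric) : {h | IsOrdinaryCusp f h}.Finite := by
  refine ((hf.finite_flipSet.image fun y => (y, curveL f y)).union
    (hf.finite_cusp_orbits.image f.lift)).subset fun h hh => ?_
  have hc : IsOrdinaryCusp f h := hh
  rcases orbit_cases hc.mem_horizon with ⟨hd, -⟩ | ⟨r, ho⟩
  · left
    refine ⟨h.1, mem_flipSet_iff.2 ⟨hd.mem, ?_⟩, Prod.ext rfl (diagOrbit_iff.1 hd).2.symm⟩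
    by_contra hS
    exact hd.not_isOrdinaryCusp hS hc
  · right
    refine ⟨(h.1, partner f h), ⟨_, _, _, ho, ?_⟩, ?_⟩
    · by_contra hK
      obtain ⟨c, hcc, -⟩ := hf.exists_isOffArc ho
      exact hcc.not_isOrdinaryCusp ho hK hc
    · rw [lift, ho.slope_eq, ho.intercept_eq]

theorem IsGeneric.isOrdinaryCusp (hf : f.IsGeneric) (h : f.OffOrbit p q r y w)
    (hy : y ∈ Ioo (-1 : ℝ) 1) (hw : w ∈ Ioo (-1 : ℝ) 1) (hK : f.der 2 y = r ^ 3 * f.der 2 w)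
    (hmeet : ¬ ∃ k, MeetAt f (y, p, q) k) : IsOrdinaryCusp f (y, p, q) := by
  obtain ⟨c, hc, hT⟩ := hf.exists_isOffArc h
  have hreg := hf.regular _ _ _ _ _ h
  have hn0 := hc.arcNum_eq_zero h hreg hK
  have hn1 := hc.deriv_arcNum_ne_zero h hreg hK (hf.cusp _ _ _ _ _ h hK)
  obtain ⟨h1, h2, h3⟩ := cusp_of_front (hc.hasDerivAt_proj h)
    (by exact_mod_cast contDiffAt_infty.1 (hc.contDiffAt_arcSpeed h) 2)
    (by exact_mod_cast contDiffAt_infty.1 (hc.contDiffAt_arcDir h) 2)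
    ((hc.arcSpeed_eq_zero_iff h).2 hn0) (hc.deriv_arcSpeed_ne_zero h hn0 hn1)
    (hc.cross_ne_zero h hreg hK)
  obtain ⟨ε, hε⟩ := ((hT hy hw).eventually_isContourParam hmeet h.mem_horizon.1 h3).exists
  rw [inter_univ] at hε
  exact ⟨ε, _, hε, h1, h2⟩

theorem IsGeneric.classification (hf : f.IsGeneric) {h : ℝ × ℝ × ℝ} (hh : h ∈ horizon f)
    (hend : ¬ IsOverEndpoint f h) (hmeet : ¬ ∃ k, MeetAt f h k) :
    IsSmoothPoint f h ∨ IsOrdinaryCusp f h ∨ (h.1 ∈ flipSet f ∧ h.2 = curveL f h.1) := by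
  have hy : ¬ (h.1 = 1 ∨ h.1 = -1) := fun h1 =>
    hend ⟨hh, h1.elim Or.inl fun h2 => Or.inr (Or.inl h2)⟩
  have hw : ¬ (partner f h = 1 ∨ partner f h = -1) := fun h1 => hend ⟨hh, Or.inr (Or.inr h1)⟩
  rcases orbit_cases hh with ⟨hd, -⟩ | ⟨r, ho⟩
  · by_cases hS : f.schwarz h.1 = 0
    · exact Or.inr (Or.inr ⟨mem_flipSet_iff.2 ⟨hd.mem, hS⟩, (diagOrbit_iff.1 hd).2⟩)
    · obtain ⟨c, hc, hcd⟩ := hd.exists_full_arc hS (mem_Ioo_of_ne hd.mem hy)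
      refine Or.inl (hc.isSmoothPoint hmeet hh ?_)
      rw [hcd]
      exact diag_dir_ne_zero (f.der_one_pos hd.mem)
  · have hyo := mem_Ioo_of_ne ho.y_mem hy
    have hwo := mem_Ioo_of_ne ho.w_mem hw
    by_cases hK : f.der 2 h.1 = r ^ 3 * f.der 2 (partner f h)
    · exact Or.inr (Or.inl (hf.isOrdinaryCusp ho hyo hwo hK hmeet))
    · obtain ⟨c, hc, hT⟩ := hf.exists_isOffArc ho
      exact Or.inl ((hT hyo hwo).isSmoothPoint hmeet hh (hc.deriv_proj_ne_zero ho hK))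

theorem IsGeneric.no_triple (hf : f.IsGeneric) :
    ¬ ∃ h k l, MeetAt f h k ∧ MeetAt f h l ∧ MeetAt f k l := by
  -- two orbits with one element over the same point coincide
  have hdd : ∀ {h k}, MeetAt f h k → f.DiagOrbit h.2.1 h.2.2 h.1 →
      ¬ f.DiagOrbit k.2.1 k.2.2 k.1 := fun {h k} hm h1 h2 => by
    rw [← hm.2.2.1] at h2
    exact hm.2.2.2.1 (h2.unique h1)
  have hdo : ∀ {h k l r r'}, MeetAt f h k → MeetAt f h l → MeetAt f k l →
      f.DiagOrbit h.2.1 h.2.2 h.1 → f.OffOrbit k.2.1 k.2.2 r k.1 (partner f k) →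
      ¬ f.OffOrbit l.2.1 l.2.2 r' l.1 (partner f l) := fun {h k l r r'} h1 h2 h3 a1 a2 a3 => by
    rw [← h1.2.2.1] at a2
    rw [← h2.2.2.1] at a3
    exact h3.2.2.2.2 (hf.diag_triple _ _ _ _ _ _ _ _ _ a1 a2 a3 h3.2.2.2.1)
  rintro ⟨h, k, l, h1, h2, h3⟩
  rcases orbit_cases h1.1 with ⟨a1, -⟩ | ⟨r, a1⟩ <;> rcases orbit_cases h3.1 with ⟨a2, -⟩ | ⟨r', a2⟩ <;>
    rcases orbit_cases h3.2.1 with ⟨a3, -⟩ | ⟨r'', a3⟩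
  · exact hdd h1 a1 a2
  · exact hdd h1 a1 a2
  · exact hdd h2 a1 a3
  · exact hdo h1 h2 h3 a1 a2 a3
  · exact hdd h3 a2 a3
  · exact hdo h1.symm h3 h2 a2 a1 a3
  · exact hdo h2.symm h3.symm h1 a3 a1 a2
  · rw [← h1.2.2.1] at a2
    rw [← h2.2.2.1] at a3
    have := hf.triple _ _ _ _ _ _ _ _ _ _ _ a1 a2 a3 h1.2.2.2.1 h1.2.2.2.2 h2.2.2.2.1 h2.2.2.2.2
      h3.2.2.2.1
    exact h3.2.2.2.2 this

theorem IsGeneric.not_meetAt_of_endpoint (hf : f.IsGeneric) {h : ℝ × ℝ × ℝ}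
    (hend : IsOverEndpoint f h) : ¬ ∃ k, MeetAt f h k := by
  rintro ⟨k, hm⟩
  obtain ⟨hh, he⟩ := hend
  rcases orbit_cases hh with ⟨a1, hp⟩ | ⟨r, a1⟩ <;> rcases orbit_cases hm.2.1 with ⟨a2, -⟩ | ⟨r', a2⟩
  all_goals rw [← hm.2.2.1] at a2
  · exact hm.2.2.2.1 (a2.unique a1)
  · rw [hp] at he
    exact hf.diag_end _ _ _ _ _ _ a1 a2 (by tauto)
  · rcases he with he | he | he
    · exact hf.diag_off_end _ _ _ _ _ _ a2 a1 (Or.inl he)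
    · exact hf.diag_off_end _ _ _ _ _ _ a2 a1 (Or.inr he)
    · exact hf.diag_off_end _ _ _ _ _ _ a2 a1.swap he
  · rcases he with he | he | he
    · exact hf.double_end _ _ _ _ _ _ _ _ a1 a2 hm.2.2.2.1 hm.2.2.2.2 (Or.inl he)
    · exact hf.double_end _ _ _ _ _ _ _ _ a1 a2 hm.2.2.2.1 hm.2.2.2.2 (Or.inr he)
    · exact hf.double_end _ _ _ _ _ _ _ _ a1.swap a2 hm.2.2.2.2 hm.2.2.2.1 he

theorem IsGeneric.isEndOfSmoothArc (hf : f.IsGeneric) {h : ℝ × ℝ × ℝ}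
    (hend : IsOverEndpoint f h) : IsEndOfSmoothArc f h := by
  have hmeet := hf.not_meetAt_of_endpoint hend
  obtain ⟨hh, he⟩ := hend
  rcases orbit_cases hh with ⟨hd, hp⟩ | ⟨r, ho⟩
  · rw [hp] at he
    have he' : h.1 = 1 ∨ h.1 = -1 := by tauto
    obtain ⟨c, hc, hcd⟩ := hd.exists_end_arc (hf.schwarz_ne _ he') he'
    exact hc.isEndOfSmoothArc hmeet hh hcd
  · have he' : (h.1 = 1 ∨ h.1 = -1) ∨ (partner f h = 1 ∨ partner f h = -1) := by tauto
    obtain ⟨c, hc, hT⟩ := hf.exists_end_arc ho he'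
    exact hT.isEndOfSmoothArc hmeet hh (hc.deriv_proj_ne_zero ho (hf.end_fold_ne ho he'))

/-- At a self-intersection, an orbit with two elements lies on a regular arc. -/
theorem IsGeneric.exists_arc_of_meetAt_off (hf : f.IsGeneric) {h k : ℝ × ℝ × ℝ} (hm : MeetAt f h k)
    (ho : f.OffOrbit h.2.1 h.2.2 r h.1 (partner f h)) :
    ∃ (c : ℝ → ℝ × ℝ × ℝ) (κ : ℝ), κ ≠ 0 ∧ IsHorizonArc f h univ c ∧
      deriv (fun t => (c t).2) 0 = κ • ((r - 1, r * h.1 - partner f h) : ℝ × ℝ) := by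
  have hend : ¬ IsOverEndpoint f h := fun he => hf.not_meetAt_of_endpoint he ⟨k, hm⟩
  have hy := mem_Ioo_of_ne ho.y_mem fun h1 =>
    hend ⟨hm.1, h1.elim Or.inl fun h2 => Or.inr (Or.inl h2)⟩
  have hw := mem_Ioo_of_ne ho.w_mem fun h1 => hend ⟨hm.1, Or.inr (Or.inr h1)⟩
  have hK : f.der 2 h.1 ≠ r ^ 3 * f.der 2 (partner f h) := by
    rcases orbit_cases hm.2.1 with ⟨a2, -⟩ | ⟨r', a2⟩
    · rw [← hm.2.2.1] at a2
      exact hf.diag_fold _ _ _ _ _ _ a2 ho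
    · rw [← hm.2.2.1] at a2
      exact hf.double_fold _ _ _ _ _ _ _ _ ho a2 hm.2.2.2.1 hm.2.2.2.2
  obtain ⟨c, hc, hT⟩ := hf.exists_isOffArc ho
  exact ⟨_, _, mul_ne_zero (hc.arcSpeed_ne_zero ho hK) ho.p_pos.ne', hT hy hw, hc.deriv_proj ho⟩

theorem IsGeneric.exists_arc_of_diag_double (hf : f.IsGeneric) {h : ℝ × ℝ × ℝ} {y w : ℝ}
    (hd : f.DiagOrbit h.2.1 h.2.2 h.1) (ho : f.OffOrbit h.2.1 h.2.2 r y w) :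
    ∃ c : ℝ → ℝ × ℝ × ℝ, IsHorizonArc f h univ c ∧
      deriv (fun t => (c t).2) 0 = (f.der 2 h.1, f.der 2 h.1 * h.1 + 2 * f.der 1 h.1) :=
  hd.exists_full_arc (hf.diag_schwarz _ _ _ _ _ _ hd ho)
    (mem_Ioo_of_ne hd.mem (hf.diag_end _ _ _ _ _ _ hd ho))

theorem IsGeneric.isTransversalDouble (hf : f.IsGeneric) {h k : ℝ × ℝ × ℝ} (hm : MeetAt f h k) :
    IsTransversalDouble f h k := by
  rcases orbit_cases hm.1 with ⟨a1, -⟩ | ⟨r, a1⟩ <;> rcases orbit_cases hm.2.1 with ⟨a2, -⟩ | ⟨r', a2⟩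
  · rw [← hm.2.2.1] at a2
    exact absurd (a2.unique a1) hm.2.2.2.1
  · have a2' := a2
    rw [← hm.2.2.1] at a2'
    obtain ⟨c, hc, hcd⟩ := hf.exists_arc_of_diag_double a1 a2'
    obtain ⟨d, κ, hκ, hd, hdd⟩ := hf.exists_arc_of_meetAt_off hm.symm a2
    refine hc.isTransversalDouble hd hm hf.no_triple ?_
    rw [hcd, hdd]
    intro h0
    have h1 := mul_ne_zero hκ (sub_ne_zero.2 (hf.diag_tangent _ _ _ _ _ _ a1 a2'))
    rw [← a1.der_eq] at h1
    refine h1 ?_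
    simp only [Prod.smul_mk, smul_eq_mul] at h0
    linear_combination h0
  · have a2' := a2
    rw [← hm.2.2.1] at a2'
    obtain ⟨c, κ, hκ, hc, hcd⟩ := hf.exists_arc_of_meetAt_off hm a1
    obtain ⟨d, hd, hdd⟩ := hf.exists_arc_of_diag_double a2 (hm.2.2.1 ▸ a1)
    refine hc.isTransversalDouble hd hm hf.no_triple ?_
    rw [hcd, hdd]
    intro h0
    have h1 := mul_ne_zero hκ (sub_ne_zero.2 (hf.diag_tangent _ _ _ _ _ _ a2' a1))
    rw [← a2'.der_eq] at h1
    refine h1 ?_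
    simp only [Prod.smul_mk, smul_eq_mul] at h0
    linear_combination -h0
  · obtain ⟨c, κ, hκ, hc, hcd⟩ := hf.exists_arc_of_meetAt_off hm a1
    obtain ⟨d, κ', hκ', hd, hdd⟩ := hf.exists_arc_of_meetAt_off hm.symm a2
    refine hc.isTransversalDouble hd hm hf.no_triple ?_
    rw [hcd, hdd]
    intro h0
    rw [← hm.2.2.1] at a2
    have h1 := mul_ne_zero (mul_ne_zero hκ hκ')
      (hf.double_tangent _ _ _ _ _ _ _ _ a1 a2 hm.2.2.2.1 hm.2.2.2.2)
    refine h1 ?_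
    simp only [Prod.smul_mk, smul_eq_mul] at h0
    linear_combination h0

end IncrDiffeo

theorem proposition4 :
    ∀ᶠ f : IncrDiffeo in residual IncrDiffeo,
      -- the ordinary cusps and the codimension-2 flips are finite in number
      {h | IsOrdinaryCusp f h}.Finite ∧
      (flipSet f).Finite ∧
      (∀ y ∈ flipSet f, IsCodimTwoFlip f y) ∧
      -- away from endpoints and self-intersections: smooth arcs, cusps and flips only
      (∀ h ∈ horizon f, ¬ IsOverEndpoint f h → (¬ ∃ k, MeetAt f h k) →
        IsSmoothPoint f h ∨ IsOrdinaryCusp f h ∨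
          (h.1 ∈ flipSet f ∧ h.2 = curveL f h.1)) ∧
      -- self-intersections are transversal crossings of two smooth arcs
      (∀ h k, MeetAt f h k → IsTransversalDouble f h k) ∧
      -- there are no triple points
      (¬ ∃ h k l, MeetAt f h k ∧ MeetAt f h l ∧ MeetAt f k l) ∧
      -- endpoints are neither self-intersections nor singular points
      (∀ h, IsOverEndpoint f h → (¬ ∃ k, MeetAt f h k) ∧ IsEndOfSmoothArc f h) := by
  filter_upwards [residual_isGeneric] with f hf
  exact ⟨hf.finite_cusps, hf.finite_flipSet, fun y hy => hf.isCodimTwoFlip hy,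
    fun h hh hend hmeet => hf.classification hh hend hmeet,
    fun h k hm => hf.isTransversalDouble hm, hf.no_triple,
    fun h hend => ⟨hf.not_meetAt_of_endpoint hend, hf.isEndOfSmoothArc hend⟩⟩
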